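/- **Setting.** Let $\Theta\subset\mathbb R$ be open, $\theta_0\in\Theta$, let $P_\theta$ ($\theta\in\Theta$) be probability measures on a measurable space, and put $P=P_{\theta_0}$, $s_n=1/\sqrt n$; $\|\cdot\|$ and $\langle\cdot|\cdot\rangle$ are norm and inner product of $L_2(P)$, and $E$ is expectation under $P$. For $g\in L_2(P)$ and probabilities $Q_n$ write $dQ_n\approx(1+s_ng)\,dP$ if $n\int\bigl(\sqrt{dQ_n}-(1+\tfrac12 s_ng)\sqrt{dP}\bigr)^2\to0$. Let $\Lambda\in L_2(P)$ be a measurable function with $E\Lambda=0$, let $\tau>0$, and suppose $dP_{\theta_0+s_n\tau}\approx(1+s_n\tau\Lambda)\,dP$. Let $r_0,r_1>0$, $\alpha\in(0,1)$, and let $u_\alpha$ be given by $\Phi(-u_\alpha)=\alpha$, $\Phi$ the standard normal distribution function. For every $g\in L_2(P)$ with $Eg=0$ let probabilities $P_{n,g}$ with $dP_{n,g}\approx(1+s_ng)\,dP$ be given. Put $G_c=\{g\in L_2(P): Eg=0,\ g\ge-1\ P\text{-a.e.}\}$, $G_{c,0}=r_0G_c$, $G_{c,1}=\tau\Lambda+r_1G_c$.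 A test $\delta=(\delta_n)$ is a sequence of measurable functions $\delta_n$ of $x_1,\dots,x_n$ with values in $[0,1]$. Two tests *coincide asymptotically* if their difference tends to $0$ in $P^n$-probability. The *maxmin test* of $H_c$ vs. $K_c$ maximizes $\inf_{g_1\in G_{c,1}}\liminf_n\int\delta_n\,dP_{n,g_1}^n$ among all tests with $\sup_{g_0\in G_{c,0}}\limsup_n\int\delta_n\,dP_{n,g_0}^n\le\alpha$; the maximum is the *maxmin asymptotic power*. A pair $(g_0,g_1)\in G_{c,0}\times G_{c,1}$ and a test $\delta$ form a *saddle point* if $\delta$ maximizes $\liminf_n\int\delta_n\,dP_{n,g_1}^n$ subject to $\limsup_n\int\delta_n\,dP_{n,g_0}^n\le\alpha$, while $\limsup_n\int\delta_n\,dP_{n,h_0}^n\le\limsup_n\int\delta_n\,dP_{n,g_0}^n$ for all $h_0\in G_{c,0}$ and $\liminf_n\int\delta_n\,dP_{n,h_1}^n\ge\liminf_n\int\delta_n\,dP_{n,g_1}^n$ for all $h_1\in G_{c,1}$. A pair is *least favorable* if it belongs to a saddle point. For a pair $g=(g_0,g_1)$ and $g_{10}=g_1-g_0$ put $\delta_{n,g}=\mathbf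 1\bigl(s_n\sum_{i\le n}g_{10}(x_i)>\|g_{10}\|u_\alpha+\langle g_{10}|g_0\rangle\bigr)$. For a probability $Q$ and $0\le\varepsilon\le1$ let $U_c(Q;\varepsilon)=\{(1-\varepsilon)Q+\varepsilon M: M\text{ any probability}\}$, and (for large $n$) $\mathcal U_{n,0}=U_c(P_{\theta_0};r_0/\sqrt n)$, $\mathcal U_{n,1}=U_c(P_{\theta_0+\tau/\sqrt n};r_1/\sqrt n)$. A *least favorable probability pair* for $\mathcal U_{n,0}$ vs. $\mathcal U_{n,1}$ consists of $Q_0\in\mathcal U_{n,0}$, $Q_1\in\mathcal U_{n,1}$ with $dQ_1=\pi\,dQ_0$ for some measurable $\pi\ge0$ such that $Q_0(\pi>t)\ge Q'(\pi>t)$ and $Q_1(\pi>t)\le Q''(\pi>t)$ for all $Q'\in\mathcal U_{n,0}$, $Q''\in\mathcal U_{n,1}$, $0<t<\infty$. A *robust asymptotic test based on least favorable probability pairs* is a test $\varphi$ for which there are, for all large $n$, such pairs $(Q_{n,0},Q_{n,1})$ with ratios $\pi_n$, and constants $k_n\in[0,\infty]$, with $\varphi_n=1$ where $\prod_{i\le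 n}\pi_n(x_i)>k_n$, $\varphi_n=0$ where $\prod_{i\le n}\pi_n(x_i)<k_n$, and $\int\varphi_n\,dQ_{n,0}^n\to\alpha$. **Theorem.** Assume $r_0<E\bigl(\tau\Lambda-(r_1-r_0)\bigr)_+$. a) There are unique real constants $c',c''$ such that the functions $$q_{c,0}=\tau(\Lambda-c'')_+-r_0,\qquad q_{c,1}=\tau\Lambda+\tau(c'-\Lambda)_+-r_1$$ satisfy $Eq_{c,0}=Eq_{c,1}=0$, and $c'<z:=(r_1-r_0)/\tau<c''$. The pair $q_c=(q_{c,0},q_{c,1})$ is the unique least favorable tangent pair in $G_{c,0}\times G_{c,1}$, and also the unique pair in $G_{c,0}\times G_{c,1}$ with $q_{c,1}-q_{c,0}$ of minimal norm in $G_{c,1}-G_{c,0}$. With $\Lambda^{(c)}=c'\vee\Lambda\wedge c''-z$, the test $$\delta_n=\mathbf 1\Bigl(s_n\sum_{i=1}^n\Lambda^{(c)}(x_i)>\|\Lambda^{(c)}\|\,u_\alpha+r_0(c''-z)\Bigr)$$ equals $\delta_{n,q_c}$ $P^n$-a.e. for every $n$, forms a saddle point together with $q_c$, and is the maxmin test of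 $H_c$ vs. $K_c$, every other maxmin test coinciding with it asymptotically; the maxmin asymptotic power is $\Phi\bigl(-u_\alpha+\tau\|\Lambda^{(c)}\|\bigr)$. b) Robust asymptotic tests based on least favorable probability pairs for $\mathcal U_{n,0}$ vs. $\mathcal U_{n,1}$ exist, and each of them coincides asymptotically with $\delta$. Moreover $\delta$ maximizes the asymptotic minimum power $\liminf_n\inf_{Q\in\mathcal U_{n,1}}\int\delta_n\,dQ^n$ among all tests with asymptotic maximum size $\limsup_n\sup_{Q\in\mathcal U_{n,0}}\int\delta_n\,dQ^n\le\alpha$. -/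

import Mathlib

open MeasureTheory ProbabilityTheory Filter Topology
open scoped ENNReal

namespace RobustTest

noncomputable section

/-! ### Local alternatives -/

/-- The squared Hellinger-type distance `∫ (√dQ - (1 + f/2) √dP)²`; with respect to `P`, the measure
`Q` splits into its density `dQ/dP` and its singular part, and only the latter lives where `dP`
vanishes. -/
def hellingerDefect {Ω : Type*} [MeasurableSpace Ω] (P Q : Measure Ω) (f : Ω → ℝ) : ℝ≥0∞ :=
  ∫⁻ x, ENNReal.ofReal ((√((Q.rnDeriv P x).toReal) - (1 + f x / 2)) ^ 2) ∂P
    + Q.singularPart P Set.univ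

/-- `dQₙ ≈ (1 + sₙ g) dP` with `sₙ = 1/√n`: root densities agree in `L₂` up to an error `o(sₙ)`. -/
def HasTangent {Ω : Type*} [MeasurableSpace Ω] (P : Measure Ω) (Q : ℕ → Measure Ω)
    (g : Ω → ℝ) : Prop :=
  Tendsto (fun n : ℕ => (n : ℝ≥0∞) * hellingerDefect P (Q n) (fun x => g x / √n)) atTop (𝓝 0)

/-- The contamination tangent ball `G_c`: all `g ∈ L₂(P)` with `E g = 0` and `g ≥ -1`. -/
def contaminationTangents {Ω : Type*} [MeasurableSpace Ω] (P : Measure Ω) : Set (Lp ℝ 2 P) :=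
  {g | ∫ x, g x ∂P = 0 ∧ ∀ᵐ x ∂P, -1 ≤ g x}

/-- The null tangents `r₀ G_c`. -/
def nullTangents {Ω : Type*} [MeasurableSpace Ω] (P : Measure Ω) (r₀ : ℝ) : Set (Lp ℝ 2 P) :=
  (fun h => r₀ • h) '' contaminationTangents P

/-- The alternative tangents `τ Λ + r₁ G_c`. -/
def altTangents {Ω : Type*} [MeasurableSpace Ω] (P : Measure Ω) (Λ : Lp ℝ 2 P) (τ r₁ : ℝ) :
    Set (Lp ℝ 2 P) :=
  (fun h => τ • Λ + r₁ • h) '' contaminationTangents P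

/-! ### Sequences of (randomized) tests -/

/-- `δ n` is the test at sample size `n`. -/
abbrev TestSeq (Ω : Type*) := (n : ℕ) → (Fin n → Ω) → ℝ

def IsTest {Ω : Type*} [MeasurableSpace Ω] (δ : TestSeq Ω) : Prop :=
  ∀ n, Measurable (δ n) ∧ ∀ x, δ n x ∈ Set.Icc (0 : ℝ) 1

/-- The rejection probability `∫ δ dQⁿ` for `n` i.i.d. observations from `Q`. -/
def rejectionProb {Ω : Type*} [MeasurableSpace Ω] {n : ℕ} (δ : (Fin n → Ω) → ℝ)
    (Q : Measure Ω) : ℝ≥0∞ :=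
  ∫⁻ x, ENNReal.ofReal (δ x) ∂(Measure.pi fun _ : Fin n => Q)

/-- `limsup ∫ δₙ dQₙⁿ`. -/
def asySize {Ω : Type*} [MeasurableSpace Ω] (δ : TestSeq Ω) (Q : ℕ → Measure Ω) : ℝ≥0∞ :=
  limsup (fun n => rejectionProb (δ n) (Q n)) atTop

/-- `liminf ∫ δₙ dQₙⁿ`. -/
def asyPower {Ω : Type*} [MeasurableSpace Ω] (δ : TestSeq Ω) (Q : ℕ → Measure Ω) : ℝ≥0∞ :=
  liminf (fun n => rejectionProb (δ n) (Q n)) atTop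

/-- Two sequences of tests agree up to terms tending to `0` in `Pⁿ`-probability. -/
def AsyEqual {Ω : Type*} [MeasurableSpace Ω] (P : Measure Ω) (δ δ' : TestSeq Ω) : Prop :=
  ∀ ε : ℝ, 0 < ε →
    Tendsto (fun n => (Measure.pi fun _ : Fin n => P) {x | ε ≤ |δ n x - δ' n x|}) atTop (𝓝 0)

/-- `δ` solves the simple asymptotic testing problem `(Q₀ₙ)` against `(Q₁ₙ)` at level `α`. -/
def IsOptimalSimple {Ω : Type*} [MeasurableSpace Ω] (α : ℝ) (Q₀ Q₁ : ℕ → Measure Ω)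
    (δ : TestSeq Ω) : Prop :=
  IsTest δ ∧ asySize δ Q₀ ≤ ENNReal.ofReal α ∧
    ∀ δ' : TestSeq Ω, IsTest δ' → asySize δ' Q₀ ≤ ENNReal.ofReal α → asyPower δ' Q₁ ≤ asyPower δ Q₁

/-! ### The maxmin asymptotic testing problem between two sets of tangents

`law g n` is the law `P_{n,g}` of a single observation at sample size `n` along the tangent `g`. -/

/-- `δ` maximizes `inf_{g₁ ∈ G₁} liminf ∫ δₙ dP_{n,g₁}ⁿ` subject to
`sup_{g₀ ∈ G₀} limsup ∫ δₙ dP_{n,g₀}ⁿ ≤ α`. -/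
def IsMaxminTest {Ω T : Type*} [MeasurableSpace Ω] (law : T → ℕ → Measure Ω) (G₀ G₁ : Set T)
    (α : ℝ) (δ : TestSeq Ω) : Prop :=
  IsTest δ ∧ (⨆ g ∈ G₀, asySize δ (law g)) ≤ ENNReal.ofReal α ∧
    ∀ δ' : TestSeq Ω, IsTest δ' → (⨆ g ∈ G₀, asySize δ' (law g)) ≤ ENNReal.ofReal α →
      (⨅ g ∈ G₁, asyPower δ' (law g)) ≤ ⨅ g ∈ G₁, asyPower δ (law g)

/-- `((g₀, g₁), δ)` is a saddle point: `δ` is optimal for the simple problem `g₀` against `g₁`, and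
among `G₀ × G₁` the pair `(g₀, g₁)` makes the size of `δ` largest and its power smallest. -/
def IsSaddlePoint {Ω T : Type*} [MeasurableSpace Ω] (law : T → ℕ → Measure Ω) (G₀ G₁ : Set T)
    (α : ℝ) (g₀ g₁ : T) (δ : TestSeq Ω) : Prop :=
  g₀ ∈ G₀ ∧ g₁ ∈ G₁ ∧ IsOptimalSimple α (law g₀) (law g₁) δ ∧
    (∀ h ∈ G₀, asySize δ (law h) ≤ asySize δ (law g₀)) ∧
    (∀ h ∈ G₁, asyPower δ (law g₁) ≤ asyPower δ (law h))

/-- A least favorable tangent pair: one that belongs to a saddle point. -/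
def IsLeastFavorableTangentPair {Ω T : Type*} [MeasurableSpace Ω] (law : T → ℕ → Measure Ω)
    (G₀ G₁ : Set T) (α : ℝ) (g₀ g₁ : T) : Prop :=
  ∃ δ : TestSeq Ω, IsSaddlePoint law G₀ G₁ α g₀ g₁ δ

/-- The difference `g₁ - g₀` has minimal norm in `G₁ - G₀`. -/
def IsMinNormPair {E : Type*} [NormedAddCommGroup E] (G₀ G₁ : Set E) (g₀ g₁ : E) : Prop :=
  g₀ ∈ G₀ ∧ g₁ ∈ G₁ ∧ ∀ h₀ ∈ G₀, ∀ h₁ ∈ G₁, ‖g₁ - g₀‖ ≤ ‖h₁ - h₀‖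

/-- The test `δ_{n,g} = 1(sₙ ∑ g₁₀(xᵢ) > ‖g₁₀‖ u + ⟨g₁₀ | g₀⟩)`, where `g₁₀ = g₁ - g₀`. -/
def tangentTest {Ω : Type*} [MeasurableSpace Ω] {P : Measure Ω} (g₀ g₁ : Lp ℝ 2 P) (u : ℝ) :
    TestSeq Ω :=
  open Classical in fun n x =>
    if ‖g₁ - g₀‖ * u + inner ℝ (g₁ - g₀) g₀ < (√n)⁻¹ * ∑ i, (g₁ - g₀) (x i) then 1 else 0

/-! ### The clipped score and its test -/

/-- `Λ^(c) = c' ∨ Λ ∧ c'' - z`. -/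
def clippedScore {Ω : Type*} (Λ : Ω → ℝ) (z c' c'' : ℝ) (x : Ω) : ℝ :=
  max c' (min (Λ x) c'') - z

/-- The `L₂(P)` norm of the clipped score. -/
def clippedNorm {Ω : Type*} [MeasurableSpace Ω] (P : Measure Ω) (Λ : Ω → ℝ) (z c' c'' : ℝ) : ℝ :=
  √(∫ x, clippedScore Λ z c' c'' x ^ 2 ∂P)

/-- The test `1(sₙ ∑ Λ^(c)(xᵢ) > ‖Λ^(c)‖ u + r₀ (c'' - z))`. -/
def clippedTest {Ω : Type*} [MeasurableSpace Ω] (P : Measure Ω) (Λ : Ω → ℝ)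
    (z c' c'' r₀ u : ℝ) : TestSeq Ω :=
  open Classical in fun n x =>
    if clippedNorm P Λ z c' c'' * u + r₀ * (c'' - z)
        < (√n)⁻¹ * ∑ i, clippedScore Λ z c' c'' (x i) then 1 else 0

/-! ### Contamination neighborhoods and least favorable pairs of probabilities -/

/-- The convex contamination neighborhood `{(1 - ε) P + ε M | M a probability}`, `0 ≤ ε ≤ 1`. -/
def contaminationNhd {Ω : Type*} [MeasurableSpace Ω] (P : Measure Ω) (ε : ℝ) : Set (Measure Ω) :=
  {Q | ∃ M : Measure Ω, IsProbabilityMeasure M ∧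
    Q = ENNReal.ofReal (1 - ε) • P + ENNReal.ofReal ε • M}

/-- Least favorable pair `dQ₁ = π dQ₀` for `𝒬₀` against `𝒬₁`, in the sense of Huber and Strassen. -/
def IsLeastFavorablePair {Ω : Type*} [MeasurableSpace Ω] (𝒬₀ 𝒬₁ : Set (Measure Ω))
    (Q₀ Q₁ : Measure Ω) (π : Ω → ℝ≥0∞) : Prop :=
  Q₀ ∈ 𝒬₀ ∧ Q₁ ∈ 𝒬₁ ∧ Measurable π ∧ Q₁ = Q₀.withDensity π ∧
    ∀ t : ℝ≥0∞, 0 < t → t < ∞ →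
      (∀ Q ∈ 𝒬₀, Q {x | t < π x} ≤ Q₀ {x | t < π x}) ∧
      (∀ Q ∈ 𝒬₁, Q₁ {x | t < π x} ≤ Q {x | t < π x})

/-- The robust asymptotic test based on least favorable pairs: for all large `n`, the test `φ n` is
a Neyman-Pearson test (a likelihood ratio test, possibly randomized at the critical value) between
the `n`-fold products of a least favorable pair for `𝒬₀ n` against `𝒬₁ n`, and its size tends
to `α`. -/
def IsRobustAsyTest {Ω : Type*} [MeasurableSpace Ω] (𝒬₀ 𝒬₁ : ℕ → Set (Measure Ω)) (α : ℝ)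
    (φ : TestSeq Ω) : Prop :=
  IsTest φ ∧ ∃ (Q₀ Q₁ : ℕ → Measure Ω) (π : ℕ → Ω → ℝ≥0∞) (k : ℕ → ℝ≥0∞),
    (∀ᶠ n in atTop, IsLeastFavorablePair (𝒬₀ n) (𝒬₁ n) (Q₀ n) (Q₁ n) (π n)) ∧
    (∀ᶠ n in atTop, ∀ x : Fin n → Ω,
      (k n < ∏ i, π n (x i) → φ n x = 1) ∧ (∏ i, π n (x i) < k n → φ n x = 0)) ∧
    Tendsto (fun n => rejectionProb (φ n) (Q₀ n)) atTop (𝓝 (ENNReal.ofReal α))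

/-- `limsup` of the maximum size over `𝒬 n`. -/
def asyMaxSize {Ω : Type*} [MeasurableSpace Ω] (𝒬 : ℕ → Set (Measure Ω)) (δ : TestSeq Ω) : ℝ≥0∞ :=
  limsup (fun n => ⨆ Q ∈ 𝒬 n, rejectionProb (δ n) Q) atTop

/-- `liminf` of the minimum power over `𝒬 n`. -/
def asyMinPower {Ω : Type*} [MeasurableSpace Ω] (𝒬 : ℕ → Set (Measure Ω)) (δ : TestSeq Ω) : ℝ≥0∞ :=
  liminf (fun n => ⨅ Q ∈ 𝒬 n, rejectionProb (δ n) Q) atTop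

/-- `δ` maximizes the asymptotic minimum power over `𝒬₁` subject to asymptotic maximum size at most
`α` over `𝒬₀`. -/
def IsAsyMaxminOver {Ω : Type*} [MeasurableSpace Ω] (𝒬₀ 𝒬₁ : ℕ → Set (Measure Ω)) (α : ℝ)
    (δ : TestSeq Ω) : Prop :=
  IsTest δ ∧ asyMaxSize 𝒬₀ δ ≤ ENNReal.ofReal α ∧
    ∀ δ' : TestSeq Ω, IsTest δ' → asyMaxSize 𝒬₀ δ' ≤ ENNReal.ofReal α →
      asyMinPower 𝒬₁ δ' ≤ asyMinPower 𝒬₁ δ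

end

end RobustTest

open RobustTest

/-! Asymptotically a local alternative is nothing but its tangent. Laws whose root densities agree
up to `o(1/√n)` in `L₂` have `n`-fold products under which all tests have uniformly close powers
(`eventually_abs_power_sub_le`). Along a tangent `g`, the normalized sum of a bounded centered score
`b` is asymptotically normal with mean `⟨b|g⟩` and variance `‖b‖²`
(`HasTangent.tendsto_measure_scaledSum`). The testing problem thus becomes a Gaussian shift problem,
in which power depends on the distance between tangents, and the maxmin problem asks for the closest
points of two convex sets of tangents.

These closest points are found by clipping. The difference `q₁ - q₀` is `τ Λ^(c)`, a bounded
function. The mass `q₀ + r₀` sits where this score is maximal, and `q₁ - (τ Λ - r₁)` sits where it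
is minimal. Hence pairing with the score is maximal over the null tangents at `q₀` and minimal over
the alternative tangents at `q₁`. This is the projection inequality (`ClipData.sq_le_inner`), and it
yields the minimal norm as well as the saddle point. Conversely, a saddle point at any other pair
would have power at most `Φ(-u + ‖q₁ - q₀‖)`, while optimality between its own tangents gives it at
least `Φ(-u + ‖g₁ - g₀‖)`. So every least favorable pair has minimal norm.

Optimality against `q₀` versus `q₁` is proved with convenient representatives: the law with density
`1 + q₀/√n` and its exponential tilt by `score/√n`. For these the likelihood ratio of `n`
observations is exactly an exponential of the normalized sum, up to a constant, so the classical
Neyman-Pearson lemma applies at each `n`. The gap between its test and a competitor is an integral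
of `|ψ - δ| |e^T - e^t|`. Nonnegativity of the gap bounds the power
(`TiltData.eventually_lagrangian_le`), and smallness of the gap forces asymptotic coincidence
(`TiltData.tendsto_of_lagrangian_ge`), which a contiguity bound transfers to `Pⁿ`.

For b), both tangents are realized by contaminations inside the neighborhoods, and at every large
`n` these are stochastically extremal for the score (`ClipData.extremalPair`). This gives the maxmin
property over full neighborhoods. Least favorable probability pairs exist by Huber's clipping of the
likelihood ratio; to first order its mass conditions are the hypothesis on `r₀`. No explicit form of
a pair is needed afterwards. The stochastic orders of the two extremal pairs, used against each
other, show that its likelihood ratio test nearly attains the optimal Neyman-Pearson value, and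
uniqueness identifies it (`TiltData.tendsto_of_isRobustAsyTest`). -/

namespace RobustTest

variable {Ω : Type*} [MeasurableSpace Ω]

/-! ### Product measures -/

theorem lintegral_pi_succ {n : ℕ} (μ : Measure Ω) [SigmaFinite μ] {g : (Fin (n + 1) → Ω) → ℝ≥0∞}
    (hg : Measurable g) :
    ∫⁻ x, g x ∂(Measure.pi fun _ : Fin (n + 1) => μ) =
      ∫⁻ x : Ω × (Fin n → Ω), g (Fin.cons x.1 x.2) ∂(μ.prod (Measure.pi fun _ : Fin n => μ)) := by
  have h := (measurePreserving_piFinSuccAbove (fun _ : Fin (n + 1) => μ) 0).symm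
  rw [← h.lintegral_comp hg]
  refine lintegral_congr fun x => ?_
  congr 1
  ext i
  refine Fin.cases ?_ (fun j => ?_) i
  · simp [MeasurableEquiv.piFinSuccAbove, Fin.insertNthEquiv]
  · simp [MeasurableEquiv.piFinSuccAbove, Fin.insertNthEquiv]

theorem lintegral_pi_prod {n : ℕ} (μ : Measure Ω) [SigmaFinite μ] (f : Fin n → Ω → ℝ≥0∞)
    (hf : ∀ i, Measurable (f i)) :
    ∫⁻ x, ∏ i, f i (x i) ∂(Measure.pi fun _ : Fin n => μ) = ∏ i, ∫⁻ x, f i x ∂μ := by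
  induction n with
  | zero => simp
  | succ n n_ih =>
    rw [lintegral_pi_succ μ (g := fun x => ∏ i, f i (x i))
      (Finset.measurable_fun_prod _ fun i _ => (hf i).comp (measurable_pi_apply i))]
    simp_rw [Fin.prod_univ_succ, Fin.cons_zero, Fin.cons_succ]
    rw [← n_ih _ fun i => hf _]
    exact lintegral_prod_mul (hf 0).aemeasurable (Finset.measurable_fun_prod _ fun i _ =>
      (hf (Fin.succ i)).comp (measurable_pi_apply i)).aemeasurable

theorem pi_withDensity (n : ℕ) (μ : Measure Ω) [SigmaFinite μ] {f : Ω → ℝ≥0∞} (hf : Measurable f)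
    [SigmaFinite (μ.withDensity f)] :
    Measure.pi (fun _ : Fin n => μ.withDensity f) =
      (Measure.pi fun _ : Fin n => μ).withDensity (fun x => ∏ i, f (x i)) := by
  refine Measure.pi_eq fun s hs => ?_
  rw [withDensity_apply _ (.univ_pi hs), ← lintegral_indicator (.univ_pi hs)]
  have : (Set.univ.pi s).indicator (fun x : Fin n → Ω => ∏ i, f (x i)) =
      fun x => ∏ i, (s i).indicator f (x i) := by
    ext x
    by_cases hx : x ∈ Set.univ.pi s
    · rw [Set.indicator_of_mem hx]
      exact Finset.prod_congr rfl fun i _ => (Set.indicator_of_mem (hx i trivial) _).symm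
    · rw [Set.indicator_of_notMem hx]
      simp only [Set.mem_pi, Set.mem_univ, true_implies, not_forall] at hx
      obtain ⟨i, hi⟩ := hx
      exact (Finset.prod_eq_zero (Finset.mem_univ i) (Set.indicator_of_notMem hi _)).symm
  rw [this, lintegral_pi_prod _ _ fun i => hf.indicator (hs i)]
  exact Finset.prod_congr rfl fun i _ => by
    rw [lintegral_indicator (hs i), withDensity_apply _ (hs i)]

/-- Densities given by real functions pass to the `n`-fold product. -/
theorem pi_withDensity_ofReal (n : ℕ) (μ : Measure Ω) [SigmaFinite μ] {f : Ω → ℝ}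
    (hf : Measurable f) (hf0 : ∀ x, 0 ≤ f x)
    [SigmaFinite (μ.withDensity fun x => ENNReal.ofReal (f x))] :
    Measure.pi (fun _ : Fin n => μ.withDensity fun x => ENNReal.ofReal (f x)) =
      (Measure.pi fun _ : Fin n => μ).withDensity (fun x => ENNReal.ofReal (∏ i, f (x i))) := by
  rw [pi_withDensity n μ hf.ennreal_ofReal]
  congr 1
  ext x
  rw [ENNReal.ofReal_prod_of_nonneg fun i _ => hf0 _]

theorem integral_withDensity_ofReal {X : Type*} [MeasurableSpace X] (μ : Measure X) {f : X → ℝ}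
    (hf : Measurable f) (hf0 : ∀ x, 0 ≤ f x) (g : X → ℝ) :
    ∫ x, g x ∂(μ.withDensity fun x => ENNReal.ofReal (f x)) = ∫ x, f x * g x ∂μ := by
  rw [integral_withDensity_eq_integral_toReal_smul hf.ennreal_ofReal (by simp)]
  simp [ENNReal.toReal_ofReal (hf0 _)]

theorem integrable_of_isProbabilityMeasure_withDensity {X : Type*} [MeasurableSpace X]
    {μ : Measure X} {f : X → ℝ} (hf : Measurable f) (hf0 : ∀ x, 0 ≤ f x)
    [h : IsProbabilityMeasure (μ.withDensity fun x => ENNReal.ofReal (f x))] : Integrable f μ := by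
  refine ⟨hf.aestronglyMeasurable, ?_⟩
  rw [hasFiniteIntegral_iff_ofReal (ae_of_all _ hf0)]
  have := h.measure_univ
  rw [withDensity_apply _ .univ, setLIntegral_univ] at this
  simp [this]

theorem integral_eq_one_of_withDensity {X : Type*} [MeasurableSpace X]
    {μ : Measure X} {f : X → ℝ} (hf : Measurable f) (hf0 : ∀ x, 0 ≤ f x)
    [h : IsProbabilityMeasure (μ.withDensity fun x => ENNReal.ofReal (f x))] :
    ∫ x, f x ∂μ = 1 := by
  have := integral_withDensity_ofReal μ hf hf0 (fun _ => 1)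
  simpa using this.symm

/-! ### Hellinger distance and powers of tests -/

/-- The power `∫ ψ dQⁿ` as a real number. -/
noncomputable def power {n : ℕ} (ψ : (Fin n → Ω) → ℝ) (Q : Measure Ω) : ℝ :=
  ∫ x, ψ x ∂(Measure.pi fun _ : Fin n => Q)

/-- Powers of tests under `n`-fold products differ little if the root densities are close. -/
theorem abs_power_sub_le_of_root (n : ℕ) (μ : Measure Ω) [IsFiniteMeasure μ] {r r' : Ω → ℝ}
    (hr : Measurable r) (hr' : Measurable r') (hr0 : ∀ x, 0 ≤ r x) (hr0' : ∀ x, 0 ≤ r' x)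
    [hQ : IsProbabilityMeasure (μ.withDensity fun x => ENNReal.ofReal (r x ^ 2))]
    [hQ' : IsProbabilityMeasure (μ.withDensity fun x => ENNReal.ofReal (r' x ^ 2))]
    {ψ : (Fin n → Ω) → ℝ} (hψ : Measurable ψ) (hψ01 : ∀ x, ψ x ∈ Set.Icc (0 : ℝ) 1)
    {η : ℝ} (hη : 0 < η) :
    |power ψ (μ.withDensity fun x => ENNReal.ofReal (r x ^ 2)) -
      power ψ (μ.withDensity fun x => ENNReal.ofReal (r' x ^ 2))| ≤
      n * (∫ x, (r x - r' x) ^ 2 ∂μ) / (2 * η) + 2 * η := by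
  set R : (Fin n → Ω) → ℝ := fun x => ∏ i, r (x i) with hR
  set R' : (Fin n → Ω) → ℝ := fun x => ∏ i, r' (x i) with hR'
  set ν := Measure.pi fun _ : Fin n => μ with hν
  have hi := integrable_of_isProbabilityMeasure_withDensity (μ := μ) (hr.pow_const 2)
    (fun x => sq_nonneg (r x))
  have hi' := integrable_of_isProbabilityMeasure_withDensity (μ := μ) (hr'.pow_const 2)
    (fun x => sq_nonneg (r' x))
  have h1 := integral_eq_one_of_withDensity (μ := μ) (hr.pow_const 2) (fun x => sq_nonneg (r x))
  have h1' := integral_eq_one_of_withDensity (μ := μ) (hr'.pow_const 2)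
    (fun x => sq_nonneg (r' x))
  have hL : MemLp r 2 μ := (memLp_two_iff_integrable_sq hr.aestronglyMeasurable).2 hi
  have hL' : MemLp r' 2 μ := (memLp_two_iff_integrable_sq hr'.aestronglyMeasurable).2 hi'
  have him : Integrable (fun x => r x * r' x) μ := hL.integrable_mul hL'
  have hRm : Measurable R := Finset.measurable_fun_prod _ fun i _ => hr.comp (measurable_pi_apply i)
  have hRm' : Measurable R' :=
    Finset.measurable_fun_prod _ fun i _ => hr'.comp (measurable_pi_apply i)
  have hR2 : ∀ x, R x ^ 2 = ∏ i, r (x i) ^ 2 := fun x => (Finset.prod_pow _ _ _).symm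
  have hR2' : ∀ x, R' x ^ 2 = ∏ i, r' (x i) ^ 2 := fun x => (Finset.prod_pow _ _ _).symm
  have hRR : ∀ x, R x * R' x = ∏ i, r (x i) * r' (x i) := fun x =>
    (Finset.prod_mul_distrib).symm
  have hRi : Integrable (fun x => R x ^ 2) ν := by
    simp_rw [hR2]; exact Integrable.fintype_prod (f := fun _ x => r x ^ 2) fun _ => hi
  have hRi' : Integrable (fun x => R' x ^ 2) ν := by
    simp_rw [hR2']; exact Integrable.fintype_prod (f := fun _ x => r' x ^ 2) fun _ => hi'
  have hRRi : Integrable (fun x => R x * R' x) ν := by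
    simp_rw [hRR]; exact Integrable.fintype_prod (f := fun _ x => r x * r' x) fun _ => him
  have e1 : ∫ x, R x ^ 2 ∂ν = 1 := by
    simp_rw [hR2]
    rw [integral_fintype_prod_eq_pow (ι := Fin n) (μ := μ) (fun x => r x ^ 2), h1, one_pow]
  have e1' : ∫ x, R' x ^ 2 ∂ν = 1 := by
    simp_rw [hR2']
    rw [integral_fintype_prod_eq_pow (ι := Fin n) (μ := μ) (fun x => r' x ^ 2), h1', one_pow]
  set H := ∫ x, (r x - r' x) ^ 2 ∂μ with hH
  have hρ : ∫ x, r x * r' x ∂μ = 1 - H / 2 := by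
    have : H = ∫ x, (r x ^ 2 + r' x ^ 2) - 2 * (r x * r' x) ∂μ := by
      rw [hH]; congr 1; ext x; ring
    rw [integral_sub (f := fun x => r x ^ 2 + r' x ^ 2) (hi.add hi') (him.const_mul 2),
      integral_add hi hi', h1, h1', integral_const_mul] at this
    linarith
  have hρ0 : 0 ≤ ∫ x, r x * r' x ∂μ := integral_nonneg fun x => mul_nonneg (hr0 x) (hr0' x)
  -- Bernoulli's inequality for the `n`-th power of the affinity; its nonnegativity `hρ0` keeps the
  -- base in the admissible range.
  have eRR : 1 - n * (H / 2) ≤ ∫ x, R x * R' x ∂ν := by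
    simp_rw [hRR]
    rw [integral_fintype_prod_eq_pow (ι := Fin n) (μ := μ) (fun x => r x * r' x), hρ,
      Fintype.card_fin]
    have := one_add_mul_le_pow (a := -(H / 2)) (by linarith) n
    calc 1 - n * (H / 2) = 1 + n * (-(H / 2)) := by ring
      _ ≤ _ := this
      _ = _ := by ring
  have p1 : power ψ (μ.withDensity fun x => ENNReal.ofReal (r x ^ 2)) = ∫ x, R x ^ 2 * ψ x ∂ν := by
    rw [power, pi_withDensity_ofReal n μ (hr.pow_const 2) (fun x => sq_nonneg _)]
    simp_rw [← hR2]
    exact integral_withDensity_ofReal ν (hRm.pow_const 2) (fun x => sq_nonneg _) ψ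
  have p1' : power ψ (μ.withDensity fun x => ENNReal.ofReal (r' x ^ 2)) =
      ∫ x, R' x ^ 2 * ψ x ∂ν := by
    rw [power, pi_withDensity_ofReal n μ (hr'.pow_const 2) (fun x => sq_nonneg _)]
    simp_rw [← hR2']
    exact integral_withDensity_ofReal ν (hRm'.pow_const 2) (fun x => sq_nonneg _) ψ
  have hb : ∀ x, ‖ψ x‖ ≤ 1 := fun x => by
    rw [Real.norm_eq_abs, abs_le]; exact ⟨by linarith [(hψ01 x).1], (hψ01 x).2⟩
  have hψi : Integrable (fun x => R x ^ 2 * ψ x) ν :=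
    hRi.mul_bdd hψ.aestronglyMeasurable (c := 1) (ae_of_all _ hb)
  have hψi' : Integrable (fun x => R' x ^ 2 * ψ x) ν :=
    hRi'.mul_bdd hψ.aestronglyMeasurable (c := 1) (ae_of_all _ hb)
  rw [p1, p1', ← integral_sub hψi hψi']
  have hdom : Integrable (fun x => (R x ^ 2 + R' x ^ 2 - 2 * (R x * R' x)) / (2 * η) +
      (η / 2) * (2 * (R x ^ 2 + R' x ^ 2))) ν :=
    (((hRi.add hRi').sub (hRRi.const_mul 2)).div_const _).add
      (((hRi.add hRi').const_mul 2).const_mul _)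
  calc |∫ x, R x ^ 2 * ψ x - R' x ^ 2 * ψ x ∂ν| ≤ ∫ x, |R x ^ 2 * ψ x - R' x ^ 2 * ψ x| ∂ν :=
        abs_integral_le_integral_abs
    _ ≤ ∫ x, (R x ^ 2 + R' x ^ 2 - 2 * (R x * R' x)) / (2 * η) +
      (η / 2) * (2 * (R x ^ 2 + R' x ^ 2)) ∂ν := by
        refine integral_mono (hψi.sub hψi').abs hdom fun x => ?_
        simp only []
        have a1 : |R x ^ 2 * ψ x - R' x ^ 2 * ψ x| ≤ |R x - R' x| * |R x + R' x| := by
          rw [← sub_mul, abs_mul, ← abs_mul (R x - R' x)]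
          have : R x ^ 2 - R' x ^ 2 = (R x - R' x) * (R x + R' x) := by ring
          rw [this]
          exact mul_le_of_le_one_right (abs_nonneg _) (hb x)
        -- Young's inequality with a free weight `η` takes the place of Cauchy-Schwarz; the weight
        -- is balanced later.
        have a2 : |R x - R' x| * |R x + R' x| ≤
            (R x - R' x) ^ 2 / (2 * η) + (η / 2) * (R x + R' x) ^ 2 := by
          rw [← sq_abs (R x - R' x), ← sq_abs (R x + R' x)]
          have := sq_nonneg (|R x - R' x| - η * |R x + R' x|)
          rw [div_add' _ _ _ (by positivity), le_div_iff₀ (by positivity)]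
          nlinarith
        have a3 : (R x + R' x) ^ 2 ≤ 2 * (R x ^ 2 + R' x ^ 2) := by
          nlinarith [sq_nonneg (R x - R' x)]
        have a4 : (R x - R' x) ^ 2 = R x ^ 2 + R' x ^ 2 - 2 * (R x * R' x) := by ring
        rw [a4] at a2
        have := mul_le_mul_of_nonneg_left a3 (by positivity : 0 ≤ η / 2)
        linarith
    _ = (2 - 2 * ∫ x, R x * R' x ∂ν) / (2 * η) + 2 * η := by
        rw [integral_add, integral_div, integral_sub, integral_add, integral_const_mul,
          integral_const_mul, integral_const_mul, integral_add, e1, e1']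
        · ring
        · exact hRi
        · exact hRi'
        · exact hRi
        · exact hRi'
        · exact hRi.add hRi'
        · exact hRRi.const_mul 2
        · exact ((hRi.add hRi').sub (hRRi.const_mul 2)).div_const _
        · exact ((hRi.add hRi').const_mul 2).const_mul _
    _ ≤ n * H / (2 * η) + 2 * η := by
        have : 2 - 2 * ∫ x, R x * R' x ∂ν ≤ n * H := by linarith
        gcongr

/-- Root densities with respect to a dominating measure, and the Hellinger defect. -/
theorem exists_root_density (P Q μ : Measure Ω) [IsProbabilityMeasure P] [IsFiniteMeasure Q]
    [IsFiniteMeasure μ] (hP : P ≪ μ) (hQ : Q ≪ μ) {f : Ω → ℝ} (hf : Measurable f) :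
    ∃ r : Ω → ℝ, Measurable r ∧ (∀ x, 0 ≤ r x) ∧
      Q = μ.withDensity (fun x => ENNReal.ofReal (r x ^ 2)) ∧
      ∫⁻ x, ENNReal.ofReal ((r x - (1 + f x / 2) * √(P.rnDeriv μ x).toReal) ^ 2) ∂μ =
        hellingerDefect P Q f := by
  set r : Ω → ℝ := fun x => √(Q.rnDeriv μ x).toReal with hr
  have hrm : Measurable r := (Measure.measurable_rnDeriv _ _).ennreal_toReal.sqrt
  refine ⟨r, hrm, fun x => Real.sqrt_nonneg _, ?_, ?_⟩
  · nth_rewrite 1 [← Measure.withDensity_rnDeriv_eq Q μ hQ]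
    refine withDensity_congr_ae ?_
    filter_upwards [Q.rnDeriv_lt_top μ] with x hx
    rw [hr, Real.sq_sqrt ENNReal.toReal_nonneg, ENNReal.ofReal_toReal hx.ne]
  · set Qs := Q.singularPart P
    have hQs : Qs ≪ μ := (Measure.absolutelyContinuous_of_le (Measure.singularPart_le Q P)).trans hQ
    -- The density of `Q` splits by the Lebesgue decomposition with respect to `P` and the chain
    -- rule. By `hzero` the two summands live on disjoint sets, so the squared difference of roots
    -- separates as well.
    have hsplit : Q.rnDeriv μ =ᵐ[μ] fun x =>
        Qs.rnDeriv μ x + Q.rnDeriv P x * P.rnDeriv μ x := by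
      have h1 := Measure.rnDeriv_add Qs (P.withDensity (Q.rnDeriv P)) μ
      rw [← Measure.haveLebesgueDecomposition_add Q P] at h1
      have h2 := Measure.rnDeriv_mul_rnDeriv (κ := μ)
        (withDensity_absolutelyContinuous P (Q.rnDeriv P))
      have h3 : (P.withDensity (Q.rnDeriv P)).rnDeriv P =ᵐ[P] Q.rnDeriv P :=
        Measure.rnDeriv_withDensity P (Measure.measurable_rnDeriv _ _)
      have h4 : ∀ᵐ x ∂μ, P.rnDeriv μ x ≠ 0 →
          (P.withDensity (Q.rnDeriv P)).rnDeriv P x = Q.rnDeriv P x := by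
        rw [← Measure.withDensity_rnDeriv_eq P μ hP] at h3
        have := (ae_withDensity_iff (Measure.measurable_rnDeriv P μ)).1 h3
        rwa [Measure.withDensity_rnDeriv_eq P μ hP] at this
      filter_upwards [h1, h2, h4] with x x1 x2 x4
      rw [x1, Pi.add_apply, ← x2, Pi.mul_apply]
      by_cases h0 : P.rnDeriv μ x = 0
      · simp [h0]
      · rw [x4 h0]
    have hzero : ∀ᵐ x ∂μ, P.rnDeriv μ x ≠ 0 → Qs.rnDeriv μ x = 0 := by
      have h3 := Measure.rnDeriv_eq_zero_of_mutuallySingular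
        (Measure.mutuallySingular_singularPart Q P) hP
      rw [← Measure.withDensity_rnDeriv_eq P μ hP] at h3
      have := (ae_withDensity_iff (Measure.measurable_rnDeriv P μ)).1 h3
      rwa [Measure.withDensity_rnDeriv_eq P μ hP] at this
    have key : ∀ᵐ x ∂μ, ENNReal.ofReal ((r x - (1 + f x / 2) * √(P.rnDeriv μ x).toReal) ^ 2) =
        P.rnDeriv μ x * ENNReal.ofReal ((√(Q.rnDeriv P x).toReal - (1 + f x / 2)) ^ 2) +
          Qs.rnDeriv μ x := by
      filter_upwards [hsplit, hzero, Q.rnDeriv_lt_top μ, P.rnDeriv_lt_top μ, Qs.rnDeriv_lt_top μ]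
        with x x1 x2 x3 x4 x5
      simp only [hr]
      by_cases h0 : P.rnDeriv μ x = 0
      · rw [x1, h0]
        simp [Real.sq_sqrt ENNReal.toReal_nonneg, ENNReal.ofReal_toReal x5.ne]
      · rw [x1, x2 h0, zero_add, add_zero, ENNReal.toReal_mul,
          Real.sqrt_mul ENNReal.toReal_nonneg, ← sub_mul, mul_pow,
          Real.sq_sqrt ENNReal.toReal_nonneg, ENNReal.ofReal_mul (sq_nonneg _),
          ENNReal.ofReal_toReal x4.ne, mul_comm]
    have hm : Measurable fun x =>
        ENNReal.ofReal ((√(Q.rnDeriv P x).toReal - (1 + f x / 2)) ^ 2) := by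
      have := (Measure.measurable_rnDeriv Q P).ennreal_toReal.sqrt
      fun_prop
    rw [lintegral_congr_ae key, lintegral_add_right _ (Measure.measurable_rnDeriv _ _),
      Measure.lintegral_rnDeriv hQs, hellingerDefect]
    congr 1
    conv_rhs => rw [← Measure.withDensity_rnDeriv_eq P μ hP]
    rw [lintegral_withDensity_eq_lintegral_mul _ (Measure.measurable_rnDeriv P μ)]
    · simp only [Measure.withDensity_rnDeriv_eq P μ hP]; rfl
    · rw [Measure.withDensity_rnDeriv_eq P μ hP]; exact hm

theorem HasTangent.congr_ae {P : Measure Ω} {Q : ℕ → Measure Ω} {g g' : Ω → ℝ}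
    (h : HasTangent P Q g) (hg : g =ᵐ[P] g') : HasTangent P Q g' := by
  refine Tendsto.congr (fun n => ?_) h
  unfold hellingerDefect
  congr 2
  refine lintegral_congr_ae ?_
  filter_upwards [hg] with x hx
  rw [hx]

theorem HasTangent.congr_eventually {P : Measure Ω} {Q Q' : ℕ → Measure Ω} {g : Ω → ℝ}
    (h : HasTangent P Q g) (hQ : ∀ᶠ n in atTop, Q n = Q' n) : HasTangent P Q' g := by
  refine Tendsto.congr' ?_ h
  filter_upwards [hQ] with n hn
  rw [hn]

theorem eventually_natMul_le_of_tendsto {D : ℕ → ℝ≥0∞}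
    (h : Tendsto (fun n : ℕ => (n : ℝ≥0∞) * D n) atTop (𝓝 0)) {δ : ℝ} (hδ : 0 < δ) :
    ∀ᶠ n : ℕ in atTop, D n ≠ ∞ ∧ n * (D n).toReal ≤ δ := by
  have h1 := h.eventually (gt_mem_nhds (ENNReal.ofReal_pos.2 hδ))
  filter_upwards [h1, eventually_gt_atTop 0] with n hn hn0
  have hne : D n ≠ ∞ := by
    rintro h
    rw [h, ENNReal.mul_top (by exact_mod_cast hn0.ne')] at hn
    exact not_top_lt hn
  refine ⟨hne, ?_⟩
  have := ENNReal.toReal_mono ENNReal.ofReal_ne_top hn.le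
  rwa [ENNReal.toReal_mul, ENNReal.toReal_natCast, ENNReal.toReal_ofReal hδ.le] at this

/-- Sequences with the same tangent are asymptotically indistinguishable. -/
theorem eventually_abs_power_sub_le {P : Measure Ω} [IsProbabilityMeasure P]
    {Q Q' : ℕ → Measure Ω} (hQ : ∀ᶠ n in atTop, IsProbabilityMeasure (Q n))
    (hQ' : ∀ᶠ n in atTop, IsProbabilityMeasure (Q' n)) {g : Ω → ℝ} (hg : Measurable g)
    (hT : HasTangent P Q g) (hT' : HasTangent P Q' g) {ε : ℝ} (hε : 0 < ε) :
    ∀ᶠ n in atTop, ∀ ψ : (Fin n → Ω) → ℝ, Measurable ψ → (∀ x, ψ x ∈ Set.Icc (0 : ℝ) 1) →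
      |power ψ (Q n) - power ψ (Q' n)| ≤ ε := by
  -- Comparing both roots with their common approximation gives `n ∫ (r - r')² ≤ 2δ + 2δ = ε²/4`.
  -- With `η = ε / 4` the product bound becomes `ε/2 + ε/2`.
  have hδ : 0 < ε ^ 2 / 16 := by positivity
  filter_upwards [hQ, hQ', eventually_natMul_le_of_tendsto hT hδ,
    eventually_natMul_le_of_tendsto hT' hδ] with n _ _ ⟨hD, hDn⟩ ⟨hD', hDn'⟩ ψ hψ hψ01
  set f : Ω → ℝ := fun x => g x / √n with hf
  have hfm : Measurable f := hg.div_const _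
  set μ := P + (Q n + Q' n) with hμ
  have aP : P ≪ μ := (Measure.le_add_right le_rfl).absolutelyContinuous
  have aQ : Q n ≪ μ :=
    (Measure.le_add_left (Measure.le_add_right le_rfl)).absolutelyContinuous
  have aQ' : Q' n ≪ μ :=
    (Measure.le_add_left (Measure.le_add_left le_rfl)).absolutelyContinuous
  obtain ⟨r, hrm, hr0, hrQ, hrH⟩ := exists_root_density P (Q n) μ aP aQ hfm
  obtain ⟨r', hrm', hr0', hrQ', hrH'⟩ := exists_root_density P (Q' n) μ aP aQ' hfm
  have : IsProbabilityMeasure (μ.withDensity fun x => ENNReal.ofReal (r x ^ 2)) := by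
    rw [← hrQ]; infer_instance
  have : IsProbabilityMeasure (μ.withDensity fun x => ENNReal.ofReal (r' x ^ 2)) := by
    rw [← hrQ']; infer_instance
  have hH : ∫ x, (r x - r' x) ^ 2 ∂μ ≤
      2 * (hellingerDefect P (Q n) f).toReal + 2 * (hellingerDefect P (Q' n) f).toReal := by
    have hem := (Measure.measurable_rnDeriv P μ).ennreal_toReal.sqrt
    rw [integral_eq_lintegral_of_nonneg_ae (ae_of_all _ fun x => sq_nonneg _) (by fun_prop)]
    have : ∫⁻ x, ENNReal.ofReal ((r x - r' x) ^ 2) ∂μ ≤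
        2 * hellingerDefect P (Q n) f + 2 * hellingerDefect P (Q' n) f := by
      rw [← hrH, ← hrH', ← lintegral_const_mul _ (by fun_prop),
        ← lintegral_const_mul _ (by fun_prop), ← lintegral_add_left (by fun_prop)]
      refine lintegral_mono fun x => ?_
      simp only []
      rw [← ENNReal.ofReal_ofNat 2, ← ENNReal.ofReal_mul (by norm_num),
        ← ENNReal.ofReal_mul (by norm_num), ← ENNReal.ofReal_add (by positivity) (by positivity)]
      refine ENNReal.ofReal_le_ofReal ?_
      set c := (1 + f x / 2) * √(P.rnDeriv μ x).toReal
      nlinarith [sq_nonneg (r x + r' x - 2 * c)]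
    have h2 := ENNReal.toReal_mono (by finiteness) this
    rwa [ENNReal.toReal_add (by finiteness) (by finiteness), ENNReal.toReal_mul,
      ENNReal.toReal_mul, ENNReal.toReal_ofNat] at h2
  have := abs_power_sub_le_of_root n μ hrm hrm' hr0 hr0' hψ hψ01 (η := ε / 4) (by positivity)
  rw [← hrQ, ← hrQ'] at this
  refine this.trans ?_
  have hn : (n : ℝ) * ∫ x, (r x - r' x) ^ 2 ∂μ ≤ ε ^ 2 / 4 := by
    have := mul_le_mul_of_nonneg_left hH (Nat.cast_nonneg (α := ℝ) n)
    linarith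
  calc (n : ℝ) * (∫ x, (r x - r' x) ^ 2 ∂μ) / (2 * (ε / 4)) + 2 * (ε / 4)
      ≤ (ε ^ 2 / 4) / (2 * (ε / 4)) + 2 * (ε / 4) := by gcongr
    _ = ε := by field_simp; ring

/-! ### Moments of bounded functions under local alternatives -/

/-- With root densities `r` of `Q` and `e` of `P`, and `y = 1 + f/2`, one has `r² - y²e² = (r -
ye)(r + ye)`: the first factor is controlled by the defect, the second is bounded in `L₂`. The
weight `η` is left free because at sample size `n` it must shrink like `1/√n`. -/
theorem abs_integral_sub_le_hellingerDefect {P Q : Measure Ω} [IsProbabilityMeasure P]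
    [IsProbabilityMeasure Q] {f h : Ω → ℝ} (hf : Measurable f) (hfL : MemLp f 2 P)
    (hh : Measurable h) {C : ℝ} (hC : ∀ x, |h x| ≤ C)
    {η : ℝ} (hη : 0 < η) :
    |∫ x, h x ∂Q - ∫ x, h x * (1 + f x / 2) ^ 2 ∂P| ≤
      C * ((hellingerDefect P Q f).toReal / (2 * η) + η * (1 + ∫ x, (1 + f x / 2) ^ 2 ∂P)) := by
  set μ := P + Q with hμ
  have aP : P ≪ μ := (Measure.le_add_right le_rfl).absolutelyContinuous
  have aQ : Q ≪ μ := (Measure.le_add_left le_rfl).absolutelyContinuous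
  obtain ⟨r, hrm, hr0, hrQ, hrH⟩ := exists_root_density P Q μ aP aQ hf
  obtain ⟨e, hem, he0, heP, -⟩ := exists_root_density P P μ aP aP (f := 0) measurable_zero
  have hee : (fun x => √(P.rnDeriv μ x).toReal) =ᵐ[μ] e := by
    have h1 : P.rnDeriv μ =ᵐ[μ] fun x => ENNReal.ofReal (e x ^ 2) := by
      conv_lhs => rw [heP]
      exact Measure.rnDeriv_withDensity μ (hem.pow_const 2).ennreal_ofReal
    filter_upwards [h1] with x hx
    rw [hx, ENNReal.toReal_ofReal (sq_nonneg _), Real.sqrt_sq (he0 x)]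
  have iQ : IsProbabilityMeasure (μ.withDensity fun x => ENNReal.ofReal (r x ^ 2)) := by
    rw [← hrQ]; infer_instance
  have hri := integrable_of_isProbabilityMeasure_withDensity (μ := μ) (hrm.pow_const 2)
    (fun x => sq_nonneg (r x))
  have hr1 := integral_eq_one_of_withDensity (μ := μ) (hrm.pow_const 2) (fun x => sq_nonneg (r x))
  have convP : ∀ k : Ω → ℝ, ∫ x, k x ∂P = ∫ x, e x ^ 2 * k x ∂μ := fun k => by
    conv_lhs => rw [heP]
    exact integral_withDensity_ofReal μ (hem.pow_const 2) (fun x => sq_nonneg _) k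
  have convQ : ∀ k : Ω → ℝ, ∫ x, k x ∂Q = ∫ x, r x ^ 2 * k x ∂μ := fun k => by
    conv_lhs => rw [hrQ]
    exact integral_withDensity_ofReal μ (hrm.pow_const 2) (fun x => sq_nonneg _) k
  have convi : ∀ k : Ω → ℝ, Integrable k P → Integrable (fun x => e x ^ 2 * k x) μ := by
    intro k hk
    rw [heP, integrable_withDensity_iff_integrable_smul' (hem.pow_const 2).ennreal_ofReal
      (by simp)] at hk
    simpa [ENNReal.toReal_ofReal (sq_nonneg _)] using hk
  set y : Ω → ℝ := fun x => 1 + f x / 2 with hy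
  have hyL : MemLp y 2 P := (memLp_const (1 : ℝ)).add (by
    simpa [div_eq_mul_inv, mul_comm] using hfL.const_mul (2 : ℝ)⁻¹)
  have hy2 : Integrable (fun x => y x ^ 2) P := hyL.integrable_sq
  have hey := convi _ hy2
  have hdm : Integrable (fun x => (r x - y x * e x) ^ 2) μ := by
    refine Integrable.mono' ((hri.const_mul 2).add (hey.const_mul 2)) (by fun_prop)
      (ae_of_all _ fun x => ?_)
    rw [Real.norm_eq_abs, abs_of_nonneg (sq_nonneg _)]
    simp only [Pi.add_apply]
    nlinarith [sq_nonneg (r x + y x * e x)]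
  have hDef : ∫ x, (r x - y x * e x) ^ 2 ∂μ = (hellingerDefect P Q f).toReal := by
    rw [integral_eq_lintegral_of_nonneg_ae (ae_of_all _ fun x => sq_nonneg _) (by fun_prop), ← hrH]
    congr 1
    refine lintegral_congr_ae ?_
    filter_upwards [hee] with x hx
    rw [← hx]
  have hhi : Integrable (fun x => r x ^ 2 * h x) μ :=
    hri.mul_bdd hh.aestronglyMeasurable (c := C) (ae_of_all _ hC)
  have hhi' : Integrable (fun x => e x ^ 2 * (h x * y x ^ 2)) μ := by
    have := hey.mul_bdd hh.aestronglyMeasurable (c := C) (ae_of_all _ hC)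
    exact this.congr (ae_of_all _ fun x => by ring)
  have hS : Integrable (fun x => (r x - y x * e x) ^ 2 / (2 * η) +
      η * (r x ^ 2 + e x ^ 2 * y x ^ 2)) μ :=
    (hdm.div_const _).add ((hri.add hey).const_mul _)
  rw [convQ, convP, ← integral_sub hhi hhi']
  calc |∫ x, r x ^ 2 * h x - e x ^ 2 * (h x * y x ^ 2) ∂μ|
      ≤ ∫ x, |r x ^ 2 * h x - e x ^ 2 * (h x * y x ^ 2)| ∂μ := abs_integral_le_integral_abs
    _ ≤ ∫ x, C * ((r x - y x * e x) ^ 2 / (2 * η) + η * (r x ^ 2 + e x ^ 2 * y x ^ 2)) ∂μ := by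
        refine integral_mono (hhi.sub hhi').abs (hS.const_mul C) fun x => ?_
        simp only []
        have e1 : r x ^ 2 * h x - e x ^ 2 * (h x * y x ^ 2) =
          h x * ((r x - y x * e x) * (r x + y x * e x)) := by ring
        rw [e1, abs_mul]
        refine mul_le_mul (hC x) ?_ (abs_nonneg _) ((abs_nonneg _).trans (hC x))
        have : |(r x - y x * e x) * (r x + y x * e x)| ≤
            (r x - y x * e x) ^ 2 / (2 * η) + (η / 2) * (r x + y x * e x) ^ 2 := by
          rw [abs_mul, ← sq_abs (r x - y x * e x), ← sq_abs (r x + y x * e x)]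
          have := sq_nonneg (|r x - y x * e x| - η * |r x + y x * e x|)
          rw [div_add' _ _ _ (by positivity), le_div_iff₀ (by positivity)]
          nlinarith
        have a3 : (r x + y x * e x) ^ 2 ≤ 2 * (r x ^ 2 + e x ^ 2 * y x ^ 2) := by
          nlinarith [sq_nonneg (r x - y x * e x)]
        have := mul_le_mul_of_nonneg_left a3 (by positivity : 0 ≤ η / 2)
        linarith
    _ = _ := by
        rw [integral_const_mul, integral_add (hdm.div_const _)
          ((show Integrable (fun x => r x ^ 2 + e x ^ 2 * y x ^ 2) μ from hri.add hey).const_mul _),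
          integral_div, integral_const_mul, integral_add hri hey, hr1, ← convP, hDef]

/-- First order expansion of the expectation of a bounded function. -/
theorem HasTangent.tendsto_sqrt_mul_integral_sub {P : Measure Ω} [IsProbabilityMeasure P]
    {Q : ℕ → Measure Ω} (hQ : ∀ᶠ n in atTop, IsProbabilityMeasure (Q n)) {g h : Ω → ℝ}
    (hg : Measurable g) (hgL : MemLp g 2 P) (hT : HasTangent P Q g)
    (hh : Measurable h) {C : ℝ} (hC : ∀ x, |h x| ≤ C) :
    Tendsto (fun n : ℕ => √n * (∫ x, h x ∂(Q n) - ∫ x, h x ∂P)) atTop (𝓝 (∫ x, h x * g x ∂P)) := by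
  have hC0 : 0 ≤ C := by
    obtain ⟨x⟩ : Nonempty Ω := nonempty_of_isProbabilityMeasure P
    exact (abs_nonneg _).trans (hC x)
  have hhi : Integrable h P := Integrable.of_bound hh.aestronglyMeasurable C (ae_of_all _ hC)
  have hg2 := hgL.integrable_sq
  have hgi : Integrable g P := hgL.integrable one_le_two
  have hhg : Integrable (fun x => h x * g x) P :=
    hgi.bdd_mul hh.aestronglyMeasurable (c := C) (ae_of_all _ hC)
  have hhg2 : Integrable (fun x => h x * g x ^ 2) P :=
    hg2.bdd_mul hh.aestronglyMeasurable (c := C) (ae_of_all _ hC)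
  set G := ∫ x, g x ^ 2 ∂P with hG
  have hG0 : 0 ≤ G := integral_nonneg fun x => sq_nonneg _
  rw [Metric.tendsto_atTop']
  intro ε hε
  set θ := ε / (4 * (C + 1) * (3 + G)) with hθ
  have hθ0 : 0 < θ := by positivity
  have hlim : Tendsto (fun n : ℕ => (√n)⁻¹ * (C * G / 4)) atTop (𝓝 0) := by
    have := (tendsto_inv_atTop_zero.comp (Real.tendsto_sqrt_atTop.comp
      (tendsto_natCast_atTop_atTop (R := ℝ)))).mul_const (C * G / 4)
    simpa using this
  have ev := (hQ.and (eventually_natMul_le_of_tendsto hT (δ := θ ^ 2) (by positivity))).and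
    ((hlim.eventually (gt_mem_nhds (by positivity : 0 < ε / 4))).and (eventually_gt_atTop 0))
  obtain ⟨N, hN⟩ := eventually_atTop.1 ev
  refine ⟨N, fun n hn => ?_⟩
  obtain ⟨⟨_, _, hDn⟩, hs, hn0⟩ := hN n hn.le
  have hn1 : (1 : ℝ) ≤ n := by exact_mod_cast hn0
  have hsq : 0 < √(n : ℝ) := Real.sqrt_pos.2 (by linarith)
  have hsq1 : 1 ≤ √(n : ℝ) := by rw [Real.one_le_sqrt]; exact hn1
  have hss : √(n : ℝ) * √n = n := Real.mul_self_sqrt (by linarith)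
  set s := √(n : ℝ) with hsdef
  have hfm : Measurable fun x => g x / s := hg.div_const _
  have hfL : MemLp (fun x => g x / s) 2 P := by
    simpa [div_eq_mul_inv, mul_comm] using hgL.const_mul s⁻¹
  -- Since `n` times the defect is at most `θ²`, the weight `θ/√n` makes both error terms of order
  -- `θ/√n`, which survives multiplication by `√n`.
  have hmain := abs_integral_sub_le_hellingerDefect (Q := Q n) hfm hfL hh hC
    (η := θ / s) (by positivity)
  set D := (hellingerDefect P (Q n) fun x => g x / s).toReal with hDdef
  have hexp : ∫ x, h x * (1 + g x / s / 2) ^ 2 ∂P =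
      ∫ x, h x ∂P + s⁻¹ * (∫ x, h x * g x ∂P) + s⁻¹ ^ 2 / 4 * (∫ x, h x * g x ^ 2 ∂P) := by
    rw [← integral_const_mul, ← integral_const_mul, ← integral_add hhi (hhg.const_mul _),
      ← integral_add (f := fun x => h x + s⁻¹ * (h x * g x)) (hhi.add (hhg.const_mul _))
        (hhg2.const_mul _)]
    congr 1; ext x; field_simp; ring
  have hexp1 : ∫ x, (1 + g x / s / 2) ^ 2 ∂P ≤ 2 + G := by
    calc ∫ x, (1 + g x / s / 2) ^ 2 ∂P ≤ ∫ x, 2 + g x ^ 2 ∂P := by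
          refine integral_mono_of_nonneg (ae_of_all _ fun x => sq_nonneg _)
            ((integrable_const _).add hg2) (ae_of_all _ fun x => ?_)
          simp only []
          have h1 : (g x / s) ^ 2 ≤ g x ^ 2 := by
            rw [div_pow]; exact div_le_self (sq_nonneg _) (one_le_pow₀ hsq1)
          nlinarith [sq_nonneg (1 - g x / s / 2)]
      _ = 2 + G := by rw [integral_add (integrable_const _) hg2]; simp [hG]
  have hg2b : |∫ x, h x * g x ^ 2 ∂P| ≤ C * G := by
    refine abs_integral_le_integral_abs.trans ?_
    rw [hG, ← integral_const_mul]
    refine integral_mono_of_nonneg (ae_of_all _ fun x => abs_nonneg _) (hg2.const_mul _)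
      (ae_of_all _ fun x => ?_)
    simp only [abs_mul, abs_of_nonneg (sq_nonneg (g x))]
    exact mul_le_mul_of_nonneg_right (hC x) (sq_nonneg _)
  rw [Real.dist_eq]
  have e1 : s * (∫ x, h x ∂(Q n) - ∫ x, h x ∂P) - ∫ x, h x * g x ∂P =
      s * (∫ x, h x ∂(Q n) - ∫ x, h x * (1 + g x / s / 2) ^ 2 ∂P) +
        s⁻¹ * ((∫ x, h x * g x ^ 2 ∂P) / 4) := by
    rw [hexp]; field_simp; ring
  rw [e1]
  have b1 : |s * (∫ x, h x ∂(Q n) - ∫ x, h x * (1 + g x / s / 2) ^ 2 ∂P)| ≤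
      C * (θ / 2 + θ * (3 + G)) := by
    rw [abs_mul, abs_of_pos hsq]
    calc s * _ ≤ s * _ := mul_le_mul_of_nonneg_left hmain hsq.le
      _ = C * ((s * s) * D / (2 * θ) + θ * (1 + ∫ x, (1 + g x / s / 2) ^ 2 ∂P)) := by
          field_simp
      _ ≤ C * (θ ^ 2 / (2 * θ) + θ * (1 + (2 + G))) := by
          rw [hss]; gcongr
      _ = _ := by field_simp; ring
  have b2 : |s⁻¹ * ((∫ x, h x * g x ^ 2 ∂P) / 4)| ≤ s⁻¹ * (C * G / 4) := by
    rw [abs_mul, abs_of_pos (inv_pos.2 hsq), abs_div, abs_of_pos (by norm_num : (0 : ℝ) < 4)]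
    gcongr
  have b3 : C * (θ / 2 + θ * (3 + G)) ≤ ε / 2 := by
    have : (C + 1) * (θ * (3 + G)) = ε / 4 := by rw [hθ]; field_simp
    have h3 : θ / 2 ≤ θ * (3 + G) := by nlinarith
    have h4 : C * (θ / 2 + θ * (3 + G)) ≤ (C + 1) * (2 * (θ * (3 + G))) := by
      refine mul_le_mul (by linarith) (by linarith) (by positivity) (by linarith)
    linarith
  calc _ ≤ _ := abs_add_le _ _
    _ < ε := by linarith

/-! ### Asymptotic normality of bounded scores -/

/-- The standardized sum `sₙ ∑ h(xᵢ)`. -/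
noncomputable def scaledSum (h : Ω → ℝ) {n : ℕ} (x : Fin n → Ω) : ℝ := (√n)⁻¹ * ∑ i, h (x i)

theorem measurable_scaledSum {h : Ω → ℝ} (hh : Measurable h) (n : ℕ) :
    Measurable (fun x : Fin n → Ω => scaledSum h x) :=
  (Finset.measurable_fun_sum _ fun i _ => hh.comp (measurable_pi_apply i)).const_mul _

/-- The standard normal distribution function. -/
noncomputable abbrev normalCdf (x : ℝ) : ℝ := cdf (gaussianReal 0 1) x

theorem gaussianReal_Ioi (m : ℝ) {σ : ℝ} (hσ : 0 < σ) (t : ℝ) :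
    (gaussianReal m (σ ^ 2).toNNReal).real (Set.Ioi t) = normalCdf ((m - t) / σ) := by
  have h1 : (gaussianReal 0 1).map (fun x => m - σ * x) = gaussianReal m (σ ^ 2).toNNReal := by
    have : (fun x : ℝ => m - σ * x) = (fun x => m - x) ∘ fun x => σ * x := rfl
    rw [this, ← Measure.map_map (by fun_prop) (by fun_prop), gaussianReal_map_const_mul,
      gaussianReal_map_const_sub]
    congr 1
    · simp
    · ext; simp [sq_nonneg]
  have : NullSingletonClass (gaussianReal 0 1) := nullSingletonClass_gaussianReal one_ne_zero
  rw [normalCdf, cdf_eq_real, ← h1, measureReal_def, measureReal_def,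
    Measure.map_apply (by fun_prop) measurableSet_Ioi, ← measure_congr (Iio_ae_eq_Iic)]
  congr 2
  ext x
  simp only [Set.mem_preimage, Set.mem_Ioi, Set.mem_Iio]
  rw [lt_div_iff₀ hσ]
  constructor <;> intro h <;> linarith

theorem normalCdf_strictMono : StrictMono normalCdf := by
  intro a b hab
  rw [normalCdf, normalCdf, cdf_eq_real, cdf_eq_real]
  have h1 : Set.Iic b = Set.Iic a ∪ Set.Ioc a b := (Set.Iic_union_Ioc_eq_Iic hab.le).symm
  rw [h1, measureReal_union (Set.Iic_disjoint_Ioc le_rfl)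
    measurableSet_Ioc]
  have : 0 < (gaussianReal 0 1).real (Set.Ioc a b) := by
    refine ENNReal.toReal_pos ?_ (measure_ne_top _ _)
    intro h0
    have := gaussianReal_absolutelyContinuous' 0 (v := 1) one_ne_zero h0
    rw [Real.volume_Ioc] at this
    simp at this
    linarith
  linarith

theorem continuous_normalCdf : Continuous normalCdf := by
  have : NullSingletonClass (gaussianReal 0 1) := nullSingletonClass_gaussianReal one_ne_zero
  rw [continuous_iff_continuousAt]
  intro x
  rw [continuousAt_iff_continuous_left_right]
  refine ⟨?_, (cdf (gaussianReal 0 1)).right_continuous x⟩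
  have h1 : (cdf (gaussianReal 0 1)).measure {x} = 0 := by rw [measure_cdf]; simp
  rw [StieltjesFunction.measure_singleton, ENNReal.ofReal_eq_zero, sub_nonpos] at h1
  have h2 := (cdf (gaussianReal 0 1)).mono.leftLim_le (le_refl x)
  have h3 := (cdf (gaussianReal 0 1)).mono.continuousWithinAt_Iio_iff_leftLim_eq.2
    (le_antisymm h2 h1)
  exact continuousWithinAt_Iio_iff_Iic.1 h3

theorem exists_normalCdf_eq {a : ℝ} (h0 : 0 < a) (h1 : a < 1) : ∃ u, normalCdf (-u) = a := by
  have := mem_range_of_exists_le_of_exists_ge continuous_normalCdf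
    (((tendsto_cdf_atBot (gaussianReal 0 1)).eventually (gt_mem_nhds h0)).exists.imp
      fun _ h => h.le)
    (((tendsto_cdf_atTop (gaussianReal 0 1)).eventually (lt_mem_nhds h1)).exists.imp
      fun _ h => h.le)
  obtain ⟨x, hx⟩ := this
  exact ⟨-x, by rw [neg_neg]; exact hx⟩

theorem tendsto_inv_sqrt_natCast : Tendsto (fun n : ℕ => (√(n : ℝ))⁻¹) atTop (𝓝 0) :=
  tendsto_inv_atTop_zero.comp (Real.tendsto_sqrt_atTop.comp tendsto_natCast_atTop_atTop)

theorem norm_cexp_sub_quadratic_le {w : ℂ} (hw : ‖w‖ ≤ 1) :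
    ‖Complex.exp w - (1 + w + w ^ 2 / 2)‖ ≤ ‖w‖ ^ 3 := by
  have := Complex.exp_bound hw (n := 3) (by norm_num)
  simp only [Finset.sum_range_succ, Finset.sum_range_zero, Nat.factorial] at this
  norm_num at this
  have h3 : 0 ≤ ‖w‖ ^ 3 := by positivity
  calc _ ≤ _ := this
    _ ≤ _ := by linarith

/-- The logarithm of the moment generating function along a tangent. -/
theorem HasTangent.tendsto_natMul_integral_cexp {P : Measure Ω} [IsProbabilityMeasure P]
    {Q : ℕ → Measure Ω} (hQ : ∀ᶠ n in atTop, IsProbabilityMeasure (Q n)) {g h : Ω → ℝ}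
    (hg : Measurable g) (hgL : MemLp g 2 P) (hT : HasTangent P Q g)
    (hh : Measurable h) {C : ℝ} (hC : ∀ x, |h x| ≤ C) (hh0 : ∫ x, h x ∂P = 0) (z : ℂ) :
    Tendsto (fun n : ℕ => (n : ℂ) *
        (∫ x, Complex.exp (z * ((√(n : ℝ))⁻¹ * h x : ℝ)) ∂(Q n) - 1)) atTop
      (𝓝 (z * (∫ x, h x * g x ∂P : ℝ) + z ^ 2 / 2 * (∫ x, h x ^ 2 ∂P : ℝ))) := by
  have hC0 : 0 ≤ C := by
    obtain ⟨x⟩ : Nonempty Ω := nonempty_of_isProbabilityMeasure P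
    exact (abs_nonneg _).trans (hC x)
  have t1 := hT.tendsto_sqrt_mul_integral_sub hQ hg hgL hh hC
  rw [hh0] at t1
  simp only [sub_zero] at t1
  have hC2 : ∀ x, |h x ^ 2| ≤ C ^ 2 := fun x => by
    rw [abs_pow]; exact pow_le_pow_left₀ (abs_nonneg _) (hC x) 2
  have t2 := hT.tendsto_sqrt_mul_integral_sub hQ hg hgL (hh.pow_const 2) hC2
  -- Second moments enter with a factor `1/n` already, so plain convergence suffices for them; only
  -- first moments need the expansion at scale `√n`.
  have t2' : Tendsto (fun n : ℕ => ∫ x, h x ^ 2 ∂(Q n)) atTop (𝓝 (∫ x, h x ^ 2 ∂P)) := by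
    have := (t2.mul tendsto_inv_sqrt_natCast).add_const (∫ x, h x ^ 2 ∂P)
    rw [mul_zero, zero_add] at this
    refine this.congr' ?_
    filter_upwards [eventually_gt_atTop 0] with n hn
    have : √(n : ℝ) ≠ 0 := (Real.sqrt_pos.2 (by exact_mod_cast hn)).ne'
    field_simp
    ring
  have main : Tendsto (fun n : ℕ => z * (√(n : ℝ) * ∫ x, h x ∂(Q n) : ℝ) +
      z ^ 2 / 2 * (∫ x, h x ^ 2 ∂(Q n) : ℝ)) atTop
      (𝓝 (z * (∫ x, h x * g x ∂P : ℝ) + z ^ 2 / 2 * (∫ x, h x ^ 2 ∂P : ℝ))) :=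
    ((Complex.continuous_ofReal.tendsto _ |>.comp t1).const_mul z).add
      ((Complex.continuous_ofReal.tendsto _ |>.comp t2').const_mul _)
  have err : Tendsto (fun n : ℕ => (‖z‖ * C) ^ 3 * (√(n : ℝ))⁻¹) atTop (𝓝 0) := by
    simpa using tendsto_inv_sqrt_natCast.const_mul ((‖z‖ * C) ^ 3)
  have small : Tendsto (fun n : ℕ => ‖z‖ * ((√(n : ℝ))⁻¹ * C)) atTop (𝓝 0) := by
    simpa using (tendsto_inv_sqrt_natCast.mul_const C).const_mul ‖z‖
  rw [← tendsto_sub_nhds_zero_iff]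
  rw [← tendsto_sub_nhds_zero_iff] at main
  have hdiff : Tendsto (fun n : ℕ => (n : ℂ) *
        (∫ x, Complex.exp (z * ((√(n : ℝ))⁻¹ * h x : ℝ)) ∂(Q n) - 1) -
        (z * (√(n : ℝ) * ∫ x, h x ∂(Q n) : ℝ) + z ^ 2 / 2 * (∫ x, h x ^ 2 ∂(Q n) : ℝ)))
      atTop (𝓝 0) := by
    -- The Taylor remainder of third order is at most `(‖z‖ C/√n)³`, and `n` times this is
    -- `O(1/√n)`. Boundedness of `h` makes the estimate uniform over the changing laws.
    refine squeeze_zero_norm' ?_ err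
    filter_upwards [hQ, eventually_gt_atTop 0,
      small.eventually (ge_mem_nhds (zero_lt_one (α := ℝ)))] with n _ hn hsm
    have hnr : (0 : ℝ) < n := by exact_mod_cast hn
    have hs : 0 < √(n : ℝ) := Real.sqrt_pos.2 hnr
    have hss : √(n : ℝ) * √n = n := Real.mul_self_sqrt hnr.le
    set s := √(n : ℝ) with hsdef
    have hwb : ∀ x, ‖z * ((s⁻¹ * h x : ℝ) : ℂ)‖ ≤ ‖z‖ * (s⁻¹ * C) := fun x => by
      rw [norm_mul, Complex.norm_real, Real.norm_eq_abs, abs_mul, abs_of_pos (inv_pos.2 hs)]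
      gcongr
      exact hC x
    have hi1 : Integrable (fun x => z * ((s⁻¹ * h x : ℝ) : ℂ)) (Q n) :=
      Integrable.of_bound (by fun_prop) _ (ae_of_all _ hwb)
    have hi2 : Integrable (fun x => (z * ((s⁻¹ * h x : ℝ) : ℂ)) ^ 2 / 2) (Q n) := by
      refine (Integrable.of_bound (C := (‖z‖ * (s⁻¹ * C)) ^ 2) (by fun_prop)
        (ae_of_all _ fun x => ?_)).div_const _
      rw [norm_pow]
      exact pow_le_pow_left₀ (norm_nonneg _) (hwb x) 2
    have hie : Integrable (fun x => Complex.exp (z * ((s⁻¹ * h x : ℝ) : ℂ))) (Q n) := by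
      refine Integrable.of_bound (C := Real.exp 1) (by fun_prop) (ae_of_all _ fun x => ?_)
      rw [Complex.norm_exp]
      exact Real.exp_le_exp.2 ((Complex.re_le_norm _).trans ((hwb x).trans hsm))
    have hq : Integrable (fun x => 1 + z * ((s⁻¹ * h x : ℝ) : ℂ) +
        (z * ((s⁻¹ * h x : ℝ) : ℂ)) ^ 2 / 2) (Q n) := ((integrable_const _).add hi1).add hi2
    have e1 : ∫ x, (1 + z * ((s⁻¹ * h x : ℝ) : ℂ) + (z * ((s⁻¹ * h x : ℝ) : ℂ)) ^ 2 / 2) ∂(Q n) =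
        1 + z * s⁻¹ * (∫ x, h x ∂(Q n) : ℝ) + z ^ 2 / 2 * s⁻¹ ^ 2 * (∫ x, h x ^ 2 ∂(Q n) : ℝ) := by
      rw [integral_add (f := fun x => 1 + z * ((s⁻¹ * h x : ℝ) : ℂ))
        ((integrable_const _).add hi1) hi2, integral_add (integrable_const _) hi1]
      simp only [integral_const, probReal_univ, one_smul]
      congr 1
      · rw [integral_const_mul, integral_complex_ofReal, integral_const_mul]
        push_cast; ring
      · have : ∀ x, (z * ((s⁻¹ * h x : ℝ) : ℂ)) ^ 2 / 2 =
          z ^ 2 / 2 * (s : ℂ)⁻¹ ^ 2 * ((h x ^ 2 : ℝ) : ℂ) := fun x => by push_cast; ring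
        simp_rw [this]
        rw [integral_const_mul, integral_complex_ofReal, Complex.ofReal_inv]
    have e2 : (n : ℂ) * (∫ x, Complex.exp (z * ((s⁻¹ * h x : ℝ))) ∂(Q n) - 1) -
        (z * (s * ∫ x, h x ∂(Q n) : ℝ) + z ^ 2 / 2 * (∫ x, h x ^ 2 ∂(Q n) : ℝ)) =
        n * ∫ x, (Complex.exp (z * ((s⁻¹ * h x : ℝ))) -
          (1 + z * ((s⁻¹ * h x : ℝ) : ℂ) + (z * ((s⁻¹ * h x : ℝ) : ℂ)) ^ 2 / 2)) ∂(Q n) := by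
      rw [integral_sub hie hq, e1]
      have hnc : (n : ℂ) = s * s := by exact_mod_cast hss.symm
      have hsc : (s : ℂ) ≠ 0 := by exact_mod_cast hs.ne'
      rw [hnc]
      push_cast
      field_simp
      ring
    rw [e2, norm_mul, Complex.norm_natCast]
    have e3 : ‖∫ x, (Complex.exp (z * ((s⁻¹ * h x : ℝ))) -
          (1 + z * ((s⁻¹ * h x : ℝ) : ℂ) + (z * ((s⁻¹ * h x : ℝ) : ℂ)) ^ 2 / 2)) ∂(Q n)‖ ≤
        (‖z‖ * (s⁻¹ * C)) ^ 3 := by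
      have := norm_integral_le_of_norm_le_const (μ := Q n) (C := (‖z‖ * (s⁻¹ * C)) ^ 3)
        (f := fun x => Complex.exp (z * ((s⁻¹ * h x : ℝ))) -
          (1 + z * ((s⁻¹ * h x : ℝ) : ℂ) + (z * ((s⁻¹ * h x : ℝ) : ℂ)) ^ 2 / 2))
        (ae_of_all _ fun x => (norm_cexp_sub_quadratic_le ((hwb x).trans hsm)).trans
          (pow_le_pow_left₀ (norm_nonneg _) (hwb x) 3))
      simpa using this
    calc (n : ℝ) * _ ≤ n * (‖z‖ * (s⁻¹ * C)) ^ 3 := by gcongr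
      _ = (‖z‖ * C) ^ 3 * s⁻¹ := by rw [← hss]; field_simp
  have := hdiff.add main
  rw [add_zero] at this
  exact this.congr fun n => by ring

/-- Powers of the moment generating function along a tangent. -/
theorem HasTangent.tendsto_integral_cexp_pow {P : Measure Ω} [IsProbabilityMeasure P]
    {Q : ℕ → Measure Ω} (hQ : ∀ᶠ n in atTop, IsProbabilityMeasure (Q n)) {g h : Ω → ℝ}
    (hg : Measurable g) (hgL : MemLp g 2 P) (hT : HasTangent P Q g)
    (hh : Measurable h) {C : ℝ} (hC : ∀ x, |h x| ≤ C) (hh0 : ∫ x, h x ∂P = 0) (z : ℂ) :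
    Tendsto (fun n : ℕ => (∫ x, Complex.exp (z * ((√(n : ℝ))⁻¹ * h x : ℝ)) ∂(Q n)) ^ n) atTop
      (𝓝 (Complex.exp (z * (∫ x, h x * g x ∂P : ℝ) + z ^ 2 / 2 * (∫ x, h x ^ 2 ∂P : ℝ)))) := by
  refine (Complex.tendsto_one_add_pow_exp_of_tendsto
    (hT.tendsto_natMul_integral_cexp hQ hg hgL hh hC hh0 z)).congr fun n => ?_
  ring

theorem charFun_map_scaledSum {Q : Measure Ω} [IsProbabilityMeasure Q] {h : Ω → ℝ}
    (hh : Measurable h) (n : ℕ) (t : ℝ) :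
    charFun ((Measure.pi fun _ : Fin n => Q).map fun x => scaledSum h x) t =
      (∫ x, Complex.exp (t * Complex.I * ((√(n : ℝ))⁻¹ * h x : ℝ)) ∂Q) ^ n := by
  rw [charFun_apply_real, integral_map (measurable_scaledSum hh n).aemeasurable (by fun_prop)]
  have := integral_fintype_prod_eq_pow (ι := Fin n) (μ := Q)
    (fun x => Complex.exp (t * Complex.I * ((√(n : ℝ))⁻¹ * h x : ℝ)))
  rw [Fintype.card_fin] at this
  rw [← this]
  refine integral_congr_ae (ae_of_all _ fun x => ?_)
  simp only [scaledSum]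
  rw [← Complex.exp_sum]
  congr 1
  push_cast
  rw [Finset.mul_sum, Finset.mul_sum, Finset.sum_mul]
  exact Finset.sum_congr rfl fun i _ => by ring

/-- Rejection probabilities of bounded scores under local alternatives. -/
theorem HasTangent.tendsto_measure_scaledSum {P : Measure Ω} [IsProbabilityMeasure P]
    {Q : ℕ → Measure Ω} (hQ : ∀ᶠ n in atTop, IsProbabilityMeasure (Q n)) {g h : Ω → ℝ}
    (hg : Measurable g) (hgL : MemLp g 2 P) (hT : HasTangent P Q g)
    (hh : Measurable h) {C : ℝ} (hC : ∀ x, |h x| ≤ C) (hh0 : ∫ x, h x ∂P = 0)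
    {σ : ℝ} (hσ : 0 < σ) (hσ2 : ∫ x, h x ^ 2 ∂P = σ ^ 2) (t : ℝ) :
    Tendsto (fun n : ℕ => (Measure.pi fun _ : Fin n => Q n).real {x | t < scaledSum h x}) atTop
      (𝓝 (normalCdf ((∫ x, h x * g x ∂P - t) / σ))) := by
  classical
  -- Weak convergence is stated for sequences of probability measures, so the finitely many
  -- exceptional members are replaced by `P`.
  wlog hall : ∀ n, IsProbabilityMeasure (Q n) generalizing Q
  · have hQ' : ∀ᶠ n in atTop, Q n = if IsProbabilityMeasure (Q n) then Q n else P := by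
      filter_upwards [hQ] with n hn
      rw [if_pos hn]
    have hp : ∀ n, IsProbabilityMeasure (if IsProbabilityMeasure (Q n) then Q n else P) := by
      intro n; split_ifs with h <;> infer_instance
    refine (this (Q := fun n => if IsProbabilityMeasure (Q n) then Q n else P)
      (.of_forall hp) (hT.congr_eventually hQ') hp).congr' ?_
    filter_upwards [hQ'] with n hn
    rw [← hn]
  let ν : ℕ → ProbabilityMeasure ℝ := fun n =>
    ⟨(Measure.pi fun _ : Fin n => Q n).map fun x => scaledSum h x,
      Measure.isProbabilityMeasure_map (measurable_scaledSum hh n).aemeasurable⟩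
  let G : ProbabilityMeasure ℝ :=
    ⟨gaussianReal (∫ x, h x * g x ∂P) (σ ^ 2).toNNReal, inferInstance⟩
  have hν : Tendsto ν atTop (𝓝 G) := by
    refine ProbabilityMeasure.tendsto_of_tendsto_charFun fun t => ?_
    have h1 := hT.tendsto_integral_cexp_pow hQ hg hgL hh hC hh0 (t * Complex.I)
    have h2 : charFun (G : Measure ℝ) t = Complex.exp (t * Complex.I *
        (∫ x, h x * g x ∂P : ℝ) + (t * Complex.I) ^ 2 / 2 * (∫ x, h x ^ 2 ∂P : ℝ)) := by
      change charFun (gaussianReal _ _) t = _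
      rw [charFun_gaussianReal, hσ2]
      congr 1
      rw [mul_pow, Complex.I_sq]
      rw [Real.coe_toNNReal _ (sq_nonneg σ)]
      push_cast
      ring
    rw [h2]
    exact h1.congr fun n => (charFun_map_scaledSum hh n t).symm
  have hv : ((σ ^ 2).toNNReal : NNReal) ≠ 0 := by
    simp [hσ.ne']
  have hfr : (G : Measure ℝ) (frontier (Set.Ioi t)) = 0 := by
    rw [frontier_Ioi]
    have : NullSingletonClass (gaussianReal (∫ x, h x * g x ∂P) (σ ^ 2).toNNReal) :=
      nullSingletonClass_gaussianReal hv
    exact measure_singleton (μ := gaussianReal (∫ x, h x * g x ∂P) (σ ^ 2).toNNReal) t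
  have := ProbabilityMeasure.tendsto_measure_of_null_frontier_of_tendsto' hν hfr
  have h3 := (ENNReal.tendsto_toReal (measure_ne_top _ _)).comp this
  rw [← gaussianReal_Ioi _ hσ]
  refine h3.congr fun n => ?_
  simp only [Function.comp, ν, ProbabilityMeasure.coe_mk]
  rw [Measure.map_apply (measurable_scaledSum hh n) measurableSet_Ioi]
  rfl

/-! ### Construction of local alternatives -/

/-- Dominated convergence with the factor `n` absorbed into the square. Together with
`tendsto_sqrt_mul_remainder` it reduces the verification of a tangent to a pointwise derivative at
`s = 0` and a square integrable bound. -/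
theorem tendsto_natMul_lintegral_sq {P : Measure Ω} {F : ℕ → Ω → ℝ} {B : Ω → ℝ}
    (hF : ∀ n, Measurable (F n)) (hB : MemLp B 2 P)
    (hFB : ∀ᶠ n : ℕ in atTop, ∀ x, √n * |F n x| ≤ B x)
    (hlim : ∀ x, Tendsto (fun n : ℕ => √n * F n x) atTop (𝓝 0)) :
    Tendsto (fun n : ℕ => (n : ℝ≥0∞) * ∫⁻ x, ENNReal.ofReal (F n x ^ 2) ∂P) atTop (𝓝 0) := by
  have h1 : ∀ n : ℕ, (n : ℝ≥0∞) * ∫⁻ x, ENNReal.ofReal (F n x ^ 2) ∂P =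
      ∫⁻ x, ENNReal.ofReal ((√n * F n x) ^ 2) ∂P := fun n => by
    rw [← lintegral_const_mul _ ((hF n).pow_const 2).ennreal_ofReal]
    refine lintegral_congr fun x => ?_
    rw [mul_pow, Real.sq_sqrt (Nat.cast_nonneg n), ENNReal.ofReal_mul (Nat.cast_nonneg n),
      ENNReal.ofReal_natCast]
  simp_rw [h1]
  have h2 := tendsto_lintegral_filter_of_dominated_convergence (μ := P) (l := atTop)
    (F := fun (n : ℕ) x => ENNReal.ofReal ((√n * F n x) ^ 2)) (f := fun _ => 0)
    (fun x => ENNReal.ofReal (B x ^ 2))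
    (.of_forall fun n => (((hF n).const_mul _).pow_const 2).ennreal_ofReal)
    (hFB.mono fun n hn => ae_of_all _ fun x => ENNReal.ofReal_le_ofReal ?_)
    ((hasFiniteIntegral_iff_ofReal (ae_of_all _ fun x => sq_nonneg _)).1 hB.integrable_sq.2).ne
    (ae_of_all _ fun x => ?_)
  · simpa using h2
  · rw [← sq_abs, abs_mul, abs_of_nonneg (Real.sqrt_nonneg _)]
    exact pow_le_pow_left₀ (by positivity) (hn x) 2
  · have := ENNReal.tendsto_ofReal ((hlim x).pow 2)
    simpa using this

theorem tendsto_sqrt_mul_remainder {f : ℝ → ℝ} {f' : ℝ} (hf : HasDerivAt f f' 0) :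
    Tendsto (fun n : ℕ => √n * (f (√(n : ℝ))⁻¹ - (f 0 + (√(n : ℝ))⁻¹ * f'))) atTop (𝓝 0) := by
  have h1 := hasDerivAt_iff_tendsto_slope_zero.1 hf
  have h2 : Tendsto (fun n : ℕ => (√(n : ℝ))⁻¹) atTop (𝓝[≠] 0) := by
    refine tendsto_nhdsWithin_iff.2 ⟨tendsto_inv_sqrt_natCast, ?_⟩
    filter_upwards [eventually_gt_atTop 0] with n hn
    exact inv_ne_zero (Real.sqrt_pos.2 (by exact_mod_cast hn)).ne'
  have h3 := (h1.comp h2).sub_const f'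
  rw [sub_self] at h3
  refine h3.congr' ?_
  filter_upwards [eventually_gt_atTop 0] with n hn
  have : √(n : ℝ) ≠ 0 := (Real.sqrt_pos.2 (by exact_mod_cast hn)).ne'
  simp only [Function.comp, zero_add, inv_inv, smul_eq_mul]
  field_simp
  ring

/-- Up to the factor `√c ≤ 1`, the map `X ↦ √(c X² + d)` is a Euclidean norm of `(X, const)`, hence
a contraction. It carries an `L₂` approximation of the root density of `Q n` over to a mixture,
although nothing is known about that density pointwise. -/
theorem sqrt_contraction {c d X y : ℝ} (hc : 0 ≤ c) (hc1 : c ≤ 1) (hd : 0 ≤ d) :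
    (√(c * X ^ 2 + d) - √(c * y ^ 2 + d)) ^ 2 ≤ (X - y) ^ 2 := by
  have h1 : c * X * y + d ≤ √(c * X ^ 2 + d) * √(c * y ^ 2 + d) := by
    rw [← Real.sqrt_mul (by positivity)]
    refine (le_abs_self _).trans (Real.abs_le_sqrt ?_)
    nlinarith [mul_nonneg (mul_nonneg hc hd) (sq_nonneg (X - y))]
  have h2 := Real.sq_sqrt (by positivity : 0 ≤ c * X ^ 2 + d)
  have h3 := Real.sq_sqrt (by positivity : 0 ≤ c * y ^ 2 + d)
  nlinarith [mul_nonneg (sub_nonneg.2 hc1) (sq_nonneg (X - y))]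

/-- The dominating function for `HasTangent.mixture`: pointwise differentiability in `s` alone gives
no bound uniform in `x`, as `g` may be unbounded. -/
theorem abs_sqrt_mixture_sub_le {s r g a : ℝ} (hs : 0 < s) (hs1 : s ≤ 1) (hr : 0 ≤ r)
    (hrs : r * s ≤ 1 / 2) (ha : 0 ≤ a) :
    |√((1 - r * s) * (1 + s * g / 2) ^ 2 + s * a) - (1 + s * ((g + a - r) / 2))| ≤
      s * ((4 + 2 * r) * (1 + |g| + a)) := by
  set c := 1 - r * s with hc
  set y := 1 + s * g / 2 with hy
  set A := √(c * y ^ 2 + s * a) with hA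
  have hrs0 : 0 ≤ r * s := by positivity
  have hsa : 0 ≤ s * a := by positivity
  have hc0 : 1 / 2 ≤ c := by linarith
  have hc1 : c ≤ 1 := by linarith
  have hA2 : A ^ 2 = c * y ^ 2 + s * a := Real.sq_sqrt (by positivity)
  have hA0 : 0 ≤ A := Real.sqrt_nonneg _
  set k := √c with hk
  have hk2 : k ^ 2 = c := Real.sq_sqrt (by linarith)
  have hk0 : 0 ≤ k := Real.sqrt_nonneg _
  have hk1 : k ≤ 1 := by rw [hk]; exact Real.sqrt_le_one.2 hc1
  have hkc : c ≤ k := by nlinarith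
  have hg := abs_nonneg g
  have hyg : |y| ≤ 1 + |g| := by
    rw [hy, abs_le]
    have h1 := abs_le.1 (le_refl |g|)
    constructor <;> nlinarith
  have hAk : k * |y| ≤ A := by
    refine Real.le_sqrt_of_sq_le ?_
    rw [mul_pow, sq_abs, hk2]; linarith
  -- If `|y| ≥ 1/2`, the difference of roots is divided by a sum bounded away from zero. Otherwise
  -- `s |g| ≥ 1`, so constants are absorbed into `s |g|`.
  have b1 : A - k * |y| ≤ s * (|g| + 2 * a) := by
    by_cases h : 1 / 2 ≤ |y|
    · have h1 : (A - k * |y|) * (A + k * |y|) = s * a := by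
        have : (k * |y|) ^ 2 = c * y ^ 2 := by rw [mul_pow, sq_abs, hk2]
        nlinarith
      have h2 : 1 / 2 ≤ A + k * |y| := by nlinarith
      have h3 : (A - k * |y|) * (1 / 2) ≤ s * a := by
        rw [← h1]; exact mul_le_mul_of_nonneg_left h2 (by linarith)
      nlinarith [mul_nonneg hs.le hg]
    · push Not at h
      have h1 : 1 ≤ s * |g| := by
        have h2 : y < 1 / 2 := (le_abs_self y).trans_lt h
        have h3 : -(s * |g|) ≤ s * g := by
          have := mul_le_mul_of_nonneg_left (neg_abs_le g) hs.le
          linarith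
        rw [hy] at h2
        linarith
      have h4 : A ≤ k * |y| + (1 + s * a) / 2 := by
        refine Real.sqrt_le_iff.2 ⟨by positivity, ?_⟩
        have h6 : (k * |y|) ^ 2 = c * y ^ 2 := by rw [mul_pow, sq_abs, hk2]
        have h7 : 0 ≤ k * |y| := by positivity
        nlinarith [sq_nonneg (1 - s * a)]
      nlinarith
  have b2 : |y| - k * |y| ≤ r * s * (1 + |g|) := by
    have : (1 - k) * |y| ≤ (r * s) * (1 + |g|) :=
      mul_le_mul (by linarith) hyg (abs_nonneg _) hrs0
    linarith
  have b3 : |y| - y ≤ s * |g| := by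
    have h3 : -(s * |g|) ≤ s * g := by
      have := mul_le_mul_of_nonneg_left (neg_abs_le g) hs.le
      linarith
    rcases abs_cases y with ⟨h, _⟩ | ⟨h, _⟩ <;> rw [h]
    · nlinarith
    · rw [hy]; nlinarith
  have b4 : |y| ≥ y := le_abs_self y
  have hkpos : k * |y| ≤ |y| := mul_le_of_le_one_left (abs_nonneg _) hk1
  have e : 1 + s * ((g + a - r) / 2) = y + s * a / 2 - s * r / 2 := by rw [hy]; ring
  rw [e, abs_le]
  have p1 := mul_nonneg hs.le hg
  have p2 := mul_nonneg hrs0 hg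
  have p3 := mul_nonneg hrs0 ha
  constructor <;> nlinarith

theorem HasTangent.of_density {P : Measure Ω} [SigmaFinite P] {Q : ℕ → Measure Ω}
    {v : ℕ → Ω → ℝ} {g : Ω → ℝ} (hv : ∀ n, Measurable (v n))
    (hv0 : ∀ᶠ n in atTop, ∀ x, 0 ≤ v n x)
    (hQ : ∀ᶠ n in atTop, Q n = P.withDensity fun x => ENNReal.ofReal (v n x))
    (h : Tendsto (fun n : ℕ => (n : ℝ≥0∞) *
      ∫⁻ x, ENNReal.ofReal ((√(v n x) - (1 + g x / √n / 2)) ^ 2) ∂P) atTop (𝓝 0)) :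
    HasTangent P Q g := by
  refine h.congr' ?_
  filter_upwards [hv0, hQ] with n hn0 hn
  rw [hellingerDefect, hn, Measure.singularPart_withDensity]
  simp only [Measure.coe_zero, Pi.zero_apply, add_zero]
  congr 1
  refine lintegral_congr_ae ?_
  filter_upwards [Measure.rnDeriv_withDensity P (hv n).ennreal_ofReal] with x hx
  rw [hx, ENNReal.toReal_ofReal (hn0 x)]

theorem HasTangent.const (P : Measure Ω) [IsProbabilityMeasure P] :
    HasTangent P (fun _ => P) (fun _ => 0) := by
  refine HasTangent.of_density (v := fun _ _ => 1) (fun _ => measurable_const)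
    (.of_forall fun _ _ => zero_le_one) (.of_forall fun _ => by simp [withDensity_const]) ?_
  simp

/-- Contaminating a sequence with tangent `g` by the law `(a / r) dP` at rate `r / √n`. -/
theorem HasTangent.mixture {P : Measure Ω} [IsProbabilityMeasure P] {Q : ℕ → Measure Ω}
    (hQ : ∀ᶠ n in atTop, IsProbabilityMeasure (Q n)) {g a : Ω → ℝ} (hg : Measurable g)
    (hgL : MemLp g 2 P) (hT : HasTangent P Q g) (ha : Measurable a) (ha0 : ∀ x, 0 ≤ a x)
    (haL : MemLp a 2 P) {r : ℝ} (hr : 0 < r) :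
    HasTangent P (fun n : ℕ => ENNReal.ofReal (1 - r / √n) • Q n +
      ENNReal.ofReal (r / √n) • P.withDensity fun x => ENNReal.ofReal (a x / r))
      (fun x => g x + a x - r) := by
  set M := P.withDensity fun x => ENNReal.ofReal (a x / r) with hM
  have hMf : IsFiniteMeasure M :=
    isFiniteMeasure_withDensity_ofReal ((haL.integrable one_le_two).div_const r).2
  -- The error made when the root density of `Q n` is replaced by its ideal form `1 + g/(2√n)`
  -- inside the mixture. The deviation of `Q n` from the ideal form is handled separately, by
  -- contraction.
  set F : ℕ → Ω → ℝ := fun n x =>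
    √((1 - r * (√(n : ℝ))⁻¹) * (1 + (√(n : ℝ))⁻¹ * g x / 2) ^ 2 + (√(n : ℝ))⁻¹ * a x) -
      (1 + (√(n : ℝ))⁻¹ * ((g x + a x - r) / 2)) with hF
  have hFm : ∀ n, Measurable (F n) := fun n => by fun_prop
  have small : ∀ᶠ n : ℕ in atTop, r * (√(n : ℝ))⁻¹ ≤ 1 / 2 := by
    have := tendsto_inv_sqrt_natCast.const_mul r
    rw [mul_zero] at this
    exact this.eventually (ge_mem_nhds (by norm_num))
  have hFlim : Tendsto (fun n : ℕ => (n : ℝ≥0∞) * ∫⁻ x, ENNReal.ofReal (F n x ^ 2) ∂P)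
      atTop (𝓝 0) := by
    refine tendsto_natMul_lintegral_sq (B := fun x => (4 + 2 * r) * (1 + |g x| + a x)) hFm
      (((memLp_const (1 : ℝ)).add hgL.norm).add haL |>.const_mul _) ?_ fun x => ?_
    · filter_upwards [small, eventually_gt_atTop 0] with n hn hn0 x
      have hn1 : (1 : ℝ) ≤ n := by exact_mod_cast hn0
      have hs : 0 < √(n : ℝ) := Real.sqrt_pos.2 (by linarith)
      have := abs_sqrt_mixture_sub_le (g := g x) (inv_pos.2 hs)
        (inv_le_one_of_one_le₀ (by rw [Real.one_le_sqrt]; exact hn1)) hr.le hn (ha0 x)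
      calc √(n : ℝ) * |F n x| ≤ √(n : ℝ) * _ := mul_le_mul_of_nonneg_left this hs.le
        _ = _ := by field_simp
    · have hd : HasDerivAt (fun s : ℝ => √((1 - r * s) * (1 + s * g x / 2) ^ 2 + s * a x))
          ((g x + a x - r) / 2) 0 := by
        have h1 : HasDerivAt (fun s : ℝ => (1 - r * s) * (1 + s * g x / 2) ^ 2 + s * a x)
            (g x + a x - r) 0 := by
          have := (((((hasDerivAt_id (0 : ℝ)).const_mul r).const_sub 1).mul
            (((((hasDerivAt_id (0 : ℝ)).mul_const (g x)).div_const 2).const_add 1).pow 2)).add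
              ((hasDerivAt_id (0 : ℝ)).mul_const (a x)))
          convert! this using 1
          simp
          ring
        have := h1.sqrt (by simp)
        convert! this using 1
        simp
      have := tendsto_sqrt_mul_remainder hd
      simpa [hF] using this
  have hT2 : Tendsto (fun n : ℕ => 2 * ((n : ℝ≥0∞) * hellingerDefect P (Q n) fun x => g x / √n) +
      2 * ((n : ℝ≥0∞) * ∫⁻ x, ENNReal.ofReal (F n x ^ 2) ∂P)) atTop (𝓝 0) := by
    have h1 := ENNReal.Tendsto.const_mul (a := 2) hT (Or.inr (by simp))
    have h2 := ENNReal.Tendsto.const_mul (a := 2) hFlim (Or.inr (by simp))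
    simpa using h1.add h2
  refine tendsto_of_tendsto_of_tendsto_of_le_of_le' tendsto_const_nhds hT2
    (.of_forall fun _ => zero_le) ?_
  filter_upwards [hQ, small, eventually_gt_atTop 0] with n _ hn hn0
  have hn1 : (1 : ℝ) ≤ n := by exact_mod_cast hn0
  have hs : 0 < √(n : ℝ) := Real.sqrt_pos.2 (by linarith)
  set s := √(n : ℝ) with hsdef
  have hrs : r / s ≤ 1 / 2 := by rwa [div_eq_mul_inv]
  have hrs0 : 0 ≤ r / s := by positivity
  -- The contaminating law is dominated by `P`, so no singular mass is added.
  have hsing : (ENNReal.ofReal (1 - r / s) • Q n + ENNReal.ofReal (r / s) • M).singularPart P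
      Set.univ ≤ (Q n).singularPart P Set.univ := by
    have e1 : ENNReal.ofReal (1 - r / s) • Q n = Real.toNNReal (1 - r / s) • Q n := rfl
    have e2 : ENNReal.ofReal (r / s) • M = Real.toNNReal (r / s) • M := rfl
    rw [Measure.singularPart_add, e1, e2, Measure.singularPart_smul, Measure.singularPart_smul, hM,
      Measure.singularPart_withDensity, smul_zero, add_zero]
    change ENNReal.ofReal (1 - r / s) * _ ≤ _
    exact mul_le_of_le_one_left (zero_le) (ENNReal.ofReal_le_one.2 (by linarith))
  have hrn : (fun x => ((ENNReal.ofReal (1 - r / s) • Q n +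
      ENNReal.ofReal (r / s) • M).rnDeriv P x).toReal) =ᵐ[P]
      fun x => (1 - r * s⁻¹) * √((Q n).rnDeriv P x).toReal ^ 2 + s⁻¹ * a x := by
    have i1 : IsFiniteMeasure (ENNReal.ofReal (1 - r / s) • Q n) :=
      Measure.smul_finite _ ENNReal.ofReal_ne_top
    have i2 : IsFiniteMeasure (ENNReal.ofReal (r / s) • M) :=
      Measure.smul_finite _ ENNReal.ofReal_ne_top
    filter_upwards [Measure.rnDeriv_add (ENNReal.ofReal (1 - r / s) • Q n)
      (ENNReal.ofReal (r / s) • M) P,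
      Measure.rnDeriv_smul_left_of_ne_top (Q n) P (ENNReal.ofReal_ne_top (r := 1 - r / s)),
      Measure.rnDeriv_smul_left_of_ne_top M P (ENNReal.ofReal_ne_top (r := r / s)),
      Measure.rnDeriv_withDensity P (ha.div_const r).ennreal_ofReal,
      (Q n).rnDeriv_lt_top P] with x h1 h2 h3 h4 h5
    rw [h1, Pi.add_apply, h2, h3, Pi.smul_apply, Pi.smul_apply, hM, h4, smul_eq_mul, smul_eq_mul,
      ENNReal.toReal_add (by finiteness) (by finiteness), ENNReal.toReal_mul, ENNReal.toReal_mul,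
      ENNReal.toReal_ofReal (by linarith), ENNReal.toReal_ofReal hrs0,
      ENNReal.toReal_ofReal (div_nonneg (ha0 x) hr.le), Real.sq_sqrt ENNReal.toReal_nonneg]
    field_simp
  have hpm := (Measure.measurable_rnDeriv (Q n) P).ennreal_toReal.sqrt
  have hmain : hellingerDefect P (ENNReal.ofReal (1 - r / s) • Q n + ENNReal.ofReal (r / s) • M)
      (fun x => (g x + a x - r) / s) ≤
      2 * hellingerDefect P (Q n) (fun x => g x / s) +
        2 * ∫⁻ x, ENNReal.ofReal (F n x ^ 2) ∂P := by
    rw [hellingerDefect, hellingerDefect, mul_add]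
    have : ∫⁻ x, ENNReal.ofReal ((√((ENNReal.ofReal (1 - r / s) • Q n +
        ENNReal.ofReal (r / s) • M).rnDeriv P x).toReal - (1 + (g x + a x - r) / s / 2)) ^ 2) ∂P ≤
        2 * ∫⁻ x, ENNReal.ofReal ((√((Q n).rnDeriv P x).toReal - (1 + g x / s / 2)) ^ 2) ∂P +
          2 * ∫⁻ x, ENNReal.ofReal (F n x ^ 2) ∂P := by
      rw [← lintegral_const_mul _ (by fun_prop), ← lintegral_const_mul _ (by fun_prop),
        ← lintegral_add_left (by fun_prop)]
      refine lintegral_mono_ae ?_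
      filter_upwards [hrn] with x hx
      rw [hx, ← ENNReal.ofReal_ofNat 2, ← ENNReal.ofReal_mul (by norm_num),
        ← ENNReal.ofReal_mul (by norm_num), ← ENNReal.ofReal_add (by positivity) (by positivity)]
      refine ENNReal.ofReal_le_ofReal ?_
      have hc := sqrt_contraction (c := 1 - r * s⁻¹) (d := s⁻¹ * a x)
        (X := √((Q n).rnDeriv P x).toReal) (y := 1 + s⁻¹ * g x / 2)
        (by linarith) (by linarith [(by positivity : 0 ≤ r * s⁻¹)])
        (mul_nonneg (inv_pos.2 hs).le (ha0 x))
      have e1 : 1 + g x / s / 2 = 1 + s⁻¹ * g x / 2 := by rw [div_eq_inv_mul (g x)]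
      have e2 : 1 + (g x + a x - r) / s / 2 = 1 + s⁻¹ * ((g x + a x - r) / 2) := by ring
      rw [e1, e2]
      simp only [hF]
      rw [← hsdef]
      set U := √((1 - r * s⁻¹) * √((Q n).rnDeriv P x).toReal ^ 2 + s⁻¹ * a x)
      set V := √((1 - r * s⁻¹) * (1 + s⁻¹ * g x / 2) ^ 2 + s⁻¹ * a x)
      set m := 1 + s⁻¹ * ((g x + a x - r) / 2)
      nlinarith [sq_nonneg (U - V - (V - m))]
    calc _ ≤ _ := add_le_add this hsing
      _ ≤ _ := by
        rw [add_right_comm]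
        gcongr
        exact le_mul_of_one_le_left zero_le one_le_two
  calc (n : ℝ≥0∞) * _ ≤ n * _ := mul_le_mul_right hmain _
    _ = _ := by ring

/-! ### Linear laws and their exponential tilts. -/

/-- The law with density `1 + q / √n`. -/
noncomputable def linearLaw (P : Measure Ω) (q : Ω → ℝ) (n : ℕ) : Measure Ω :=
  P.withDensity fun x => ENNReal.ofReal (1 + (√(n : ℝ))⁻¹ * q x)

/-- The normalizing constant of the exponential tilt of `linearLaw` by `b / √n`. -/
noncomputable def tiltMass (P : Measure Ω) (q b : Ω → ℝ) (n : ℕ) : ℝ :=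
  ∫ x, Real.exp ((√(n : ℝ))⁻¹ * b x) ∂(linearLaw P q n)

/-- The exponential tilt of `linearLaw` by `b / √n`. -/
noncomputable def tiltLaw (P : Measure Ω) (q b : Ω → ℝ) (n : ℕ) : Measure Ω :=
  (linearLaw P q n).withDensity fun x =>
    ENNReal.ofReal (Real.exp ((√(n : ℝ))⁻¹ * b x) / tiltMass P q b n)

theorem eventually_mul_inv_sqrt_le (r : ℝ) {c : ℝ} (hc : 0 < c) :
    ∀ᶠ n : ℕ in atTop, r * (√(n : ℝ))⁻¹ ≤ c := by
  have := tendsto_inv_sqrt_natCast.const_mul r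
  rw [mul_zero] at this
  exact this.eventually (ge_mem_nhds hc)

theorem linearLaw_density_ge {X : Type*} {q : X → ℝ} {r s : ℝ} (hqr : ∀ x, -r ≤ q x) (hs : 0 ≤ s)
    (hrs : r * s ≤ 1 / 2) (x : X) : 1 / 2 ≤ 1 + s * q x := by
  have := mul_le_mul_of_nonneg_left (hqr x) hs
  linarith

theorem isProbabilityMeasure_withDensity_ofReal {X : Type*} [MeasurableSpace X] {μ : Measure X}
    {f : X → ℝ} (hf0 : ∀ x, 0 ≤ f x) (hfi : Integrable f μ) (hf1 : ∫ x, f x ∂μ = 1) :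
    IsProbabilityMeasure (μ.withDensity fun x => ENNReal.ofReal (f x)) := by
  refine ⟨?_⟩
  rw [withDensity_apply _ .univ, setLIntegral_univ,
    ← ofReal_integral_eq_lintegral_ofReal hfi (ae_of_all _ hf0), hf1, ENNReal.ofReal_one]

theorem eventually_isProbabilityMeasure_linearLaw {P : Measure Ω} [IsProbabilityMeasure P]
    {q : Ω → ℝ} {r : ℝ} (hqi : Integrable q P) (hq0 : ∫ x, q x ∂P = 0) (hqr : ∀ x, -r ≤ q x) :
    ∀ᶠ n in atTop, IsProbabilityMeasure (linearLaw P q n) := by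
  filter_upwards [eventually_mul_inv_sqrt_le r (by norm_num : (0 : ℝ) < 1 / 2)] with n hn
  refine isProbabilityMeasure_withDensity_ofReal (fun x => ?_)
    ((integrable_const _).add (hqi.const_mul _)) ?_
  · linarith [linearLaw_density_ge hqr (inv_nonneg.2 (Real.sqrt_nonneg n)) hn x]
  · rw [integral_add (integrable_const _) (hqi.const_mul _), integral_const_mul, hq0]
    simp

/-- `linearLaw` as a contamination of `P`. -/
theorem linearLaw_eq_mixture {P : Measure Ω} [IsProbabilityMeasure P] {q : Ω → ℝ} {r : ℝ}
    (hq : Measurable q) (hr : 0 < r) (hqr : ∀ x, -r ≤ q x) {n : ℕ} (hn : 0 < n)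
    (hrn : r * (√(n : ℝ))⁻¹ ≤ 1 / 2) :
    linearLaw P q n = ENNReal.ofReal (1 - r / √n) • P +
      ENNReal.ofReal (r / √n) • P.withDensity fun x => ENNReal.ofReal ((q x + r) / r) := by
  have hs : 0 < √(n : ℝ) := Real.sqrt_pos.2 (by exact_mod_cast hn)
  have e1 : ENNReal.ofReal (1 - r / √n) • P =
      P.withDensity fun _ => ENNReal.ofReal (1 - r / √n) := (withDensity_const _).symm
  have hm : Measurable fun x => ENNReal.ofReal ((q x + r) / r) := by fun_prop
  rw [e1, ← withDensity_smul _ hm, ← withDensity_add_left measurable_const, linearLaw]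
  congr 1
  ext x
  simp only [Pi.add_apply, Pi.smul_apply, smul_eq_mul]
  rw [← ENNReal.ofReal_mul (by positivity), ← ENNReal.ofReal_add]
  · congr 1
    field_simp
    ring
  · rw [div_eq_mul_inv]; linarith
  · have := hqr x
    exact mul_nonneg (by positivity) (div_nonneg (by linarith) hr.le)

/-- The constant sequence `P` has tangent `0`, and the linear law contaminates it at rate `r/√n` by
the law with density `(q + r)/r`. -/
theorem hasTangent_linearLaw {P : Measure Ω} [IsProbabilityMeasure P] {q : Ω → ℝ} {r : ℝ}
    (hq : Measurable q) (hqL : MemLp q 2 P) (hr : 0 < r) (hqr : ∀ x, -r ≤ q x) :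
    HasTangent P (linearLaw P q) q := by
  have h := HasTangent.mixture (P := P) (Q := fun _ => P) (.of_forall fun _ => inferInstance)
    measurable_const (memLp_const 0) (HasTangent.const P) (hq.add_const r)
    (fun x => by linarith [hqr x]) (hqL.add (memLp_const r)) hr
  simp only [zero_add, add_sub_cancel_right] at h
  refine h.congr_eventually ?_
  filter_upwards [eventually_gt_atTop 0,
    eventually_mul_inv_sqrt_le r (by norm_num : (0 : ℝ) < 1 / 2)] with n hn hrn
  exact (linearLaw_eq_mixture hq hr hqr hn hrn).symm

/-- Standing assumptions on the null tangent `q` and the bounded score `b`. -/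
structure TiltData (P : Measure Ω) (q b : Ω → ℝ) (r C σ : ℝ) : Prop where
  hq : Measurable q
  hqL : MemLp q 2 P
  hq0 : ∫ x, q x ∂P = 0
  hr : 0 < r
  hqr : ∀ x, -r ≤ q x
  hb : Measurable b
  hbC : ∀ x, |b x| ≤ C
  hb0 : ∫ x, b x ∂P = 0
  hσ : 0 < σ
  hσ2 : ∫ x, b x ^ 2 ∂P = σ ^ 2

namespace TiltData

variable {P : Measure Ω} [IsProbabilityMeasure P] {q b : Ω → ℝ} {r C σ : ℝ}


theorem qi (D : TiltData P q b r C σ) : Integrable q P := D.hqL.integrable one_le_two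

theorem bL (D : TiltData P q b r C σ) : MemLp b 2 P :=
  MemLp.of_bound D.hb.aestronglyMeasurable C (ae_of_all _ D.hbC)

theorem tangent (D : TiltData P q b r C σ) : HasTangent P (linearLaw P q) q :=
  hasTangent_linearLaw D.hq D.hqL D.hr D.hqr

theorem prob (D : TiltData P q b r C σ) : ∀ᶠ n in atTop, IsProbabilityMeasure (linearLaw P q n) :=
  eventually_isProbabilityMeasure_linearLaw D.qi D.hq0 D.hqr

/-- The expansion behind the normal limit, read at the real point `z = 1` instead of the imaginary
axis. -/
theorem tendsto_natMul_tiltMass (D : TiltData P q b r C σ) :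
    Tendsto (fun n : ℕ => n * (tiltMass P q b n - 1)) atTop
      (𝓝 (∫ x, b x * q x ∂P + σ ^ 2 / 2)) := by
  have h := D.tangent.tendsto_natMul_integral_cexp D.prob D.hq D.hqL D.hb D.hbC D.hb0 1
  have h2 := (Complex.continuous_re.tendsto _).comp h
  rw [D.hσ2] at h2
  convert! h2 using 1
  · ext n
    have : ∫ x, Complex.exp (1 * ((√(n : ℝ))⁻¹ * b x : ℝ)) ∂(linearLaw P q n) =
        (tiltMass P q b n : ℂ) := by
      rw [tiltMass, ← integral_complex_ofReal]
      congr 1; ext x; rw [one_mul, Complex.ofReal_exp]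
    simp only [Function.comp]
    rw [this]
    norm_cast
  · congr 1
    norm_cast
    simp [div_eq_inv_mul, -Complex.ofReal_pow]

theorem tendsto_tiltMass_pow (D : TiltData P q b r C σ) :
    Tendsto (fun n : ℕ => tiltMass P q b n ^ n) atTop
      (𝓝 (Real.exp (∫ x, b x * q x ∂P + σ ^ 2 / 2))) := by
  refine (Real.tendsto_one_add_pow_exp_of_tendsto D.tendsto_natMul_tiltMass).congr fun n => ?_
  ring

/-- The normalization is `1 + O(1/n)` because `b` is centered; at the scale `1/√n` of tangents it is
invisible. -/
theorem tendsto_sqrt_mul_tiltMass (D : TiltData P q b r C σ) :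
    Tendsto (fun n : ℕ => √n * (tiltMass P q b n - 1)) atTop (𝓝 0) := by
  have h := D.tendsto_natMul_tiltMass.mul tendsto_inv_sqrt_natCast
  rw [mul_zero] at h
  refine h.congr' ?_
  filter_upwards [eventually_gt_atTop 0] with n hn
  have hn : (0 : ℝ) < n := by exact_mod_cast hn
  have hs : 0 < √(n : ℝ) := Real.sqrt_pos.2 hn
  have hss : √(n : ℝ) * √n = n := Real.mul_self_sqrt hn.le
  nth_rewrite 1 [← hss]
  field_simp

theorem tendsto_tiltMass (D : TiltData P q b r C σ) :
    Tendsto (tiltMass P q b) atTop (𝓝 1) := by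
  have h := (D.tendsto_sqrt_mul_tiltMass.mul tendsto_inv_sqrt_natCast).const_add 1
  rw [mul_zero, add_zero] at h
  refine h.congr' ?_
  filter_upwards [eventually_gt_atTop 0] with n hn
  have hs : 0 < √(n : ℝ) := Real.sqrt_pos.2 (by exact_mod_cast hn)
  field_simp
  ring

theorem eventually_tiltMass_pos (D : TiltData P q b r C σ) : ∀ᶠ n in atTop, 0 < tiltMass P q b n :=
  D.tendsto_tiltMass.eventually (lt_mem_nhds zero_lt_one)

theorem prob_tilt (D : TiltData P q b r C σ) :
    ∀ᶠ n in atTop, IsProbabilityMeasure (tiltLaw P q b n) := by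
  filter_upwards [D.prob, D.eventually_tiltMass_pos] with n _ hZ
  refine isProbabilityMeasure_withDensity_ofReal (fun x => by positivity) ?_ ?_
  · refine Integrable.div_const (Integrable.of_bound (C := Real.exp ((√(n : ℝ))⁻¹ * C))
      (by have := D.hb; fun_prop) (ae_of_all _ fun x => ?_)) _
    rw [Real.norm_eq_abs, Real.abs_exp]
    exact Real.exp_le_exp.2 (mul_le_mul_of_nonneg_left ((le_abs_self _).trans (D.hbC x))
      (inv_nonneg.2 (Real.sqrt_nonneg _)))
  · rw [integral_div]
    exact div_self hZ.ne'

/-- The root of `(1 + s q) e^{s b}` has derivative `(q + b)/2` at `s = 0`, and the normalizing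
constant is negligible at this scale. Hence the tilt represents the alternative `q + b` while
keeping an exact exponential likelihood ratio. -/
theorem tangent_tilt (D : TiltData P q b r C σ) :
    HasTangent P (tiltLaw P q b) (fun x => q x + b x) := by
  have hbm := D.hb
  have hqm := D.hq
  have hC0 : 0 ≤ C := by
    obtain ⟨x⟩ : Nonempty Ω := nonempty_of_isProbabilityMeasure P
    exact (abs_nonneg _).trans (D.hbC x)
  set Z := tiltMass P q b
  set v : ℕ → Ω → ℝ := fun n x =>
    (1 + (√(n : ℝ))⁻¹ * q x) * Real.exp ((√(n : ℝ))⁻¹ * b x) / Z n with hv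
  have hpos : ∀ᶠ n : ℕ in atTop, ∀ x, 1 / 2 ≤ 1 + (√(n : ℝ))⁻¹ * q x := by
    filter_upwards [eventually_mul_inv_sqrt_le r (by norm_num : (0 : ℝ) < 1 / 2)] with n hn x
    exact linearLaw_density_ge D.hqr (inv_nonneg.2 (Real.sqrt_nonneg n)) hn x
  have hvm : ∀ n, Measurable (v n) := fun n => by fun_prop
  have hζ1 : Tendsto (fun n => (√(Z n))⁻¹) atTop (𝓝 1) := by
    have := (D.tendsto_tiltMass.sqrt).inv₀ (by simp)
    simpa using this
  have hζ : Tendsto (fun n : ℕ => √n * ((√(Z n))⁻¹ - 1)) atTop (𝓝 0) := by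
    have h1 : Tendsto (fun n => (√(Z n) * (1 + √(Z n)))⁻¹) atTop (𝓝 (1 * (1 + 1))⁻¹) := by
      have := D.tendsto_tiltMass.sqrt
      rw [Real.sqrt_one] at this
      exact (this.mul (this.const_add 1)).inv₀ (by norm_num)
    have h2 := (D.tendsto_sqrt_mul_tiltMass.neg).mul h1
    rw [neg_zero, zero_mul] at h2
    refine h2.congr' ?_
    filter_upwards [D.eventually_tiltMass_pos] with n hn
    have hz : 0 < √(Z n) := Real.sqrt_pos.2 hn
    have : tiltMass P q b n = √(Z n) ^ 2 := (Real.sq_sqrt hn.le).symm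
    rw [this]
    field_simp
    ring
  refine HasTangent.of_density (v := v) hvm ?_ ?_ ?_
  · filter_upwards [hpos, D.eventually_tiltMass_pos] with n hn hZ x
    exact div_nonneg (mul_nonneg (by linarith [hn x]) (Real.exp_pos _).le) hZ.le
  · filter_upwards [hpos, D.eventually_tiltMass_pos] with n hn hZ
    rw [tiltLaw, linearLaw, ← withDensity_mul _ (by fun_prop) (by fun_prop)]
    congr 1
    ext x
    rw [Pi.mul_apply, ← ENNReal.ofReal_mul (by linarith [hn x])]
    congr 1
    rw [hv]
    ring
  -- The three summands of `B` bound, after scaling by `√n`: the unnormalized root minus one (with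
  -- `1/√Z ≤ 2`), the normalization error, and the linear term.
  · refine tendsto_natMul_lintegral_sq
      (F := fun (n : ℕ) x => √(v n x) - (1 + (q x + b x) / √n / 2))
      (B := fun x => (2 * (3 * |q x| + 2 * C) + 1 + (|q x| + C)))
      (fun n => by fun_prop) ?_ ?_ fun x => ?_
    · exact ((((D.hqL.norm.const_mul 3).add (memLp_const _)).const_mul 2).add (memLp_const _)).add
        (D.hqL.norm.add (memLp_const _))
    · have hsm := eventually_mul_inv_sqrt_le C zero_lt_one
      have hζ2 := hζ1.eventually (ge_mem_nhds one_lt_two)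
      have hζ3 := (hζ.abs).eventually (ge_mem_nhds (by norm_num : |(0 : ℝ)| < 1))
      filter_upwards [hpos, D.eventually_tiltMass_pos, hsm, hζ2, hζ3, eventually_gt_atTop 0]
        with n hp hZ hC hz2 hz3 hn x
      have hs : 0 < √(n : ℝ) := Real.sqrt_pos.2 (by exact_mod_cast hn)
      set s := √(n : ℝ) with hsdef
      have hsi : 0 < s⁻¹ := inv_pos.2 hs
      set w := (1 + s⁻¹ * q x) * Real.exp (s⁻¹ * b x) with hw
      have hw0 : 0 ≤ w := mul_nonneg (by linarith [hp x]) (Real.exp_pos _).le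
      have hvx : √(v n x) = √w * (√(Z n))⁻¹ := by
        rw [hv]; simp only []
        rw [Real.sqrt_div hw0, div_eq_mul_inv]
      have hb1 : |s⁻¹ * b x| ≤ s⁻¹ * C := by
        rw [abs_mul, abs_of_pos hsi]; exact mul_le_mul_of_nonneg_left (D.hbC x) hsi.le
      have hb2 : |s⁻¹ * b x| ≤ 1 := hb1.trans (by rw [mul_comm]; exact hC)
      have he1 : |Real.exp (s⁻¹ * b x) - 1| ≤ 2 * (s⁻¹ * C) :=
        (Real.abs_exp_sub_one_le hb2).trans (by linarith)
      have he2 : Real.exp (s⁻¹ * b x) ≤ 3 := by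
        have := (abs_le.1 (Real.abs_exp_sub_one_le hb2)).2
        linarith
      have hw1 : |√w - 1| ≤ s⁻¹ * (3 * |q x| + 2 * C) := by
        have h1 : |√w - 1| ≤ |w - 1| := by
          have h2 : w - 1 = (√w - 1) * (√w + 1) := by
            have := Real.sq_sqrt hw0; nlinarith
          rw [h2, abs_mul]
          refine le_mul_of_one_le_right (abs_nonneg _) ?_
          rw [abs_of_nonneg (by positivity)]
          linarith [Real.sqrt_nonneg w]
        refine h1.trans ?_
        have h3 : w - 1 = s⁻¹ * q x * Real.exp (s⁻¹ * b x) + (Real.exp (s⁻¹ * b x) - 1) := by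
          rw [hw]; ring
        rw [h3]
        refine (abs_add_le _ _).trans ?_
        rw [abs_mul, abs_mul, abs_of_pos hsi, Real.abs_exp]
        have := mul_le_mul_of_nonneg_left he2 (mul_nonneg hsi.le (abs_nonneg (q x)))
        linarith
      have hF : √(v n x) - (1 + (q x + b x) / s / 2) =
          (√w - 1) * (√(Z n))⁻¹ + ((√(Z n))⁻¹ - 1) - s⁻¹ * ((q x + b x) / 2) := by
        rw [hvx]; field_simp; ring
      rw [hF]
      have hzz : 0 ≤ (√(Z n))⁻¹ := by positivity
      have t1 : s * |(√w - 1) * (√(Z n))⁻¹| ≤ 2 * (3 * |q x| + 2 * C) := by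
        rw [abs_mul, abs_of_nonneg hzz]
        calc s * (|√w - 1| * (√(Z n))⁻¹) ≤ s * (s⁻¹ * (3 * |q x| + 2 * C) * 2) := by gcongr
          _ = _ := by field_simp
      have t2 : s * |(√(Z n))⁻¹ - 1| ≤ 1 := by
        rwa [abs_mul, abs_of_pos hs] at hz3
      have t3 : s * |s⁻¹ * ((q x + b x) / 2)| ≤ |q x| + C := by
        rw [abs_mul, abs_of_pos hsi, ← mul_assoc, mul_inv_cancel₀ hs.ne', one_mul, abs_div,
          abs_of_pos (by norm_num : (0 : ℝ) < 2)]
        have := abs_add_le (q x) (b x)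
        have := D.hbC x
        have := abs_nonneg (q x + b x)
        linarith
      calc s * _ ≤ s * (|(√w - 1) * (√(Z n))⁻¹| + |(√(Z n))⁻¹ - 1| +
            |s⁻¹ * ((q x + b x) / 2)|) := by
            refine mul_le_mul_of_nonneg_left ?_ hs.le
            exact (abs_sub _ _).trans (add_le_add (abs_add_le _ _) le_rfl)
        _ ≤ _ := by rw [mul_add, mul_add]; linarith
    · have hd : HasDerivAt (fun s : ℝ => √((1 + s * q x) * Real.exp (s * b x)))
          ((q x + b x) / 2) 0 := by
        have h1 : HasDerivAt (fun s : ℝ => (1 + s * q x) * Real.exp (s * b x)) (q x + b x) 0 := by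
          have := (((hasDerivAt_id (0 : ℝ)).mul_const (q x)).const_add 1).mul
            (((hasDerivAt_id (0 : ℝ)).mul_const (b x)).exp)
          convert! this using 1
          simp
        have := h1.sqrt (by simp)
        convert! this using 1
        simp
      have h1 := tendsto_sqrt_mul_remainder hd
      have h2 : Tendsto (fun n : ℕ => √((1 + (√(n : ℝ))⁻¹ * q x) *
          Real.exp ((√(n : ℝ))⁻¹ * b x))) atTop (𝓝 1) := by
        have := hd.continuousAt.tendsto.comp tendsto_inv_sqrt_natCast
        simpa [Function.comp_def] using this
      have h3 := h1.add (h2.mul hζ)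
      rw [mul_zero, add_zero] at h3
      refine h3.congr' ?_
      filter_upwards [hpos, eventually_gt_atTop 0] with n hp hn
      have hs : 0 < √(n : ℝ) := Real.sqrt_pos.2 (by exact_mod_cast hn)
      rw [hv]
      simp only []
      rw [Real.sqrt_div (mul_nonneg (by linarith [hp x]) (Real.exp_pos _).le)]
      simp only [zero_mul, add_zero, Real.exp_zero, mul_one, Real.sqrt_one]
      field_simp
      ring

end TiltData

/-! ### Neyman-Pearson tests in the limit -/

/-- The test `1(sₙ ∑ b(xᵢ) > t)`. -/
noncomputable def thresholdTest (b : Ω → ℝ) (t : ℝ) (n : ℕ) (x : Fin n → Ω) : ℝ :=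
  {x : Fin n → Ω | t < scaledSum b x}.indicator 1 x

theorem measurableSet_lt_scaledSum {b : Ω → ℝ} (hb : Measurable b) (t : ℝ) (n : ℕ) :
    MeasurableSet {x : Fin n → Ω | t < scaledSum b x} :=
  measurableSet_lt measurable_const (measurable_scaledSum hb n)

theorem measurable_thresholdTest {b : Ω → ℝ} (hb : Measurable b) (t : ℝ) (n : ℕ) :
    Measurable (thresholdTest b t n) :=
  measurable_one.indicator (measurableSet_lt_scaledSum hb t n)

theorem thresholdTest_mem {X : Type*} (b : X → ℝ) (t : ℝ) (n : ℕ) (x : Fin n → X) :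
    thresholdTest b t n x ∈ Set.Icc (0 : ℝ) 1 := by
  unfold thresholdTest Set.indicator
  split_ifs <;> simp

theorem thresholdTest_of_lt {X : Type*} {b : X → ℝ} {t : ℝ} {n : ℕ} {x : Fin n → X}
    (h : t < scaledSum b x) : thresholdTest b t n x = 1 := by
  rw [thresholdTest, Set.indicator_of_mem (by exact h)]; rfl

theorem thresholdTest_of_le {X : Type*} {b : X → ℝ} {t : ℝ} {n : ℕ} {x : Fin n → X}
    (h : scaledSum b x ≤ t) : thresholdTest b t n x = 0 := by
  rw [thresholdTest, Set.indicator_of_notMem (by exact not_lt.2 h)]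

theorem isTest_thresholdTest {b : Ω → ℝ} (hb : Measurable b) (t : ℝ) :
    IsTest (thresholdTest b t) :=
  fun n => ⟨measurable_thresholdTest hb t n, thresholdTest_mem b t n⟩

theorem power_thresholdTest {b : Ω → ℝ} (hb : Measurable b) (t : ℝ) (n : ℕ) (Q : Measure Ω) :
    power (thresholdTest b t n) Q =
      (Measure.pi fun _ : Fin n => Q).real {x | t < scaledSum b x} := by
  rw [power]
  exact integral_indicator_one (measurableSet_lt_scaledSum hb t n)

theorem integrable_test {n : ℕ} {ψ : (Fin n → Ω) → ℝ} (hψ : Measurable ψ)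
    (h01 : ∀ x, ψ x ∈ Set.Icc (0 : ℝ) 1) (μ : Measure (Fin n → Ω)) [IsFiniteMeasure μ] :
    Integrable ψ μ :=
  Integrable.of_bound hψ.aestronglyMeasurable 1 (ae_of_all _ fun x => by
    rw [Real.norm_eq_abs, abs_le]; exact ⟨by linarith [(h01 x).1], (h01 x).2⟩)

theorem power_nonneg {n : ℕ} {ψ : (Fin n → Ω) → ℝ}
    (h01 : ∀ x, ψ x ∈ Set.Icc (0 : ℝ) 1) (Q : Measure Ω) : 0 ≤ power ψ Q :=
  integral_nonneg fun x => (h01 x).1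

theorem power_le_one {n : ℕ} {ψ : (Fin n → Ω) → ℝ} (hψ : Measurable ψ)
    (h01 : ∀ x, ψ x ∈ Set.Icc (0 : ℝ) 1) (Q : Measure Ω) [IsProbabilityMeasure Q] :
    power ψ Q ≤ 1 := by
  have := integral_mono (integrable_test hψ h01 (Measure.pi fun _ : Fin n => Q))
    (integrable_const (1 : ℝ)) fun x => (h01 x).2
  simpa [power] using this

section Tilt

variable {W : Measure Ω} [IsProbabilityMeasure W] {b : Ω → ℝ} {Z : ℝ} {n : ℕ}

/-- For the tilt the logarithm of the likelihood ratio of the whole sample is exactly the normalized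
sum minus a constant, so threshold tests are Neyman-Pearson tests at each finite `n`. -/
theorem pi_tilt (hb : Measurable b) (hZ : 0 < Z)
    [IsProbabilityMeasure (W.withDensity fun x =>
      ENNReal.ofReal (Real.exp ((√(n : ℝ))⁻¹ * b x) / Z))] :
    Measure.pi (fun _ : Fin n => W.withDensity fun x =>
      ENNReal.ofReal (Real.exp ((√(n : ℝ))⁻¹ * b x) / Z)) =
    (Measure.pi fun _ : Fin n => W).withDensity fun x =>
      ENNReal.ofReal (Real.exp (scaledSum b x) / Z ^ n) := by
  rw [pi_withDensity_ofReal n W (by fun_prop) fun x => by positivity]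
  congr 1
  ext x
  rw [Finset.prod_div_distrib, ← Real.exp_sum, ← Finset.mul_sum]
  simp [scaledSum]

/-- The Lagrangian gap between the Neyman-Pearson test and any other test. -/
theorem neymanPearson_gap (hb : Measurable b) {C : ℝ} (hbC : ∀ x, |b x| ≤ C) (hZ : 0 < Z)
    [IsProbabilityMeasure (W.withDensity fun x =>
      ENNReal.ofReal (Real.exp ((√(n : ℝ))⁻¹ * b x) / Z))]
    {ψ : (Fin n → Ω) → ℝ} (hψ : Measurable ψ) (h01 : ∀ x, ψ x ∈ Set.Icc (0 : ℝ) 1) (t : ℝ) :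
    Integrable (fun x => |ψ x - thresholdTest b t n x| * |Real.exp (scaledSum b x) - Real.exp t|)
      (Measure.pi fun _ : Fin n => W) ∧
    (power (thresholdTest b t n) (W.withDensity fun x =>
        ENNReal.ofReal (Real.exp ((√(n : ℝ))⁻¹ * b x) / Z)) -
      Real.exp t / Z ^ n * power (thresholdTest b t n) W) -
    (power ψ (W.withDensity fun x => ENNReal.ofReal (Real.exp ((√(n : ℝ))⁻¹ * b x) / Z)) -
      Real.exp t / Z ^ n * power ψ W) =
    (∫ x, |ψ x - thresholdTest b t n x| * |Real.exp (scaledSum b x) - Real.exp t|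
      ∂(Measure.pi fun _ : Fin n => W)) / Z ^ n := by
  set μ := Measure.pi fun _ : Fin n => W
  have hTm := measurable_scaledSum hb n
  have hTb : ∀ x : Fin n → Ω, Real.exp (scaledSum b x) ≤ Real.exp ((√(n : ℝ))⁻¹ * (n * C)) := by
    intro x
    refine Real.exp_le_exp.2 (mul_le_mul_of_nonneg_left ?_ (inv_nonneg.2 (Real.sqrt_nonneg _)))
    calc ∑ i, b (x i) ≤ ∑ _i : Fin n, C := Finset.sum_le_sum fun i _ =>
          (le_abs_self _).trans (hbC _)
      _ = n * C := by simp
  have hei : Integrable (fun x : Fin n → Ω => Real.exp (scaledSum b x)) μ :=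
    Integrable.of_bound hTm.exp.aestronglyMeasurable _ (ae_of_all _ fun x => by
      rw [Real.norm_eq_abs, Real.abs_exp]; exact hTb x)
  have hδm := measurable_thresholdTest hb t n
  have hδ01 := thresholdTest_mem b t n
  have hpow : ∀ φ : (Fin n → Ω) → ℝ, power φ (W.withDensity fun x =>
      ENNReal.ofReal (Real.exp ((√(n : ℝ))⁻¹ * b x) / Z)) =
      ∫ x, Real.exp (scaledSum b x) / Z ^ n * φ x ∂μ := fun φ => by
    rw [power, pi_tilt hb hZ]
    exact integral_withDensity_ofReal μ (hTm.exp.div_const _) (fun x => by positivity) φ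
  have hint : ∀ φ : (Fin n → Ω) → ℝ, Measurable φ → (∀ x, φ x ∈ Set.Icc (0 : ℝ) 1) →
      Integrable (fun x => Real.exp (scaledSum b x) / Z ^ n * φ x) μ := fun φ hφ hφ01 =>
    (hei.div_const _).mul_bdd hφ.aestronglyMeasurable (c := 1) (ae_of_all _ fun x => by
      rw [Real.norm_eq_abs, abs_le]; exact ⟨by linarith [(hφ01 x).1], (hφ01 x).2⟩)
  have hlag : ∀ φ : (Fin n → Ω) → ℝ, Measurable φ → (∀ x, φ x ∈ Set.Icc (0 : ℝ) 1) →
      power φ (W.withDensity fun x => ENNReal.ofReal (Real.exp ((√(n : ℝ))⁻¹ * b x) / Z)) -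
        Real.exp t / Z ^ n * power φ W =
      ∫ x, φ x * (Real.exp (scaledSum b x) - Real.exp t) / Z ^ n ∂μ := fun φ hφ hφ01 => by
    rw [hpow, power, ← integral_const_mul, ← integral_sub (hint φ hφ hφ01)
      ((integrable_test hφ hφ01 μ).const_mul _)]
    congr 1; ext x; ring
  have hlint : ∀ φ : (Fin n → Ω) → ℝ, Measurable φ → (∀ x, φ x ∈ Set.Icc (0 : ℝ) 1) →
      Integrable (fun x => φ x * (Real.exp (scaledSum b x) - Real.exp t) / Z ^ n) μ :=
    fun φ hφ hφ01 => ((hint φ hφ hφ01).sub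
      ((integrable_test hφ hφ01 μ).const_mul (Real.exp t / Z ^ n))).congr
      (ae_of_all _ fun x => by simp only [Pi.sub_apply]; ring)
  -- The threshold test is `1` where the bracket is positive and `0` where it is not, so any
  -- deviation of `ψ` has the losing sign.
  have hpt : ∀ x, thresholdTest b t n x * (Real.exp (scaledSum b x) - Real.exp t) / Z ^ n -
      ψ x * (Real.exp (scaledSum b x) - Real.exp t) / Z ^ n =
      |ψ x - thresholdTest b t n x| * |Real.exp (scaledSum b x) - Real.exp t| / Z ^ n := by
    intro x
    rw [← sub_div, ← sub_mul]
    congr 1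
    have h1 := h01 x
    by_cases hx : t < scaledSum b x
    · rw [thresholdTest_of_lt hx, abs_of_nonpos (by linarith [h1.2]),
        abs_of_nonneg (by linarith [Real.exp_lt_exp.2 hx])]
      ring
    · rw [thresholdTest_of_le (not_lt.1 hx), abs_of_nonneg (by linarith [h1.1]),
        abs_of_nonpos (by linarith [Real.exp_le_exp.2 (not_lt.1 hx)])]
      ring
  have hgi : Integrable (fun x => |ψ x - thresholdTest b t n x| *
      |Real.exp (scaledSum b x) - Real.exp t| / Z ^ n) μ :=
    ((hlint _ hδm hδ01).sub (hlint _ hψ h01)).congr (ae_of_all _ hpt)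
  refine ⟨?_, ?_⟩
  · have := hgi.mul_const (Z ^ n)
    refine this.congr (ae_of_all _ fun x => ?_)
    simp only []
    field_simp
  · rw [hlag _ hδm hδ01, hlag _ hψ h01, ← integral_sub (hlint _ hδm hδ01) (hlint _ hψ h01),
      integral_congr_ae (ae_of_all _ hpt), integral_div]

/-- A test with small Lagrangian gap is close to the Neyman-Pearson test. -/
theorem measureReal_abs_sub_thresholdTest_le (hb : Measurable b) {ψ : (Fin n → Ω) → ℝ} {t : ℝ}
    (hi : Integrable (fun x => |ψ x - thresholdTest b t n x| *
      |Real.exp (scaledSum b x) - Real.exp t|) (Measure.pi fun _ : Fin n => W))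
    {η ζ : ℝ} (hη : 0 < η) (hζ : 0 < ζ) :
    (Measure.pi fun _ : Fin n => W).real {x | η ≤ |ψ x - thresholdTest b t n x|} ≤
      ((Measure.pi fun _ : Fin n => W).real {x | t - 2 * ζ < scaledSum b x} -
        (Measure.pi fun _ : Fin n => W).real {x | t + ζ < scaledSum b x}) +
      (∫ x, |ψ x - thresholdTest b t n x| * |Real.exp (scaledSum b x) - Real.exp t|
        ∂(Measure.pi fun _ : Fin n => W)) / (η * (Real.exp t * (1 - Real.exp (-ζ)))) := by
  set μ := Measure.pi fun _ : Fin n => W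
  set κ := Real.exp t * (1 - Real.exp (-ζ)) with hκ
  have hκ0 : 0 < κ := mul_pos (Real.exp_pos _) (by
    have : Real.exp (-ζ) < 1 := Real.exp_zero ▸ Real.exp_lt_exp.2 (by linarith)
    linarith)
  set f := fun x => |ψ x - thresholdTest b t n x| * |Real.exp (scaledSum b x) - Real.exp t|
  have hsub : {x : Fin n → Ω | t + ζ < scaledSum b x} ⊆ {x | t - 2 * ζ < scaledSum b x} :=
    fun x (hx : t + ζ < scaledSum b x) => show t - 2 * ζ < scaledSum b x by linarith
  -- Outside the strip around `t` the weight `|e^T - e^t|` is at least `κ`, the gap at distance `ζ`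
  -- below `t`, which is the smaller of the two one-sided gaps. There Markov's inequality applies.
  have hcover : {x | η ≤ |ψ x - thresholdTest b t n x|} ⊆
      ({x : Fin n → Ω | t - 2 * ζ < scaledSum b x} \ {x | t + ζ < scaledSum b x}) ∪
        {x | η * κ ≤ f x} := by
    intro x hx
    by_cases h1 : t - 2 * ζ < scaledSum b x
    · by_cases h2 : t + ζ < scaledSum b x
      · right
        have h3 : κ ≤ |Real.exp (scaledSum b x) - Real.exp t| := by
          refine le_trans ?_ (le_abs_self _)
          have h4 : Real.exp t * Real.exp ζ ≤ Real.exp (scaledSum b x) := by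
            rw [← Real.exp_add]; exact Real.exp_le_exp.2 h2.le
          have h5 : 1 - Real.exp (-ζ) ≤ Real.exp ζ - 1 := by
            have := Real.add_one_le_exp ζ
            have := Real.add_one_le_exp (-ζ)
            linarith
          have := mul_le_mul_of_nonneg_left h5 (Real.exp_pos t).le
          rw [hκ]; linarith
        exact mul_le_mul hx h3 hκ0.le (abs_nonneg _)
      · exact Or.inl ⟨h1, h2⟩
    · right
      have h3 : κ ≤ |Real.exp (scaledSum b x) - Real.exp t| := by
        rw [abs_sub_comm]
        refine le_trans ?_ (le_abs_self _)
        have h4 : Real.exp (scaledSum b x) ≤ Real.exp t * Real.exp (-ζ) := by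
          rw [← Real.exp_add]; exact Real.exp_le_exp.2 (by linarith [not_lt.1 h1])
        rw [hκ]; linarith
      exact mul_le_mul hx h3 hκ0.le (abs_nonneg _)
  refine (measureReal_mono hcover).trans ((measureReal_union_le _ _).trans (add_le_add ?_ ?_))
  · rw [measureReal_sdiff hsub (measurableSet_lt_scaledSum hb _ n)]
  · rw [le_div_iff₀ (mul_pos hη hκ0), mul_comm]
    exact mul_meas_ge_le_integral_of_nonneg
      (ae_of_all _ fun x => mul_nonneg (abs_nonneg _) (abs_nonneg _)) hi _

end Tilt

/-- The product of `P` is dominated by the product of a nearby law up to a small error. -/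
theorem measureReal_pi_le_linearLaw {P : Measure Ω} [IsProbabilityMeasure P] {q : Ω → ℝ} {r : ℝ}
    (hq : Measurable q) (hqL : MemLp q 2 P) (hq0 : ∫ x, q x ∂P = 0) (hqr : ∀ x, -r ≤ q x) {n : ℕ}
    (hn : 0 < n) (hrn : r * (√(n : ℝ))⁻¹ ≤ 1 / 2) [IsProbabilityMeasure (linearLaw P q n)]
    {A : Set (Fin n → Ω)} (hA : MeasurableSet A) {R : ℝ} (hR : 0 < R) :
    (Measure.pi fun _ : Fin n => P).real A ≤
      R * (Measure.pi fun _ : Fin n => linearLaw P q n).real A +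
        Real.exp (2 * ∫ x, q x ^ 2 ∂P) / R := by
  set s := (√(n : ℝ))⁻¹ with hs
  have hnr : (0 : ℝ) < n := by exact_mod_cast hn
  have hs0 : 0 ≤ s := inv_nonneg.2 (Real.sqrt_nonneg _)
  have hs2 : s ^ 2 = (n : ℝ)⁻¹ := by rw [hs, inv_pow, Real.sq_sqrt hnr.le]
  have hw : ∀ x, 1 / 2 ≤ 1 + s * q x := linearLaw_density_ge hqr hs0 hrn
  have hqi : Integrable q P := hqL.integrable one_le_two
  have hq2 := hqL.integrable_sq
  set μ := Measure.pi fun _ : Fin n => P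
  set G : (Fin n → Ω) → ℝ := fun x => ∏ i, (1 + s * q (x i)) with hG
  have hwm : Measurable fun x => 1 + s * q x := by fun_prop
  have hGm : Measurable G :=
    Finset.measurable_fun_prod _ fun i _ => hwm.comp (measurable_pi_apply i)
  have hG0 : ∀ x, 0 < G x := fun x => Finset.prod_pos fun i _ => by linarith [hw (x i)]
  have hpi : Measure.pi (fun _ : Fin n => linearLaw P q n) =
      μ.withDensity fun x => ENNReal.ofReal (G x) := by
    have : SigmaFinite (P.withDensity fun x => ENNReal.ofReal (1 + s * q x)) :=
      inferInstanceAs (SigmaFinite (linearLaw P q n))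
    exact pi_withDensity_ofReal n P hwm fun x => by linarith [hw x]
  have hwi : Integrable (fun x => (1 + s * q x)⁻¹) P :=
    Integrable.of_bound hwm.inv.aestronglyMeasurable 2 (ae_of_all _ fun x => by
      have := hw x
      rw [Real.norm_eq_abs, abs_of_pos (inv_pos.2 (by linarith)), inv_le_comm₀ (by linarith)
        (by norm_num)]
      linarith)
  have hGi : Integrable (fun x => (G x)⁻¹) μ := by
    simp_rw [hG, ← Finset.prod_inv_distrib]
    exact Integrable.fintype_prod (f := fun _ x => (1 + s * q x)⁻¹) fun _ => hwi
  -- The mean of the inverse likelihood ratio under the product of `P` stays bounded: each factor is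
  -- `1 + O(1/n)` since `q` is centered. This is the contiguity that is needed.
  have hGint : ∫ x, (G x)⁻¹ ∂μ ≤ Real.exp (2 * ∫ x, q x ^ 2 ∂P) := by
    have e1 : ∫ x, (G x)⁻¹ ∂μ = (∫ x, (1 + s * q x)⁻¹ ∂P) ^ n := by
      simp_rw [hG, ← Finset.prod_inv_distrib]
      rw [integral_fintype_prod_eq_pow (ι := Fin n) (μ := P) (fun x => (1 + s * q x)⁻¹),
        Fintype.card_fin]
    have e2 : ∫ x, (1 + s * q x)⁻¹ ∂P ≤ 1 + 2 * (∫ x, q x ^ 2 ∂P) / n := by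
      have i1 : Integrable (fun x => 1 - s * q x) P := (integrable_const _).sub (hqi.const_mul _)
      calc ∫ x, (1 + s * q x)⁻¹ ∂P ≤ ∫ x, (1 - s * q x + 2 * s ^ 2 * q x ^ 2) ∂P := by
            refine integral_mono hwi (i1.add (hq2.const_mul _)) fun x => ?_
            have h1 := hw x
            simp only []
            rw [inv_eq_one_div, div_le_iff₀ (by linarith)]
            -- For `v ≥ -1/2` one has `(1 - v + 2v²)(1 + v) = 1 + v²(1 + 2v) ≥ 1`.
            nlinarith [mul_nonneg (sq_nonneg (s * q x)) (by linarith : 0 ≤ 2 * (s * q x) + 1)]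
        _ = _ := by
            rw [integral_add i1 (hq2.const_mul _), integral_sub (integrable_const _)
              (hqi.const_mul _), integral_const_mul, integral_const_mul, hq0, hs2]
            simp
            ring
    have e3 : 0 ≤ ∫ x, (1 + s * q x)⁻¹ ∂P :=
      integral_nonneg fun x => inv_nonneg.2 (by linarith [hw x])
    rw [e1]
    calc _ ≤ (1 + 2 * (∫ x, q x ^ 2 ∂P) / n) ^ n := pow_le_pow_left₀ e3 e2 n
      _ ≤ (Real.exp (2 * (∫ x, q x ^ 2 ∂P) / n)) ^ n := by
          refine pow_le_pow_left₀ (e3.trans e2) ?_ n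
          rw [add_comm]; exact Real.add_one_le_exp _
      _ = _ := by rw [← Real.exp_nat_mul]; congr 1; field_simp
  have hW : (Measure.pi fun _ : Fin n => linearLaw P q n).real A =
      ∫ x, G x * A.indicator 1 x ∂μ := by
    rw [← integral_indicator_one hA, hpi]
    exact integral_withDensity_ofReal μ hGm (fun x => (hG0 x).le) _
  have hGA : Integrable (fun x => G x * A.indicator 1 x) μ := by
    have : IsProbabilityMeasure (μ.withDensity fun x => ENNReal.ofReal (G x)) := by
      rw [← hpi]; infer_instance
    exact (integrable_of_isProbabilityMeasure_withDensity hGm fun x => (hG0 x).le).mul_bdd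
      (measurable_one.indicator hA).aestronglyMeasurable (c := 1) (ae_of_all _ fun x => by
        unfold Set.indicator; split_ifs <;> simp)
  rw [← integral_indicator_one hA, hW]
  -- On `A` one of `R G` and `1/(R G)` is at least one.
  calc ∫ x, A.indicator 1 x ∂μ ≤ ∫ x, (R * (G x * A.indicator 1 x) + (G x)⁻¹ / R) ∂μ := by
        refine integral_mono ((integrable_const (1 : ℝ)).indicator hA)
          ((hGA.const_mul R).add (hGi.div_const R)) fun x => ?_
        simp only []
        have hg := hG0 x
        by_cases hx : x ∈ A
        · simp only [Set.indicator_of_mem hx, Pi.one_apply, mul_one]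
          rcases le_total 1 (R * G x) with h | h
          · have : 0 ≤ (G x)⁻¹ / R := by positivity
            linarith
          · have : 1 ≤ (G x)⁻¹ / R := by
              rw [le_div_iff₀ hR, one_mul, le_inv_comm₀ hR hg, inv_eq_one_div, le_div_iff₀ hR]
              linarith
            have : 0 ≤ R * G x := by positivity
            linarith
        · simp only [Set.indicator_of_notMem hx, mul_zero, zero_add]
          positivity
    _ = R * (∫ x, G x * A.indicator 1 x ∂μ) + (∫ x, (G x)⁻¹ ∂μ) / R := by
        rw [integral_add (hGA.const_mul R) (hGi.div_const R), integral_const_mul, integral_div]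
    _ ≤ _ := by gcongr

theorem HasTangent.tendsto_power_thresholdTest {P : Measure Ω} [IsProbabilityMeasure P]
    {Q : ℕ → Measure Ω} (hQ : ∀ᶠ n in atTop, IsProbabilityMeasure (Q n)) {g h : Ω → ℝ}
    (hg : Measurable g) (hgL : MemLp g 2 P) (hT : HasTangent P Q g)
    (hh : Measurable h) {C : ℝ} (hC : ∀ x, |h x| ≤ C) (hh0 : ∫ x, h x ∂P = 0)
    {σ : ℝ} (hσ : 0 < σ) (hσ2 : ∫ x, h x ^ 2 ∂P = σ ^ 2) (t : ℝ) :
    Tendsto (fun n : ℕ => power (thresholdTest h t n) (Q n)) atTop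
      (𝓝 (normalCdf ((∫ x, h x * g x ∂P - t) / σ))) := by
  simp_rw [power_thresholdTest hh]
  exact hT.tendsto_measure_scaledSum hQ hg hgL hh hC hh0 hσ hσ2 t

/-! ### The asymptotic Neyman-Pearson lemma with uniqueness. -/

namespace TiltData

variable {P : Measure Ω} {q b : Ω → ℝ} {r C σ : ℝ}

/-- The threshold of the asymptotic level `Φ(-u)` test. -/
noncomputable def threshold (_ : TiltData P q b r C σ) (u : ℝ) : ℝ := σ * u + ∫ x, b x * q x ∂P

/-- The limiting critical value of the likelihood ratio. -/
noncomputable def crit (_ : TiltData P q b r C σ) (u : ℝ) : ℝ := Real.exp (σ * u - σ ^ 2 / 2)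

/-- The asymptotic Neyman-Pearson test. -/
noncomputable def npTest (D : TiltData P q b r C σ) (u : ℝ) : TestSeq Ω :=
  thresholdTest b (D.threshold u)

theorem isTest_npTest (D : TiltData P q b r C σ) (u : ℝ) : IsTest (D.npTest u) :=
  isTest_thresholdTest D.hb _

variable [IsProbabilityMeasure P]

theorem qbL (D : TiltData P q b r C σ) : MemLp (fun x => q x + b x) 2 P := D.hqL.add D.bL

theorem integral_mul_add (D : TiltData P q b r C σ) :
    ∫ x, b x * (q x + b x) ∂P = ∫ x, b x * q x ∂P + σ ^ 2 := by
  simp_rw [mul_add]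
  rw [integral_add (f := fun x => b x * q x) (g := fun x => b x * b x)
    (D.bL.integrable_mul D.hqL) (D.bL.integrable_mul D.bL), ← D.hσ2]
  simp_rw [pow_two]

/-- The limit sees `g` only through its pairing with `b`. Maximal size and minimal power over sets
of tangents thereby become linear extremal problems. -/
theorem tendsto_power_npTest (D : TiltData P q b r C σ) (u : ℝ) {Q : ℕ → Measure Ω}
    (hQ : ∀ᶠ n in atTop, IsProbabilityMeasure (Q n)) {g : Ω → ℝ}
    (hg : Measurable g) (hgL : MemLp g 2 P) (hT : HasTangent P Q g) :
    Tendsto (fun n => power (D.npTest u n) (Q n)) atTop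
      (𝓝 (normalCdf (-u + (∫ x, b x * g x ∂P - ∫ x, b x * q x ∂P) / σ))) := by
  have := hT.tendsto_power_thresholdTest hQ hg hgL D.hb D.hbC D.hb0 D.hσ D.hσ2 (D.threshold u)
  convert! this using 3
  have := D.hσ.ne'
  rw [threshold]
  field_simp
  ring

theorem tendsto_power_npTest_null (D : TiltData P q b r C σ) (u : ℝ) {Q : ℕ → Measure Ω}
    (hQ : ∀ᶠ n in atTop, IsProbabilityMeasure (Q n)) (hT : HasTangent P Q q) :
    Tendsto (fun n => power (D.npTest u n) (Q n)) atTop (𝓝 (normalCdf (-u))) := by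
  simpa using D.tendsto_power_npTest u hQ D.hq D.hqL hT

theorem tendsto_power_npTest_alt (D : TiltData P q b r C σ) (u : ℝ) {Q : ℕ → Measure Ω}
    (hQ : ∀ᶠ n in atTop, IsProbabilityMeasure (Q n))
    (hT : HasTangent P Q (fun x => q x + b x)) :
    Tendsto (fun n => power (D.npTest u n) (Q n)) atTop (𝓝 (normalCdf (-u + σ))) := by
  have := D.tendsto_power_npTest u hQ (g := fun x => q x + b x) (D.hq.add D.hb) D.qbL hT
  rw [D.integral_mul_add, add_sub_cancel_left, pow_two, mul_div_assoc, div_self D.hσ.ne',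
    mul_one] at this
  exact this

/-- The pairing of `b` with `q` enters the threshold and the normalization alike and cancels, so the
limiting critical value depends on `σ` and `u` alone. -/
theorem tendsto_crit (D : TiltData P q b r C σ) (u : ℝ) :
    Tendsto (fun n => Real.exp (D.threshold u) / tiltMass P q b n ^ n) atTop (𝓝 (D.crit u)) := by
  have := (tendsto_const_nhds (x := Real.exp (D.threshold u))).div D.tendsto_tiltMass_pow
    (Real.exp_pos _).ne'
  rw [← Real.exp_sub] at this
  have e : D.crit u = Real.exp (D.threshold u - (∫ x, b x * q x ∂P + σ ^ 2 / 2)) := by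
    unfold crit threshold; congr 1; ring
  rw [e]
  exact this

theorem tendsto_lagrangian_npTest (D : TiltData P q b r C σ) (u : ℝ) :
    Tendsto (fun n => power (D.npTest u n) (tiltLaw P q b n) -
      Real.exp (D.threshold u) / tiltMass P q b n ^ n * power (D.npTest u n) (linearLaw P q n))
      atTop (𝓝 (normalCdf (-u + σ) - D.crit u * normalCdf (-u))) :=
  (D.tendsto_power_npTest_alt u D.prob_tilt D.tangent_tilt).sub
    ((D.tendsto_crit u).mul (D.tendsto_power_npTest_null u D.prob D.tangent))

variable {Q₀ Q₁ : ℕ → Measure Ω}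

/-- The Lagrangian of any test is asymptotically independent of the representing sequences. -/
theorem eventually_abs_lagrangian_sub_le (D : TiltData P q b r C σ) (u : ℝ)
    (hQ₀ : ∀ᶠ n in atTop, IsProbabilityMeasure (Q₀ n)) (hT₀ : HasTangent P Q₀ q)
    (hQ₁ : ∀ᶠ n in atTop, IsProbabilityMeasure (Q₁ n))
    (hT₁ : HasTangent P Q₁ (fun x => q x + b x)) {ε : ℝ} (hε : 0 < ε) :
    ∀ᶠ n in atTop, ∀ ψ : (Fin n → Ω) → ℝ, Measurable ψ → (∀ x, ψ x ∈ Set.Icc (0 : ℝ) 1) →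
      |(power ψ (Q₁ n) - D.crit u * power ψ (Q₀ n)) - (power ψ (tiltLaw P q b n) -
        Real.exp (D.threshold u) / tiltMass P q b n ^ n * power ψ (linearLaw P q n))| ≤ ε := by
  have hK : 0 < D.crit u := Real.exp_pos _
  -- Three errors are added: one in each power, the null one weighted by the critical value, and one
  -- in the critical value itself.
  set δ := ε / (2 + D.crit u) with hδ
  have hδ0 : 0 < δ := by positivity
  have h3 := (Metric.tendsto_nhds.1 (D.tendsto_crit u)) δ hδ0
  filter_upwards [eventually_abs_power_sub_le hQ₀ D.prob D.hq hT₀ D.tangent hδ0,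
    eventually_abs_power_sub_le hQ₁ D.prob_tilt (D.hq.add D.hb) hT₁ D.tangent_tilt hδ0, h3,
    D.prob] with n h0 h1 hk _ ψ hψ h01
  have a0 := h0 ψ hψ h01
  have a1 := h1 ψ hψ h01
  rw [Real.dist_eq] at hk
  set k := Real.exp (D.threshold u) / tiltMass P q b n ^ n
  set x0 := power ψ (linearLaw P q n)
  have hx0 : 0 ≤ x0 := power_nonneg h01 _
  have hx1 : x0 ≤ 1 := power_le_one hψ h01 _
  have e : (power ψ (Q₁ n) - D.crit u * power ψ (Q₀ n)) - (power ψ (tiltLaw P q b n) - k * x0) =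
      (power ψ (Q₁ n) - power ψ (tiltLaw P q b n)) - D.crit u * (power ψ (Q₀ n) - x0) +
        (k - D.crit u) * x0 := by ring
  rw [e]
  have b1 : |D.crit u * (power ψ (Q₀ n) - x0)| ≤ D.crit u * δ := by
    rw [abs_mul, abs_of_pos hK]; gcongr
  have b2 : |(k - D.crit u) * x0| ≤ δ := by
    rw [abs_mul, abs_of_nonneg hx0]
    exact (mul_le_of_le_one_right (abs_nonneg _) hx1).trans hk.le
  calc _ ≤ _ := (abs_add_le _ _).trans (add_le_add (abs_sub _ _) le_rfl)
    _ ≤ δ + D.crit u * δ + δ := add_le_add (add_le_add a1 b1) b2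
    _ = ε := by rw [hδ]; field_simp; ring

/-- **Asymptotic Neyman-Pearson lemma.** -/
theorem eventually_lagrangian_le (D : TiltData P q b r C σ) (u : ℝ)
    (hQ₀ : ∀ᶠ n in atTop, IsProbabilityMeasure (Q₀ n)) (hT₀ : HasTangent P Q₀ q)
    (hQ₁ : ∀ᶠ n in atTop, IsProbabilityMeasure (Q₁ n))
    (hT₁ : HasTangent P Q₁ (fun x => q x + b x)) {ε : ℝ} (hε : 0 < ε) :
    ∀ᶠ n in atTop, ∀ ψ : (Fin n → Ω) → ℝ, Measurable ψ → (∀ x, ψ x ∈ Set.Icc (0 : ℝ) 1) →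
      power ψ (Q₁ n) - D.crit u * power ψ (Q₀ n) ≤
        normalCdf (-u + σ) - D.crit u * normalCdf (-u) + ε := by
  filter_upwards [D.eventually_abs_lagrangian_sub_le u hQ₀ hT₀ hQ₁ hT₁ (half_pos hε),
    (Metric.tendsto_nhds.1 (D.tendsto_lagrangian_npTest u)) _ (half_pos hε), D.prob, D.prob_tilt,
    D.eventually_tiltMass_pos] with n h1 h2 i1 i2 hZ ψ hψ h01
  have a1 := (abs_le.1 (h1 ψ hψ h01)).2
  rw [Real.dist_eq] at h2
  have a2 := (abs_lt.1 h2).2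
  have : IsProbabilityMeasure ((linearLaw P q n).withDensity fun x =>
    ENNReal.ofReal (Real.exp ((√(n : ℝ))⁻¹ * b x) / tiltMass P q b n)) := i2
  -- Between the linear law and its tilt `npTest` is an exact Neyman-Pearson test, so its Lagrangian
  -- is the largest possible at this `n`.
  have a3 := (neymanPearson_gap (W := linearLaw P q n) D.hb D.hbC hZ hψ h01 (D.threshold u)).2
  have a4 : 0 ≤ (∫ x, |ψ x - thresholdTest b (D.threshold u) n x| *
      |Real.exp (scaledSum b x) - Real.exp (D.threshold u)|
      ∂(Measure.pi fun _ : Fin n => linearLaw P q n)) / tiltMass P q b n ^ n :=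
    div_nonneg (integral_nonneg fun x => by positivity) (by positivity)
  rw [← a3] at a4
  change 0 ≤ (power (D.npTest u n) (tiltLaw P q b n) - _ * power (D.npTest u n) _) -
    (power ψ (tiltLaw P q b n) - _) at a4
  linarith

/-- **Uniqueness in the asymptotic Neyman-Pearson lemma.** -/
theorem tendsto_of_lagrangian_ge (D : TiltData P q b r C σ) (u : ℝ)
    (hQ₀ : ∀ᶠ n in atTop, IsProbabilityMeasure (Q₀ n)) (hT₀ : HasTangent P Q₀ q)
    (hQ₁ : ∀ᶠ n in atTop, IsProbabilityMeasure (Q₁ n))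
    (hT₁ : HasTangent P Q₁ (fun x => q x + b x)) {l : Filter ℕ} (hl : l ≤ atTop)
    {ψ : TestSeq Ω} (hψ : IsTest ψ)
    (h : ∀ ε > 0, ∀ᶠ n in l, normalCdf (-u + σ) - D.crit u * normalCdf (-u) - ε ≤
      power (ψ n) (Q₁ n) - D.crit u * power (ψ n) (Q₀ n)) {η : ℝ} (hη : 0 < η) :
    Tendsto (fun n => (Measure.pi fun _ : Fin n => linearLaw P q n).real
      {x | η ≤ |ψ n x - D.npTest u n x|}) l (𝓝 0) := by
  set I : ℕ → ℝ := fun n => ∫ x, |ψ n x - thresholdTest b (D.threshold u) n x| *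
      |Real.exp (scaledSum b x) - Real.exp (D.threshold u)|
      ∂(Measure.pi fun _ : Fin n => linearLaw P q n) with hI
  have hI0 : ∀ n, 0 ≤ I n := fun n => integral_nonneg fun x => by positivity
  -- Near optimality of `ψ` for the given sequences passes to the linear law and its tilt, where the
  -- Lagrangian gap equals the weighted distance to `npTest`.
  have hgap : Tendsto (fun n => I n / tiltMass P q b n ^ n) l (𝓝 0) := by
    rw [Metric.tendsto_nhds]
    intro ε hε
    have h4 : 0 < ε / 4 := by linarith
    filter_upwards [hl (D.eventually_abs_lagrangian_sub_le u hQ₀ hT₀ hQ₁ hT₁ h4),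
      hl ((Metric.tendsto_nhds.1 (D.tendsto_lagrangian_npTest u)) _ h4), hl D.prob, hl D.prob_tilt,
      hl D.eventually_tiltMass_pos, h _ h4] with n h1 h2 i1 i2 hZ h3
    have a1 := (abs_le.1 (h1 (ψ n) (hψ n).1 (hψ n).2)).2
    rw [Real.dist_eq] at h2
    have a2 := (abs_lt.1 h2).2
    have : IsProbabilityMeasure ((linearLaw P q n).withDensity fun x =>
      ENNReal.ofReal (Real.exp ((√(n : ℝ))⁻¹ * b x) / tiltMass P q b n)) := i2
    have a3 := (neymanPearson_gap (W := linearLaw P q n) D.hb D.hbC hZ (hψ n).1 (hψ n).2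
      (D.threshold u)).2
    change (power (D.npTest u n) (tiltLaw P q b n) - _ * power (D.npTest u n) _) -
      (power (ψ n) (tiltLaw P q b n) - _) = I n / _ at a3
    rw [Real.dist_eq, sub_zero, abs_of_nonneg (div_nonneg (hI0 n) (by positivity)), ← a3]
    linarith
  have hIlim : Tendsto I l (𝓝 0) := by
    have := hgap.mul (D.tendsto_tiltMass_pow.mono_left hl)
    rw [zero_mul] at this
    refine this.congr' ?_
    filter_upwards [hl D.eventually_tiltMass_pos] with n hZ
    field_simp
  rw [Metric.tendsto_nhds]
  intro ε hε
  -- The limiting mass of the strip around the threshold, the only place where a small gap permits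
  -- large deviations. It vanishes with `ζ` by continuity of the normal distribution function, so
  -- `ζ` is fixed before `n` grows.
  set f : ℝ → ℝ := fun ζ => normalCdf ((∫ x, b x * q x ∂P - (D.threshold u - 2 * ζ)) / σ) -
    normalCdf ((∫ x, b x * q x ∂P - (D.threshold u + ζ)) / σ) with hf
  have hfc : Continuous f := by
    have := continuous_normalCdf
    exact (this.comp (by fun_prop)).sub (this.comp (by fun_prop))
  have hf0 : f 0 = 0 := by simp [hf]
  have hfe : ∀ᶠ ζ in 𝓝[>] (0 : ℝ), f ζ < ε / 2 :=
    (hfc.tendsto' 0 0 hf0).mono_left nhdsWithin_le_nhds |>.eventually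
      (gt_mem_nhds (by linarith))
  obtain ⟨ζ, hζε, hζ⟩ := (hfe.and self_mem_nhdsWithin).exists
  have hζ : 0 < ζ := hζ
  set κ := η * (Real.exp (D.threshold u) * (1 - Real.exp (-ζ)))
  have m1 := D.tangent.tendsto_measure_scaledSum D.prob D.hq D.hqL D.hb D.hbC D.hb0 D.hσ D.hσ2
    (D.threshold u - 2 * ζ)
  have m2 := D.tangent.tendsto_measure_scaledSum D.prob D.hq D.hqL D.hb D.hbC D.hb0 D.hσ D.hσ2
    (D.threshold u + ζ)
  have m3 := hIlim.div_const κ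
  rw [zero_div] at m3
  have m4 := ((m1.sub m2).mono_left hl).add m3
  rw [add_zero] at m4
  filter_upwards [m4.eventually (gt_mem_nhds hζε), hl D.prob, hl D.prob_tilt,
    hl D.eventually_tiltMass_pos] with n hn i1 i2 hZ
  have : IsProbabilityMeasure ((linearLaw P q n).withDensity fun x =>
    ENNReal.ofReal (Real.exp ((√(n : ℝ))⁻¹ * b x) / tiltMass P q b n)) := i2
  have a3 := (neymanPearson_gap (W := linearLaw P q n) D.hb D.hbC hZ (hψ n).1 (hψ n).2
    (D.threshold u)).1
  have a4 := measureReal_abs_sub_thresholdTest_le D.hb a3 hη hζ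
  rw [Real.dist_eq, sub_zero, abs_of_nonneg measureReal_nonneg]
  exact (a4.trans_lt hn).trans (by linarith)

/-- Convergence in probability under the local null law carries over to the centre. -/
theorem tendsto_center (D : TiltData P q b r C σ) {l : Filter ℕ} (hl : l ≤ atTop)
    {A : (n : ℕ) → Set (Fin n → Ω)} (hA : ∀ n, MeasurableSet (A n))
    (h : Tendsto (fun n => (Measure.pi fun _ : Fin n => linearLaw P q n).real (A n)) l (𝓝 0)) :
    Tendsto (fun n => (Measure.pi fun _ : Fin n => P).real (A n)) l (𝓝 0) := by
  rw [Metric.tendsto_nhds]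
  intro ε hε
  set E := Real.exp (2 * ∫ x, q x ^ 2 ∂P)
  have hE : 0 < E := Real.exp_pos _
  set R := 2 * E / ε with hR
  have hR0 : 0 < R := by positivity
  have h2 := h.const_mul R
  rw [mul_zero] at h2
  filter_upwards [h2.eventually (gt_mem_nhds (half_pos hε)), hl D.prob,
    hl (eventually_mul_inv_sqrt_le r (by norm_num : (0 : ℝ) < 1 / 2)),
    hl (eventually_gt_atTop 0)] with n h1 _ hn hn0
  rw [Real.dist_eq, sub_zero, abs_of_nonneg measureReal_nonneg]
  have := measureReal_pi_le_linearLaw D.hq D.hqL D.hq0 D.hqr hn0 hn (hA n) hR0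
  have e : E / R = ε / 2 := by rw [hR]; field_simp
  linarith

end TiltData

/-! ### Stochastic order and product measures -/

theorem measurable_finCons {S : Type*} [MeasurableSpace S] (n : ℕ) :
    Measurable fun p : S × (Fin n → S) => (Fin.cons p.1 p.2 : Fin (n + 1) → S) := by
  refine measurable_pi_iff.2 fun i => ?_
  refine Fin.cases ?_ (fun j => ?_) i
  · simpa using measurable_fst
  · simpa using (by fun_prop : Measurable fun x : S × (Fin n → S) => x.2 j)

theorem measure_pi_succ {S : Type*} [MeasurableSpace S] {n : ℕ} (μ : Measure S) [SigmaFinite μ]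
    {U : Set (Fin (n + 1) → S)} (hU : MeasurableSet U) :
    Measure.pi (fun _ : Fin (n + 1) => μ) U =
      (μ.prod (Measure.pi fun _ : Fin n => μ))
        ((fun p : S × (Fin n → S) => (Fin.cons p.1 p.2 : Fin (n + 1) → S)) ⁻¹' U) := by
  rw [← lintegral_indicator_one hU, lintegral_pi_succ μ (measurable_one.indicator hU),
    ← lintegral_indicator_one (measurable_finCons n hU)]
  rfl

/-- Stochastic order passes to product measures. -/
theorem measure_pi_le_of_isUpperSet {S : Type*} [MeasurableSpace S] [Preorder S]
    {ν ν' : Measure S} [IsProbabilityMeasure ν] [IsProbabilityMeasure ν']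
    (h : ∀ U : Set S, IsUpperSet U → MeasurableSet U → ν U ≤ ν' U) (n : ℕ)
    {U : Set (Fin n → S)} (hU : IsUpperSet U) (hUm : MeasurableSet U) :
    Measure.pi (fun _ : Fin n => ν) U ≤ Measure.pi (fun _ : Fin n => ν') U := by
  induction n with
  | zero =>
    rw [Measure.pi_of_empty (fun _ : Fin 0 => ν) default,
      Measure.pi_of_empty (fun _ : Fin 0 => ν') default]
  | succ n ih =>
    rw [measure_pi_succ ν hUm, measure_pi_succ ν' hUm]
    set V := (fun p : S × (Fin n → S) => (Fin.cons p.1 p.2 : Fin (n + 1) → S)) ⁻¹' U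
    have hV : MeasurableSet V := measurable_finCons n hUm
    have hle : ∀ {x x' : S} {y y' : Fin n → S}, x ≤ x' → y ≤ y' →
        (Fin.cons x y : Fin (n + 1) → S) ≤ Fin.cons x' y' := fun hx hy i =>
      Fin.cases (by simpa using hx) (fun j => by simpa using hy j) i
    -- The law of the first coordinate is exchanged with the others held fixed, then the remaining
    -- ones by induction. Sections of upper sets are upper sets.
    calc (ν.prod (Measure.pi fun _ : Fin n => ν)) V
        = ∫⁻ y, ν ((fun x => (x, y)) ⁻¹' V) ∂(Measure.pi fun _ : Fin n => ν) :=
          Measure.prod_apply_symm hV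
      _ ≤ ∫⁻ y, ν' ((fun x => (x, y)) ⁻¹' V) ∂(Measure.pi fun _ : Fin n => ν) :=
          lintegral_mono fun y => h _ (fun x x' hx hxV => hU (hle hx le_rfl) hxV)
            (hV.preimage (by fun_prop))
      _ = (ν'.prod (Measure.pi fun _ : Fin n => ν)) V := (Measure.prod_apply_symm hV).symm
      _ = ∫⁻ x, (Measure.pi fun _ : Fin n => ν) (Prod.mk x ⁻¹' V) ∂ν' := Measure.prod_apply hV
      _ ≤ ∫⁻ x, (Measure.pi fun _ : Fin n => ν') (Prod.mk x ⁻¹' V) ∂ν' :=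
          lintegral_mono fun x => ih (fun y y' hy hyV => hU (hle le_rfl hy) hyV)
            (hV.preimage (by fun_prop))
      _ = (ν'.prod (Measure.pi fun _ : Fin n => ν')) V := (Measure.prod_apply hV).symm

/-- The order on observations is the one induced by a statistic `f`: the real score for threshold
tests, the likelihood ratio in `[0, ∞]` for least favorable pairs. -/
theorem measure_pi_comp_le_of_isUpperSet {S : Type*} [MeasurableSpace S] [Preorder S]
    {Q Q' : Measure Ω} [IsProbabilityMeasure Q] [IsProbabilityMeasure Q'] {f : Ω → S}
    (hf : Measurable f)
    (h : ∀ U : Set S, IsUpperSet U → MeasurableSet U → Q (f ⁻¹' U) ≤ Q' (f ⁻¹' U)) (n : ℕ)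
    {U : Set (Fin n → S)} (hU : IsUpperSet U) (hUm : MeasurableSet U) :
    Measure.pi (fun _ : Fin n => Q) {x | (fun i => f (x i)) ∈ U} ≤
      Measure.pi (fun _ : Fin n => Q') {x | (fun i => f (x i)) ∈ U} := by
  have i1 : IsProbabilityMeasure (Q.map f) := Measure.isProbabilityMeasure_map hf.aemeasurable
  have i2 : IsProbabilityMeasure (Q'.map f) := Measure.isProbabilityMeasure_map hf.aemeasurable
  have key := measure_pi_le_of_isUpperSet (ν := Q.map f) (ν' := Q'.map f)
    (fun U hU hUm => by
      rw [Measure.map_apply hf hUm, Measure.map_apply hf hUm]; exact h U hU hUm) n hU hUm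
  have hm : Measurable fun (x : Fin n → Ω) i => f (x i) :=
    measurable_pi_iff.2 fun i => hf.comp (measurable_pi_apply i)
  rw [← Measure.pi_map_pi (fun _ => hf.aemeasurable), ← Measure.pi_map_pi
    (fun _ => hf.aemeasurable), Measure.map_apply hm hUm, Measure.map_apply hm hUm] at key
  exact key

theorem isUpperSet_lt_sum (n : ℕ) (t : ℝ) :
    IsUpperSet {y : Fin n → ℝ | t < (√(n : ℝ))⁻¹ * ∑ i, y i} := fun _ _ hy h =>
  lt_of_lt_of_le h (mul_le_mul_of_nonneg_left (Finset.sum_le_sum fun i _ => hy i)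
    (inv_nonneg.2 (Real.sqrt_nonneg _)))

theorem power_thresholdTest_le {Q Q' : Measure Ω} [IsProbabilityMeasure Q]
    [IsProbabilityMeasure Q'] {f : Ω → ℝ} (hf : Measurable f)
    (h : ∀ U : Set ℝ, IsUpperSet U → MeasurableSet U → Q (f ⁻¹' U) ≤ Q' (f ⁻¹' U)) (t : ℝ)
    (n : ℕ) : power (thresholdTest f t n) Q ≤ power (thresholdTest f t n) Q' := by
  rw [power_thresholdTest hf, power_thresholdTest hf]
  have hm : Measurable fun y : Fin n → ℝ => (√(n : ℝ))⁻¹ * ∑ i, y i := by fun_prop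
  exact ENNReal.toReal_mono (measure_ne_top _ _) (measure_pi_comp_le_of_isUpperSet hf h n
    (isUpperSet_lt_sum n t) (measurableSet_lt measurable_const hm))

/-- Contamination at the top of the range of `f` is stochastically largest. -/
theorem contamination_le_of_top {Q M M₀ : Measure Ω} [IsProbabilityMeasure M]
    [IsProbabilityMeasure M₀] (c d : ℝ≥0∞) {S : Type*} [Preorder S] {f : Ω → S} {m : S}
    (hfm : ∀ x, f x ≤ m) (hM₀ : ∀ᵐ x ∂M₀, f x = m) {U : Set S} (hU : IsUpperSet U) :
    (c • Q + d • M) (f ⁻¹' U) ≤ (c • Q + d • M₀) (f ⁻¹' U) := by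
  simp only [Measure.add_apply, Measure.smul_apply, smul_eq_mul]
  gcongr c * _ + d * ?_
  by_cases hm : m ∈ U
  · have : M₀ (f ⁻¹' U) = 1 := by
      rw [← measure_univ (μ := M₀)]
      refine measure_congr ?_
      filter_upwards [hM₀] with x hx
      exact propext ⟨fun _ => trivial, fun _ => show f x ∈ U by rwa [hx]⟩
    rw [this]
    exact prob_le_one
  · have : f ⁻¹' U = ∅ := Set.eq_empty_of_forall_notMem fun x hx => hm (hU (hfm x) hx)
    simp [this]

/-- Contamination at the bottom of the range of `f` is stochastically smallest. -/
theorem contamination_ge_of_bot {Q M M₀ : Measure Ω} [IsProbabilityMeasure M]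
    [IsProbabilityMeasure M₀] (c d : ℝ≥0∞) {S : Type*} [Preorder S] {f : Ω → S} {m : S}
    (hfm : ∀ x, m ≤ f x) (hM₀ : ∀ᵐ x ∂M₀, f x = m) {U : Set S} (hU : IsUpperSet U) :
    (c • Q + d • M₀) (f ⁻¹' U) ≤ (c • Q + d • M) (f ⁻¹' U) := by
  simp only [Measure.add_apply, Measure.smul_apply, smul_eq_mul]
  gcongr c * _ + d * ?_
  by_cases hm : m ∈ U
  · have : f ⁻¹' U = Set.univ := Set.eq_univ_of_forall fun x => hU (hfm x) hm
    simp [this]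
  · have : M₀ (f ⁻¹' U) = 0 := by
      refine measure_mono_null (t := {x | ¬ f x = m}) (fun x hx h => hm ?_) hM₀
      rw [← h]; exact hx
    simp [this]

theorem exists_forall_isUpperSet_ennreal_cases {U : Set ℝ≥0∞} (hU : IsUpperSet U) :
    U = Set.Ici (sInf U) ∨ U = Set.Ioi (sInf U) := by
  by_cases h : sInf U ∈ U
  · left
    ext x
    exact ⟨fun hx => sInf_le hx, fun hx => hU hx h⟩
  · right
    ext x
    refine ⟨fun hx => lt_of_le_of_ne (sInf_le hx) fun h' => h (h' ▸ hx), fun hx => ?_⟩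
    obtain ⟨y, hy, hyx⟩ := sInf_lt_iff.1 (show sInf U < x from hx)
    exact hU hyx.le hy

theorem Ici_eq_iInter_Ioi {a : ℝ≥0∞} (ha : a ≠ 0) : ∃ v : ℕ → ℝ≥0∞, Monotone v ∧
    (∀ n, v n < a) ∧ (∀ n, 0 < v n) ∧ Set.Ici a = ⋂ n, Set.Ioi (v n) := by
  obtain ⟨v, hv, hva, hlim⟩ := exists_seq_strictMono_tendsto' (pos_iff_ne_zero.2 ha)
  refine ⟨v, hv.monotone, fun n => (hva n).2, fun n => (hva n).1, ?_⟩
  ext x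
  simp only [Set.mem_Ici, Set.mem_iInter, Set.mem_Ioi]
  exact ⟨fun h n => (hva n).2.trans_le h, fun h => le_of_tendsto' hlim fun n => (h n).le⟩

theorem Ioi_eq_iUnion_Ioi {a : ℝ≥0∞} (ha : a ≠ ∞) : ∃ v : ℕ → ℝ≥0∞, Antitone v ∧
    (∀ n, a < v n) ∧ (∀ n, v n < ∞) ∧ Set.Ioi a = ⋃ n, Set.Ioi (v n) := by
  obtain ⟨v, hv, hva, hlim⟩ := exists_seq_strictAnti_tendsto' (lt_top_iff_ne_top.2 ha)
  refine ⟨v, hv.antitone, fun n => (hva n).1, fun n => (hva n).2, ?_⟩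
  ext x
  simp only [Set.mem_Ioi, Set.mem_iUnion]
  exact ⟨fun h => (hlim.eventually (gt_mem_nhds h)).exists, fun ⟨n, h⟩ => (hva n).1.trans h⟩

/-- The order of the tails at finite positive levels determines the stochastic order. -/
theorem measure_le_of_forall_Ioi {ν ν' : Measure ℝ≥0∞} [IsProbabilityMeasure ν]
    [IsProbabilityMeasure ν'] (h : ∀ t, 0 < t → t < ∞ → ν (Set.Ioi t) ≤ ν' (Set.Ioi t))
    {U : Set ℝ≥0∞} (hU : IsUpperSet U) : ν U ≤ ν' U := by
  rcases exists_forall_isUpperSet_ennreal_cases hU with h1 | h1 <;> rw [h1] <;>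
    generalize sInf U = a
  · rcases eq_or_ne a 0 with rfl | ha
    · simp
    · obtain ⟨v, hv, hva, hv0, he⟩ := Ici_eq_iInter_Ioi ha
      have hanti : Antitone fun n => Set.Ioi (v n) := fun i j hij => Set.Ioi_subset_Ioi (hv hij)
      rw [he]
      have l1 := tendsto_measure_iInter_atTop (μ := ν) (s := fun n => Set.Ioi (v n))
        (fun n => measurableSet_Ioi.nullMeasurableSet) hanti ⟨0, measure_ne_top _ _⟩
      have l2 := tendsto_measure_iInter_atTop (μ := ν') (s := fun n => Set.Ioi (v n))
        (fun n => measurableSet_Ioi.nullMeasurableSet) hanti ⟨0, measure_ne_top _ _⟩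
      exact le_of_tendsto_of_tendsto' l1 l2 fun n => h _ (hv0 n) ((hva n).trans_le le_top)
  · rcases eq_or_ne a ∞ with rfl | ha
    · simp
    · obtain ⟨v, hv, hva, hvt, he⟩ := Ioi_eq_iUnion_Ioi ha
      have hmono : Monotone fun n => Set.Ioi (v n) := fun i j hij => Set.Ioi_subset_Ioi (hv hij)
      rw [he]
      have l1 := tendsto_measure_iUnion_atTop (μ := ν) (s := fun n => Set.Ioi (v n)) hmono
      have l2 := tendsto_measure_iUnion_atTop (μ := ν') (s := fun n => Set.Ioi (v n)) hmono
      exact le_of_tendsto_of_tendsto' l1 l2 fun n =>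
        h _ ((zero_le).trans_lt (hva n)) (hvt n)

theorem measure_preimage_le_of_forall_lt {Q Q' : Measure Ω} [IsProbabilityMeasure Q]
    [IsProbabilityMeasure Q'] {π : Ω → ℝ≥0∞} (hπ : Measurable π)
    (h : ∀ t, 0 < t → t < ∞ → Q {x | t < π x} ≤ Q' {x | t < π x}) {U : Set ℝ≥0∞}
    (hU : IsUpperSet U) (hUm : MeasurableSet U) : Q (π ⁻¹' U) ≤ Q' (π ⁻¹' U) := by
  have i1 : IsProbabilityMeasure (Q.map π) := Measure.isProbabilityMeasure_map hπ.aemeasurable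
  have i2 : IsProbabilityMeasure (Q'.map π) := Measure.isProbabilityMeasure_map hπ.aemeasurable
  rw [← Measure.map_apply hπ hUm, ← Measure.map_apply hπ hUm]
  refine measure_le_of_forall_Ioi (fun t h0 ht => ?_) hU
  rw [Measure.map_apply hπ measurableSet_Ioi, Measure.map_apply hπ measurableSet_Ioi]
  exact h t h0 ht

/-- Upper quantiles of a law on `[0, ∞]`. -/
theorem exists_quantile (ν : Measure ℝ≥0∞) [IsProbabilityMeasure ν] {α : ℝ≥0∞} (hα : α ≤ 1) :
    ∃ k, ν (Set.Ioi k) ≤ α ∧ α ≤ ν (Set.Ici k) := by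
  set S : Set ℝ≥0∞ := {t | ν (Set.Ioi t) ≤ α}
  have hS : ∀ t, sInf S < t → ν (Set.Ioi t) ≤ α := fun t ht => by
    obtain ⟨s, hs, hst⟩ := sInf_lt_iff.1 ht
    exact (measure_mono (Set.Ioi_subset_Ioi hst.le)).trans hs
  refine ⟨sInf S, ?_, ?_⟩
  · rcases eq_or_ne (sInf S) ∞ with h | ha
    · rw [h]; simp
    · obtain ⟨v, hv, hva, hvt, he⟩ := Ioi_eq_iUnion_Ioi ha
      have hmono : Monotone fun n => Set.Ioi (v n) := fun i j hij => Set.Ioi_subset_Ioi (hv hij)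
      rw [he]
      exact le_of_tendsto' (tendsto_measure_iUnion_atTop (μ := ν) hmono) fun n => hS _ (hva n)
  · rcases eq_or_ne (sInf S) 0 with h | ha
    · rw [h]; simpa using hα
    · obtain ⟨v, hv, hva, hv0, he⟩ := Ici_eq_iInter_Ioi ha
      have hanti : Antitone fun n => Set.Ioi (v n) := fun i j hij => Set.Ioi_subset_Ioi (hv hij)
      rw [he]
      refine ge_of_tendsto' (tendsto_measure_iInter_atTop (μ := ν)
        (fun n => measurableSet_Ioi.nullMeasurableSet) hanti ⟨0, measure_ne_top _ _⟩) fun n => ?_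
      by_contra hlt
      exact not_lt.2 (sInf_le (show v n ∈ S from (not_le.1 hlt).le)) (hva n)

/-! ### Least favorable pairs for contamination neighborhoods -/

theorem isProbabilityMeasure_contaminationNhd {P Q : Measure Ω} [IsProbabilityMeasure P] {ε : ℝ}
    (h0 : 0 ≤ ε) (h1 : ε ≤ 1) (hQ : Q ∈ contaminationNhd P ε) : IsProbabilityMeasure Q := by
  obtain ⟨M, hM, rfl⟩ := hQ
  refine ⟨?_⟩
  simp only [Measure.add_apply, Measure.smul_apply, smul_eq_mul, measure_univ, mul_one]
  rw [← ENNReal.ofReal_add (by linarith) h0]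
  simp

/-- Densities of two measures with respect to their sum. -/
theorem exists_complementary_densities (P₀ P₁ : Measure Ω) [IsProbabilityMeasure P₀]
    [IsProbabilityMeasure P₁] : ∃ f : Ω → ℝ, Measurable f ∧ (∀ x, 0 ≤ f x) ∧ (∀ x, f x ≤ 1) ∧
      P₀ = (P₀ + P₁).withDensity (fun x => ENNReal.ofReal (f x)) ∧
      P₁ = (P₀ + P₁).withDensity (fun x => ENNReal.ofReal (1 - f x)) := by
  set μ := P₀ + P₁ with hμ
  have hle : P₀ ≤ μ := Measure.le_add_right le_rfl
  have hac : P₀ ≪ μ := Measure.absolutelyContinuous_of_le hle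
  -- Truncation at `1` changes the density on a null set only, but makes both `f` and `1 - f`
  -- nonnegative at every point.
  set f : Ω → ℝ := fun x => (min (P₀.rnDeriv μ x) 1).toReal with hf
  have hfm : Measurable f := ((Measure.measurable_rnDeriv _ _).min measurable_const).ennreal_toReal
  have hf1 : ∀ x, f x ≤ 1 := fun x => by
    have := ENNReal.toReal_mono ENNReal.one_ne_top (min_le_right (P₀.rnDeriv μ x) 1)
    simpa using this
  have e0 : P₀ = μ.withDensity (fun x => ENNReal.ofReal (f x)) := by
    conv_lhs => rw [← Measure.withDensity_rnDeriv_eq P₀ μ hac]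
    refine withDensity_congr_ae ?_
    filter_upwards [Measure.rnDeriv_le_one_of_le hle] with x hx
    have hx' : P₀.rnDeriv μ x ≤ 1 := hx
    simp only [hf]
    rw [min_eq_left hx', ENNReal.ofReal_toReal (ne_top_of_le_ne_top ENNReal.one_ne_top hx')]
  refine ⟨f, hfm, fun x => ENNReal.toReal_nonneg, hf1, e0, ?_⟩
  have hsum : P₀ + P₁ = P₀ + μ.withDensity (fun x => ENNReal.ofReal (1 - f x)) := by
    conv_rhs => rw [e0]
    rw [← withDensity_add_left hfm.ennreal_ofReal]
    have : (fun x => ENNReal.ofReal (f x)) + (fun x => ENNReal.ofReal (1 - f x)) = 1 := by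
      ext x
      simp only [Pi.add_apply, Pi.one_apply]
      rw [← ENNReal.ofReal_add (show 0 ≤ f x from ENNReal.toReal_nonneg) (by linarith [hf1 x])]
      simp
    rw [this, withDensity_one]
  ext s hs
  have := congrArg (fun ν : Measure Ω => ν s) hsum
  simp only [Measure.add_apply] at this
  exact (ENNReal.add_right_inj (measure_ne_top P₀ s)).1 this

/-- The level of a truncation is determined by a mass condition. -/
theorem exists_integral_max_eq_one {μ : Measure Ω} [IsFiniteMeasure μ] {f g : Ω → ℝ}
    (hf : Measurable f) (hg : Measurable g) (hf0 : ∀ x, 0 ≤ f x) (hf1 : ∀ x, f x ≤ 1)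
    (hg1 : ∀ x, g x ≤ 1) (hfi : ∫ x, f x ∂μ = 1) {ε x₀ : ℝ} (hε : 0 < ε)
    (hx₀ : 0 < x₀) (h : 1 < (1 - ε) * ∫ x, max (f x) (x₀ * g x) ∂μ) :
    ∃ x, 0 < x ∧ x < x₀ ∧ (1 - ε) * ∫ y, max (f y) (x * g y) ∂μ = 1 := by
  have hc : ContinuousOn (fun x => (1 - ε) * ∫ y, max (f y) (x * g y) ∂μ) (Set.Icc 0 x₀) := by
    refine continuousOn_const.mul (continuousOn_of_dominated (bound := fun _ => 1 + x₀)
      (fun x _ => (hf.max (hg.const_mul x)).aestronglyMeasurable)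
      (fun x hx => .of_forall fun y => ?_)
      (integrable_const _) (.of_forall fun y => by fun_prop))
    rw [Real.norm_eq_abs, abs_of_nonneg (le_max_of_le_left (hf0 y))]
    exact max_le (by linarith [hf1 y]) (by nlinarith [hx.1, hx.2, hg1 y])
  have h0 : (1 - ε) * ∫ y, max (f y) (0 * g y) ∂μ < 1 := by
    have : (fun y => max (f y) (0 * g y)) = f := by
      ext y; rw [zero_mul, max_eq_left (hf0 y)]
    rw [this, hfi]; linarith
  obtain ⟨x, hx, hx1⟩ := intermediate_value_Ioo hx₀.le hc ⟨h0, h⟩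
  exact ⟨x, hx.1, hx.2, hx1⟩

/-- The excess of `w` over `(1 - ε) f`, divided by `ε`, is the density of the contaminating law.
Membership is thus a pointwise lower bound plus total mass one. -/
theorem mem_contaminationNhd_of_density {μ P : Measure Ω} [IsFiniteMeasure μ] {f w : Ω → ℝ}
    (hf : Measurable f) (hw : Measurable w) (hf0 : ∀ x, 0 ≤ f x)
    (hP : P = μ.withDensity (fun x => ENNReal.ofReal (f x))) {ε : ℝ} (h0 : 0 < ε) (h1 : ε < 1)
    (hfi : Integrable f μ) (hfi1 : ∫ x, f x ∂μ = 1)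
    (hwi : Integrable w μ) (hwi1 : ∫ x, w x ∂μ = 1) (hle : ∀ x, (1 - ε) * f x ≤ w x) :
    μ.withDensity (fun x => ENNReal.ofReal (w x)) ∈ contaminationNhd P ε := by
  set m : Ω → ℝ := fun x => (w x - (1 - ε) * f x) / ε with hm
  have hm0 : ∀ x, 0 ≤ m x := fun x => div_nonneg (by linarith [hle x]) h0.le
  have hmm : Measurable m := (hw.sub (hf.const_mul _)).div_const _
  have hmi : Integrable m μ := (hwi.sub (hfi.const_mul _)).div_const _
  refine ⟨μ.withDensity fun x => ENNReal.ofReal (m x), ?_, ?_⟩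
  · refine isProbabilityMeasure_withDensity_ofReal hm0 hmi ?_
    simp only [hm]
    rw [integral_div, integral_sub hwi (hfi.const_mul _), integral_const_mul, hfi1, hwi1]
    field_simp
    ring
  · rw [hP, ← withDensity_smul _ hf.ennreal_ofReal, ← withDensity_smul _ hmm.ennreal_ofReal,
      ← withDensity_add_left (hf.ennreal_ofReal.const_smul _)]
    congr 1
    ext x
    simp only [Pi.add_apply, Pi.smul_apply, smul_eq_mul]
    rw [← ENNReal.ofReal_mul (by linarith), ← ENNReal.ofReal_mul h0.le, ← ENNReal.ofReal_add
      (mul_nonneg (by linarith) (hf0 x)) (mul_nonneg h0.le (hm0 x))]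
    congr 1
    simp only [hm]
    field_simp
    ring

/-- Huber's least favorable pair for two contamination neighborhoods. -/
theorem exists_isLeastFavorablePair (P₀ P₁ : Measure Ω) [IsProbabilityMeasure P₀]
    [IsProbabilityMeasure P₁] {ε₀ ε₁ c₀ : ℝ} (h0 : 0 < ε₀) (h0' : ε₀ < 1) (h1 : 0 < ε₁)
    (h1' : ε₁ < 1) (hc₀ : 0 < c₀) {A : Set Ω} (hA : MeasurableSet A)
    (hgap₀ : c₀ < (1 - ε₀) * (c₀ * P₀.real Aᶜ + P₁.real A))
    (hgap₁ : 1 < (1 - ε₁) * (c₀ * P₀.real Aᶜ + P₁.real A)) :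
    ∃ Q₀ Q₁ π, IsLeastFavorablePair (contaminationNhd P₀ ε₀) (contaminationNhd P₁ ε₁) Q₀ Q₁ π := by
  obtain ⟨f, hfm, hf0, hf1, e0, e1⟩ := exists_complementary_densities P₀ P₁
  set μ := P₀ + P₁ with hμ
  set g : Ω → ℝ := fun x => 1 - f x with hg
  have hgm : Measurable g := measurable_const.sub hfm
  have hg0 : ∀ x, 0 ≤ g x := fun x => by simp only [hg]; linarith [hf1 x]
  have hg1 : ∀ x, g x ≤ 1 := fun x => by simp only [hg]; linarith [hf0 x]
  have hfg : ∀ x, f x + g x = 1 := fun x => by simp only [hg]; ring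
  have bdd : ∀ {h : Ω → ℝ} (C : ℝ), Measurable h → (∀ x, 0 ≤ h x) → (∀ x, h x ≤ C) →
      Integrable h μ := fun C hm hn hC => Integrable.of_bound hm.aestronglyMeasurable C
    (.of_forall fun x => by rw [Real.norm_eq_abs, abs_of_nonneg (hn x)]; exact hC x)
  have hfi := bdd 1 hfm hf0 hf1
  have hgi := bdd 1 hgm hg0 hg1
  have hset : ∀ {h : Ω → ℝ} {Q : Measure Ω} [IsProbabilityMeasure Q], Integrable h μ →
      (∀ x, 0 ≤ h x) → Q = μ.withDensity (fun x => ENNReal.ofReal (h x)) →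
      ∀ B : Set Ω, MeasurableSet B → ∫ x in B, h x ∂μ = Q.real B := by
    intro h Q _ hi hn hQ B hB
    rw [measureReal_def, hQ, withDensity_apply _ hB, integral_eq_lintegral_of_nonneg_ae
      (.of_forall hn) hi.aestronglyMeasurable.restrict]
  have hfi1 : ∫ x, f x ∂μ = 1 := by simpa using hset hfi hf0 e0 Set.univ MeasurableSet.univ
  have hgi1 : ∫ x, g x ∂μ = 1 := by simpa using hset hgi hg0 e1 Set.univ MeasurableSet.univ
  -- A maximum dominates one function on `A` and the other on its complement; the mass hypotheses
  -- enter only through this bound.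
  have hlow : ∀ {h : Ω → ℝ} (a b : ℝ), Integrable h μ → (∀ x, a * f x ≤ h x) →
      (∀ x, b * g x ≤ h x) → a * P₀.real Aᶜ + b * P₁.real A ≤ ∫ x, h x ∂μ := by
    intro h a b hi ha hb
    rw [← integral_add_compl hA hi, add_comm, ← hset hfi hf0 e0 _ hA.compl,
      ← hset hgi hg0 e1 _ hA, ← integral_const_mul, ← integral_const_mul]
    exact add_le_add
      (integral_mono (hgi.integrableOn.const_mul b) hi.integrableOn hb)
      (integral_mono (hfi.integrableOn.const_mul a) hi.integrableOn ha)
  have hmaxi : ∀ {a b : Ω → ℝ} (c : ℝ), 0 ≤ c → Measurable a → Measurable b → (∀ x, 0 ≤ a x) →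
      (∀ x, a x ≤ 1) → (∀ x, 0 ≤ b x) → (∀ x, b x ≤ 1) →
      Integrable (fun x => max (a x) (c * b x)) μ := fun c hc ham hbm ha0 ha1 hb0 hb1 =>
    bdd (1 + c) (ham.max (hbm.const_mul c)) (fun x => le_max_of_le_left (ha0 x))
      fun x => max_le (by linarith [ha1 x]) (by nlinarith [hb0 x, hb1 x])
  obtain ⟨x, hx0, hxc, hx1⟩ := exists_integral_max_eq_one (μ := μ) hfm hgm hf0 hf1 hg1 hfi1 h0
    (inv_pos.2 hc₀) (by
      have := hlow 1 c₀⁻¹ (hmaxi c₀⁻¹ (inv_pos.2 hc₀).le hfm hgm hf0 hf1 hg0 hg1)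
        (fun y => by rw [one_mul]; exact le_max_left _ _) (fun y => le_max_right _ _)
      refine lt_of_lt_of_le ?_ (mul_le_mul_of_nonneg_left this (by linarith))
      have e : (1 - ε₀) * (1 * P₀.real Aᶜ + c₀⁻¹ * P₁.real A) =
          ((1 - ε₀) * (c₀ * P₀.real Aᶜ + P₁.real A)) / c₀ := by field_simp
      rw [e, lt_div_iff₀ hc₀]; linarith)
  obtain ⟨c, hc0, hcc, hc1⟩ := exists_integral_max_eq_one (μ := μ) hgm hfm hg0 hg1 hf1 hgi1 h1
    hc₀ (by
      have := hlow c₀ 1 (hmaxi c₀ hc₀.le hgm hfm hg0 hg1 hf0 hf1)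
        (fun y => le_max_right _ _) (fun y => by rw [one_mul]; exact le_max_left _ _)
      refine lt_of_lt_of_le hgap₁ (mul_le_mul_of_nonneg_left ?_ (by linarith))
      linarith)
  -- The likelihood ratio `g/f` is going to be clipped below at `c` and above at `1/x`; here the two
  -- levels are seen to be in the right order.
  have hcx : c * x < 1 := by
    have : c * x < c₀ * c₀⁻¹ := mul_lt_mul'' hcc hxc hc0.le hx0.le
    rwa [mul_inv_cancel₀ hc₀.ne'] at this
  have hε0 : 0 < 1 - ε₀ := by linarith
  have hε1 : 0 < 1 - ε₁ := by linarith
  set w₀ : Ω → ℝ := fun y => (1 - ε₀) * max (f y) (x * g y) with hw₀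
  set w₁ : Ω → ℝ := fun y => (1 - ε₁) * max (g y) (c * f y) with hw₁
  have hw₀m : Measurable w₀ := (hfm.max (hgm.const_mul x)).const_mul _
  have hw₁m : Measurable w₁ := (hgm.max (hfm.const_mul c)).const_mul _
  have hw₀i : Integrable w₀ μ := (hmaxi x hx0.le hfm hgm hf0 hf1 hg0 hg1).const_mul _
  have hw₁i : Integrable w₁ μ := (hmaxi c hc0.le hgm hfm hg0 hg1 hf0 hf1).const_mul _
  have hw₀1 : ∫ y, w₀ y ∂μ = 1 := by simp only [hw₀]; rw [integral_const_mul, hx1]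
  have hw₁1 : ∫ y, w₁ y ∂μ = 1 := by simp only [hw₁]; rw [integral_const_mul, hc1]
  -- As `f + g = 1`, the densities never vanish together, so the clipped ratio is finite at every
  -- point.
  have hw₀p : ∀ y, 0 < w₀ y := fun y => by
    refine mul_pos hε0 ?_
    rcases (hf0 y).eq_or_lt with h | h
    · have : g y = 1 := by linarith [hfg y]
      exact lt_max_of_lt_right (by rw [this]; linarith)
    · exact lt_max_of_lt_left h
  have hw₁n : ∀ y, 0 ≤ w₁ y := fun y => mul_nonneg hε1.le (le_max_of_le_left (hg0 y))
  have m0 := mem_contaminationNhd_of_density hfm hw₀m hf0 e0 h0 h0' hfi hfi1 hw₀i hw₀1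
    fun y => mul_le_mul_of_nonneg_left (le_max_left _ _) hε0.le
  have m1 := mem_contaminationNhd_of_density hgm hw₁m hg0 e1 h1 h1' hgi hgi1 hw₁i hw₁1
    fun y => mul_le_mul_of_nonneg_left (le_max_left _ _) hε1.le
  set Q₀ := μ.withDensity fun y => ENNReal.ofReal (w₀ y) with hQ₀
  set Q₁ := μ.withDensity fun y => ENNReal.ofReal (w₁ y) with hQ₁
  have hπm : Measurable fun y => ENNReal.ofReal (w₁ y / w₀ y) := (hw₁m.div hw₀m).ennreal_ofReal
  refine ⟨Q₀, Q₁, fun y => ENNReal.ofReal (w₁ y / w₀ y), m0, m1, hπm, ?_, ?_⟩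
  · rw [hQ₀, hQ₁, ← withDensity_mul _ hw₀m.ennreal_ofReal hπm]
    congr 1
    ext y
    simp only [Pi.mul_apply]
    rw [← ENNReal.ofReal_mul (hw₀p y).le, mul_div_cancel₀ _ (hw₀p y).ne']
  · intro t' ht0 htt
    obtain ⟨t, rfl⟩ : ∃ t : ℝ, t' = ENNReal.ofReal t :=
      ⟨t'.toReal, (ENNReal.ofReal_toReal htt.ne).symm⟩
    have ht : 0 < t := ENNReal.ofReal_pos.1 ht0
    have hE : {y | ENNReal.ofReal t < ENNReal.ofReal (w₁ y / w₀ y)} = {y | t * w₀ y < w₁ y} := by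
      ext y
      simp only [Set.mem_ofPred_eq]
      rw [ENNReal.ofReal_lt_ofReal_iff_of_nonneg ht.le, lt_div_iff₀ (hw₀p y)]
    rw [hE]
    have hEm : MeasurableSet {y | t * w₀ y < w₁ y} := measurableSet_lt (hw₀m.const_mul t) hw₁m
    set E := {y | t * w₀ y < w₁ y} with hEdef
    obtain ⟨v, hv⟩ : ∃ v, v = t * (1 - ε₀) / (1 - ε₁) := ⟨_, rfl⟩
    have hv0 : 0 < v := by rw [hv]; positivity
    have hmem : ∀ y, y ∈ E ↔ v * max (f y) (x * g y) < max (g y) (c * f y) := fun y => by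
      rw [hv, div_mul_eq_mul_div, div_lt_iff₀ hε1]
      simp only [hEdef, hw₀, hw₁, Set.mem_ofPred_eq]
      rw [← mul_assoc, mul_comm (1 - ε₁)]
    constructor
    · intro Q hQ
      have hQp := isProbabilityMeasure_contaminationNhd h0.le h0'.le hQ
      have hQ₀p := isProbabilityMeasure_contaminationNhd h0.le h0'.le m0
      -- Either `t` exceeds the top clipping level, or off `E` there is no upper clipping. In the
      -- latter case `Q₀` charges `Eᶜ` by `(1 - ε₀) P₀` alone, the least that any member of the
      -- neighborhood can do.
      have hcases : E = ∅ ∨ ∀ y ∈ Eᶜ, x * g y ≤ f y := by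
        by_cases hvx : 1 ≤ v * x
        · left
          refine Set.eq_empty_of_forall_notMem fun y hy => ?_
          have hcv : c ≤ v := le_of_mul_le_mul_right (hcx.le.trans hvx) hx0
          refine not_le.2 ((hmem y).1 hy) (max_le ?_ ?_)
          · calc g y ≤ v * x * g y := le_mul_of_one_le_left (hg0 y) hvx
              _ = v * (x * g y) := by ring
              _ ≤ _ := mul_le_mul_of_nonneg_left (le_max_right _ _) hv0.le
          · exact mul_le_mul hcv (le_max_left _ _) (hf0 y) hv0.le
        · right
          intro y hy
          by_contra hlt
          have hlt := not_le.1 hlt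
          have h' := not_lt.1 (fun h => hy ((hmem y).2 h))
          rw [max_eq_right hlt.le] at h'
          have hgp : 0 < g y := (pos_iff_pos_of_mul_pos ((hf0 y).trans_lt hlt)).1 hx0
          nlinarith [le_max_left (g y) (c * f y)]
      rcases hcases with h | h
      · rw [h]; simp
      · have hcompl : Q₀ Eᶜ ≤ Q Eᶜ := by
          obtain ⟨M, -, rfl⟩ := hQ
          have : Q₀ Eᶜ = ENNReal.ofReal (1 - ε₀) * P₀ Eᶜ := by
            conv_rhs => rw [e0]
            rw [hQ₀, withDensity_apply _ hEm.compl, withDensity_apply _ hEm.compl,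
              ← lintegral_const_mul _ hfm.ennreal_ofReal]
            refine setLIntegral_congr_fun hEm.compl fun y hy => ?_
            simp only [hw₀]
            rw [max_eq_left (h y hy), ENNReal.ofReal_mul hε0.le]
          rw [this]
          simp only [Measure.add_apply, Measure.smul_apply, smul_eq_mul]
          exact le_self_add
        rw [prob_compl_eq_one_sub hEm, prob_compl_eq_one_sub hEm] at hcompl
        have := tsub_le_tsub_left hcompl 1
        rwa [ENNReal.sub_sub_cancel ENNReal.one_ne_top prob_le_one,
          ENNReal.sub_sub_cancel ENNReal.one_ne_top prob_le_one] at this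
    · intro Q hQ
      have hQp := isProbabilityMeasure_contaminationNhd h1.le h1'.le hQ
      have hQ₁p := isProbabilityMeasure_contaminationNhd h1.le h1'.le m1
      -- The mirror image: either `t` lies below the bottom clipping level, or on `E` the law `Q₁`
      -- carries no contamination.
      have hcases : E = Set.univ ∨ ∀ y ∈ E, c * f y ≤ g y := by
        by_cases hvc : v < c
        · left
          refine Set.eq_univ_of_forall fun y => (hmem y).2 ?_
          rw [mul_max_of_nonneg _ _ hv0.le]
          refine max_lt ?_ ?_
          · rcases (hf0 y).eq_or_lt with h | h
            · rw [← h, mul_zero]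
              exact lt_max_of_lt_left (by linarith [hfg y])
            · exact lt_max_of_lt_right (mul_lt_mul_of_pos_right hvc h)
          · rcases (hg0 y).eq_or_lt with h | h
            · rw [← h, mul_zero, mul_zero]
              have : f y = 1 := by linarith [hfg y]
              exact lt_max_of_lt_right (by rw [this]; linarith)
            · refine lt_max_of_lt_left ?_
              have : v * x < 1 := (mul_lt_mul_of_pos_right hvc hx0).trans hcx
              nlinarith
        · right
          intro y hy
          by_contra hlt
          have hlt := not_le.1 hlt
          have h' := (hmem y).1 hy
          rw [max_eq_right hlt.le] at h'
          have : v * f y ≤ v * max (f y) (x * g y) :=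
            mul_le_mul_of_nonneg_left (le_max_left _ _) hv0.le
          nlinarith [hf0 y, not_lt.1 hvc]
      rcases hcases with h | h
      · rw [h]; simp
      · obtain ⟨M, -, rfl⟩ := hQ
        have : Q₁ E = ENNReal.ofReal (1 - ε₁) * P₁ E := by
          conv_rhs => rw [e1]
          rw [hQ₁, withDensity_apply _ hEm, withDensity_apply _ hEm,
            ← lintegral_const_mul _ hgm.ennreal_ofReal]
          refine setLIntegral_congr_fun hEm fun y hy => ?_
          simp only [hw₁]
          rw [max_eq_left (h y hy), ENNReal.ofReal_mul hε1.le]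
        rw [this]
        simp only [Measure.add_apply, Measure.smul_apply, smul_eq_mul]
        exact le_self_add

/-- Huber's mass conditions are tested on the set `g > r₁ - r₀` with `c₀ = 1 + (r₁ - r₀)/√n`.
Expanding them in `1/√n`, both reduce to `r₀ < E (g - (r₁ - r₀))₊` at first order, and the strict
inequality absorbs the second order terms. -/
theorem eventually_exists_isLeastFavorablePair {P : Measure Ω} [IsProbabilityMeasure P]
    {Q : ℕ → Measure Ω} (hQ : ∀ᶠ n in atTop, IsProbabilityMeasure (Q n)) {g : Ω → ℝ}
    (hg : Measurable g) (hgL : MemLp g 2 P) (hT : HasTangent P Q g) {r₀ r₁ : ℝ} (hr₀ : 0 < r₀)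
    (hr₁ : 0 < r₁) (hr : r₀ < ∫ x, max (g x - (r₁ - r₀)) 0 ∂P) :
    ∀ᶠ n : ℕ in atTop, ∃ Q₀ Q₁ π, IsLeastFavorablePair (contaminationNhd P (r₀ / √n))
      (contaminationNhd (Q n) (r₁ / √n)) Q₀ Q₁ π := by
  set w := r₁ - r₀ with hw
  set A : Set Ω := {x | w < g x} with hA
  have hAm : MeasurableSet A := measurableSet_lt measurable_const hg
  have hi : Integrable g P := hgL.integrable (by norm_num)
  have hlim := hT.tendsto_sqrt_mul_integral_sub hQ hg hgL (h := A.indicator 1)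
    (measurable_one.indicator hAm) (C := 1) fun x => by
      by_cases h : x ∈ A <;> simp [h]
  have hD : r₀ < ∫ x, A.indicator 1 x * g x ∂P - w * P.real A := by
    have e : ∫ x, max (g x - w) 0 ∂P = ∫ x, A.indicator 1 x * g x ∂P - w * P.real A := by
      have h1 : ∀ x, max (g x - w) 0 = A.indicator 1 x * g x - w * A.indicator (1 : Ω → ℝ) x := by
        intro x
        by_cases h : x ∈ A
        · have : w < g x := h
          simp [h, this.le]
        · have : ¬ w < g x := h
          simp [h, not_lt.1 this]
      simp_rw [h1]
      have hi1 : Integrable (A.indicator (1 : Ω → ℝ)) P :=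
        (integrable_const (1 : ℝ)).indicator hAm
      have hi2 : Integrable (fun x => A.indicator 1 x * g x) P := by
        refine (hi.indicator hAm).congr (.of_forall fun x => ?_)
        by_cases h : x ∈ A <;> simp [h]
      rw [integral_sub hi2 (hi1.const_mul _), integral_const_mul, integral_indicator_one hAm]
    rwa [e] at hr
  set D := ∫ x, A.indicator 1 x * g x ∂P
  set p := P.real A with hp
  have hs := tendsto_inv_sqrt_natCast
  -- the common first order term of both mass conditions
  have hlim0 : Tendsto (fun n : ℕ => (√n * (∫ x, A.indicator 1 x ∂(Q n) - ∫ x, A.indicator 1 x ∂P)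
      - w * p) - r₀ - (√(n : ℝ))⁻¹ * (r₀ * (w * (1 - p) +
        √n * (∫ x, A.indicator 1 x ∂(Q n) - ∫ x, A.indicator 1 x ∂P)))) atTop
      (𝓝 ((D - w * p) - r₀ - 0 * (r₀ * (w * (1 - p) + D)))) :=
    ((hlim.sub_const _).sub_const _).sub (hs.mul ((hlim.const_add _).const_mul _))
  have hlim1 : Tendsto (fun n : ℕ => (√n * (∫ x, A.indicator 1 x ∂(Q n) - ∫ x, A.indicator 1 x ∂P)
      - w * p) - r₀ - (√(n : ℝ))⁻¹ * (r₁ * (w * (1 - p) +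
        √n * (∫ x, A.indicator 1 x ∂(Q n) - ∫ x, A.indicator 1 x ∂P)))) atTop
      (𝓝 ((D - w * p) - r₀ - 0 * (r₁ * (w * (1 - p) + D)))) :=
    ((hlim.sub_const _).sub_const _).sub (hs.mul ((hlim.const_add _).const_mul _))
  have hc : Tendsto (fun n : ℕ => 1 + (√(n : ℝ))⁻¹ * w) atTop (𝓝 (1 + 0 * w)) :=
    (hs.mul_const _).const_add _
  filter_upwards [hQ, hlim0.eventually_const_lt (u := 0) (by linarith),
    hlim1.eventually_const_lt (u := 0) (by linarith), hc.eventually_const_lt (u := 0) (by norm_num),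
    eventually_mul_inv_sqrt_le r₀ (c := 1 / 2) (by norm_num),
    eventually_mul_inv_sqrt_le r₁ (c := 1 / 2) (by norm_num), eventually_gt_atTop 0]
    with n hn e0 e1 ec h0 h1 hn0
  have hsq : 0 < √(n : ℝ) := Real.sqrt_pos.2 (by exact_mod_cast hn0)
  have hac : P.real Aᶜ = 1 - p := by rw [hp, probReal_compl_eq_one_sub hAm]
  have hq : (Q n).real A = p + (√(n : ℝ))⁻¹ *
      (√n * (∫ x, A.indicator 1 x ∂(Q n) - ∫ x, A.indicator 1 x ∂P)) := by
    rw [integral_indicator_one hAm, integral_indicator_one hAm]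
    field_simp
    ring
  set d := √n * (∫ x, A.indicator 1 x ∂(Q n) - ∫ x, A.indicator 1 x ∂P)
  set s := (√(n : ℝ))⁻¹ with hsdef
  have hs0 : 0 < s := inv_pos.2 hsq
  have hm : (1 + s * w) * P.real Aᶜ + (Q n).real A = 1 + s * (w * (1 - p) + d) := by
    rw [hac, hq]; ring
  refine exists_isLeastFavorablePair P (Q n) (c₀ := 1 + s * w) (by positivity)
    (by rw [div_eq_mul_inv]; linarith) (by positivity) (by rw [div_eq_mul_inv]; linarith) ec hAm
    ?_ ?_ <;> rw [hm, div_eq_mul_inv, ← hsdef]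
  · have := mul_pos hs0 e0
    linarith
  · have := mul_pos hs0 e1
    have hw' : r₀ = r₁ - w := by rw [hw]; ring
    rw [hw'] at this
    linarith

/-! ### Robust tests exist -/

/-- At an upper quantile `k` the level lies between the probabilities of `T > k` and `T ≥ k`; a
constant randomization on `T = k` fills the difference. -/
theorem exists_randomized_test {X : Type*} [MeasurableSpace X] (Q : Measure X)
    [IsProbabilityMeasure Q] {T : X → ℝ≥0∞} (hT : Measurable T) {α : ℝ} (h0 : 0 ≤ α)
    (h1 : α ≤ 1) : ∃ (k : ℝ≥0∞) (φ : X → ℝ), Measurable φ ∧ (∀ x, φ x ∈ Set.Icc (0 : ℝ) 1) ∧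
      (∀ x, (k < T x → φ x = 1) ∧ (T x < k → φ x = 0)) ∧
      ∫⁻ x, ENNReal.ofReal (φ x) ∂Q = ENNReal.ofReal α := by
  have i1 : IsProbabilityMeasure (Q.map T) := Measure.isProbabilityMeasure_map hT.aemeasurable
  obtain ⟨k, hk1, hk2⟩ := exists_quantile (Q.map T) (α := ENNReal.ofReal α)
    (ENNReal.ofReal_le_one.2 h1)
  rw [Measure.map_apply hT measurableSet_Ioi] at hk1
  rw [Measure.map_apply hT measurableSet_Ici] at hk2
  set A : Set X := {x | k < T x}
  set B : Set X := {x | T x = k}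
  have hA : MeasurableSet A := measurableSet_lt measurable_const hT
  have hB : MeasurableSet B := hT (measurableSet_singleton k)
  have hAB : Disjoint A B := Set.disjoint_left.2 fun x (h : k < T x) (h' : T x = k) => h.ne' h'
  have hU : T ⁻¹' Set.Ici k = A ∪ B := by
    ext x
    simp only [Set.mem_preimage, Set.mem_Ici, Set.mem_union, A, B, Set.mem_ofPred_eq]
    rw [le_iff_lt_or_eq, eq_comm]
  rw [hU, measure_union hAB hB] at hk2
  have ha : Q.real A ≤ α := ENNReal.toReal_le_of_le_ofReal h0 hk1
  have hb : α ≤ Q.real A + Q.real B := by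
    have := ENNReal.toReal_mono (by finiteness) hk2
    rwa [ENNReal.toReal_ofReal h0, ENNReal.toReal_add (by finiteness) (by finiteness)] at this
  obtain ⟨γ, hγ0, hγ1, hγ⟩ : ∃ γ : ℝ, 0 ≤ γ ∧ γ ≤ 1 ∧ Q.real A + γ * Q.real B = α := by
    rcases (measureReal_nonneg (μ := Q) (s := B)).eq_or_lt with h | h
    · exact ⟨0, le_rfl, zero_le_one, by linarith⟩
    · refine ⟨(α - Q.real A) / Q.real B, div_nonneg (by linarith) h.le,
        (div_le_one h).2 (by linarith), ?_⟩
      rw [div_mul_cancel₀ _ h.ne']; ring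
  refine ⟨k, fun x => A.indicator 1 x + γ * B.indicator 1 x, ?_, fun x => ?_, fun x => ⟨?_, ?_⟩, ?_⟩
  · exact (measurable_one.indicator hA).add ((measurable_one.indicator hB).const_mul γ)
  · by_cases hxA : x ∈ A
    · simp [hxA, Set.disjoint_left.1 hAB hxA]
    · by_cases hxB : x ∈ B <;> simp [hxA, hxB, hγ0, hγ1]
  · intro hx
    have hxA : x ∈ A := hx
    simp [hxA, Set.disjoint_left.1 hAB hxA]
  · intro hx
    have hxA : x ∉ A := fun h => lt_asymm (show k < T x from h) hx
    have hxB : x ∉ B := fun h => hx.ne h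
    simp [hxA, hxB]
  · have e : ∀ x, ENNReal.ofReal (A.indicator 1 x + γ * B.indicator 1 x) =
        A.indicator 1 x + ENNReal.ofReal γ * B.indicator 1 x := by
      intro x
      by_cases hxA : x ∈ A
      · simp [hxA, Set.disjoint_left.1 hAB hxA]
      · by_cases hxB : x ∈ B <;> simp [hxA, hxB]
    simp_rw [e]
    rw [lintegral_add_left (measurable_one.indicator hA), lintegral_const_mul _
      (measurable_one.indicator hB), lintegral_indicator_one hA, lintegral_indicator_one hB,
      ← ofReal_measureReal (by finiteness), ← ofReal_measureReal (by finiteness),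
      ← ENNReal.ofReal_mul hγ0,
      ← ENNReal.ofReal_add measureReal_nonneg (mul_nonneg hγ0 measureReal_nonneg), hγ]

theorem exists_isRobustAsyTest {𝒬₀ 𝒬₁ : ℕ → Set (Measure Ω)}
    (hp : ∀ᶠ n in atTop, ∀ Q ∈ 𝒬₀ n, IsProbabilityMeasure Q)
    (h : ∀ᶠ n in atTop, ∃ Q₀ Q₁ π, IsLeastFavorablePair (𝒬₀ n) (𝒬₁ n) Q₀ Q₁ π) {α : ℝ}
    (h0 : 0 ≤ α) (h1 : α ≤ 1) : ∃ φ : TestSeq Ω, IsRobustAsyTest 𝒬₀ 𝒬₁ α φ := by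
  -- Everything is packaged per sample size, so that one choice gives all sequences. Where the
  -- assumptions fail, zeros serve as placeholders.
  have key : ∀ n, ∃ (Q₀ Q₁ : Measure Ω) (π : Ω → ℝ≥0∞) (k : ℝ≥0∞) (φ : (Fin n → Ω) → ℝ),
      (Measurable φ ∧ ∀ x, φ x ∈ Set.Icc (0 : ℝ) 1) ∧ (((∀ Q ∈ 𝒬₀ n, IsProbabilityMeasure Q) ∧
        ∃ Q₀ Q₁ π, IsLeastFavorablePair (𝒬₀ n) (𝒬₁ n) Q₀ Q₁ π) →
        IsLeastFavorablePair (𝒬₀ n) (𝒬₁ n) Q₀ Q₁ π ∧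
        (∀ x, (k < ∏ i, π (x i) → φ x = 1) ∧ (∏ i, π (x i) < k → φ x = 0)) ∧
        rejectionProb φ Q₀ = ENNReal.ofReal α) := by
    intro n
    by_cases hn : (∀ Q ∈ 𝒬₀ n, IsProbabilityMeasure Q) ∧
        ∃ Q₀ Q₁ π, IsLeastFavorablePair (𝒬₀ n) (𝒬₁ n) Q₀ Q₁ π
    · obtain ⟨hp, Q₀, Q₁, π, hL⟩ := hn
      have := hp Q₀ hL.1
      have hπ : Measurable π := hL.2.2.1
      obtain ⟨k, φ, hφ, hφ01, hφk, hφα⟩ := exists_randomized_test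
        (Measure.pi fun _ : Fin n => Q₀) (T := fun x => ∏ i, π (x i)) (by fun_prop) h0 h1
      exact ⟨Q₀, Q₁, π, k, φ, ⟨hφ, hφ01⟩, fun _ => ⟨hL, hφk, hφα⟩⟩
    · exact ⟨0, 0, 0, 0, 0, ⟨measurable_const, fun x => by simp⟩, fun h => absurd h hn⟩
  choose Q₀ Q₁ π k φ hφ hk using key
  refine ⟨φ, hφ, Q₀, Q₁, π, k, ?_, ?_, ?_⟩
  · filter_upwards [hp, h] with n h1 h2 using (hk n ⟨h1, h2⟩).1
  · filter_upwards [hp, h] with n h1 h2 using (hk n ⟨h1, h2⟩).2.1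
  · refine tendsto_const_nhds.congr' ?_
    filter_upwards [hp, h] with n h1 h2 using (hk n ⟨h1, h2⟩).2.2.symm

/-! ### Likelihood ratio tests of least favorable pairs -/

theorem rejectionProb_eq_ofReal_power {n : ℕ} {ψ : (Fin n → Ω) → ℝ} (hψ : Measurable ψ)
    (h01 : ∀ x, ψ x ∈ Set.Icc (0 : ℝ) 1) (Q : Measure Ω) [IsProbabilityMeasure Q] :
    rejectionProb ψ Q = ENNReal.ofReal (power ψ Q) :=
  (ofReal_integral_eq_lintegral_ofReal (integrable_test hψ h01 _)
    (ae_of_all _ fun x => (h01 x).1)).symm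

/-- The Neyman-Pearson lemma for products. -/
theorem power_sub_le_of_likelihoodRatio {n : ℕ} {Q₀ : Measure Ω} [IsProbabilityMeasure Q₀]
    {π : Ω → ℝ≥0∞} (hπ : Measurable π) [IsProbabilityMeasure (Q₀.withDensity π)] {k : ℝ≥0∞}
    (hk : k ≠ ∞) {χ ψ : (Fin n → Ω) → ℝ} (hχ : Measurable χ) (hχ01 : ∀ x, χ x ∈ Set.Icc (0 : ℝ) 1)
    (hχ1 : ∀ x, k < ∏ i, π (x i) → χ x = 1) (hχ0 : ∀ x, ∏ i, π (x i) < k → χ x = 0)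
    (hψ : Measurable ψ) (hψ01 : ∀ x, ψ x ∈ Set.Icc (0 : ℝ) 1) :
    power ψ (Q₀.withDensity π) - power χ (Q₀.withDensity π) ≤
      k.toReal * (power ψ Q₀ - power χ Q₀) := by
  set Q₁ := Q₀.withDensity π with hQ₁
  have hLm : Measurable fun x : Fin n → Ω => ∏ i, π (x i) := by fun_prop
  have hrej : ∀ ξ : (Fin n → Ω) → ℝ, Measurable ξ → rejectionProb ξ Q₁ =
      ∫⁻ x, (∏ i, π (x i)) * ENNReal.ofReal (ξ x) ∂(Measure.pi fun _ : Fin n => Q₀) := by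
    intro ξ hξ
    rw [rejectionProb, hQ₁, pi_withDensity n Q₀ hπ, lintegral_withDensity_eq_lintegral_mul _ hLm
      hξ.ennreal_ofReal]
    rfl
  have key : rejectionProb ψ Q₁ + k * rejectionProb χ Q₀ ≤
      rejectionProb χ Q₁ + k * rejectionProb ψ Q₀ := by
    rw [hrej ψ hψ, hrej χ hχ, rejectionProb, rejectionProb, ← lintegral_const_mul _
      hχ.ennreal_ofReal, ← lintegral_const_mul _ hψ.ennreal_ofReal,
      ← lintegral_add_left (show Measurable fun x => (∏ i, π (x i)) * ENNReal.ofReal (ψ x) from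
        hLm.mul hψ.ennreal_ofReal),
      ← lintegral_add_left (show Measurable fun x => (∏ i, π (x i)) * ENNReal.ofReal (χ x) from
        hLm.mul hχ.ennreal_ofReal)]
    refine lintegral_mono fun x => ?_
    -- Pointwise this is `(L - k)(χ - ψ) ≥ 0`, rearranged into sums since `L` may be infinite and
    -- subtraction in `[0, ∞]` is truncated.
    rcases lt_trichotomy k (∏ i, π (x i)) with h | h | h
    · simp only [hχ1 x h, ENNReal.ofReal_one, mul_one]
      generalize (∏ i, π (x i)) = L at h
      rcases eq_or_ne L ∞ with hL | hL
      · simp [hL]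
      · lift L to NNReal using hL
        lift k to NNReal using hk
        have hx := hψ01 x
        lift ψ x to NNReal using hx.1 with y
        rw [ENNReal.ofReal_coe_nnreal]
        norm_cast at h hx ⊢
        have h' : (k : ℝ) < L := h
        have hy : (y : ℝ) ≤ 1 := hx.2
        rw [← NNReal.coe_le_coe]
        push_cast
        nlinarith
    · rw [← h, add_comm]
    · simp only [hχ0 x h, ENNReal.ofReal_zero, mul_zero, add_zero, zero_add]
      gcongr
  rw [rejectionProb_eq_ofReal_power hψ hψ01, rejectionProb_eq_ofReal_power hχ hχ01,
    rejectionProb_eq_ofReal_power hψ hψ01, rejectionProb_eq_ofReal_power hχ hχ01] at key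
  lift k to NNReal using hk
  have p1 := power_nonneg hψ01 Q₁
  have p2 := power_nonneg hχ01 Q₁
  have p3 := power_nonneg hψ01 Q₀
  have p4 := power_nonneg hχ01 Q₀
  have hk0 : (0 : ℝ) ≤ k := k.2
  rw [← ENNReal.ofReal_coe_nnreal, ← ENNReal.ofReal_mul hk0, ← ENNReal.ofReal_mul hk0,
    ← ENNReal.ofReal_add p1 (mul_nonneg hk0 p4), ← ENNReal.ofReal_add p2 (mul_nonneg hk0 p3),
    ENNReal.ofReal_le_ofReal_iff (add_nonneg p2 (mul_nonneg hk0 p3))] at key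
  simp only [ENNReal.coe_toReal]
  linarith

/-- Markov's inequality for the likelihood ratio, whose mean is one: tests with size bounded away
from zero have bounded critical values. -/
theorem mul_measure_pi_le_one {n : ℕ} {Q₀ : Measure Ω} [IsProbabilityMeasure Q₀]
    {π : Ω → ℝ≥0∞} (hπ : Measurable π) [IsProbabilityMeasure (Q₀.withDensity π)] (k : ℝ≥0∞) :
    k * (Measure.pi fun _ : Fin n => Q₀) {x | k ≤ ∏ i, π (x i)} ≤ 1 := by
  have hLm : Measurable fun x : Fin n → Ω => ∏ i, π (x i) := by fun_prop
  calc k * (Measure.pi fun _ : Fin n => Q₀) {x | k ≤ ∏ i, π (x i)}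
      ≤ ∫⁻ x, ∏ i, π (x i) ∂(Measure.pi fun _ : Fin n => Q₀) :=
        mul_meas_ge_le_lintegral hLm k
    _ = (Measure.pi fun _ : Fin n => Q₀.withDensity π) Set.univ := by
        rw [pi_withDensity n Q₀ hπ, withDensity_apply _ .univ, setLIntegral_univ]
    _ = 1 := measure_univ

/-- Neighborhoods in which `W₀`, `W₁` are extremal for the threshold tests based on `b`. -/
structure ExtremalPair (b : Ω → ℝ) (𝒬₀ 𝒬₁ : ℕ → Set (Measure Ω)) (W₀ W₁ : ℕ → Measure Ω) :
    Prop where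
  prob₀ : ∀ᶠ n in atTop, ∀ Q ∈ 𝒬₀ n, IsProbabilityMeasure Q
  prob₁ : ∀ᶠ n in atTop, ∀ Q ∈ 𝒬₁ n, IsProbabilityMeasure Q
  mem₀ : ∀ᶠ n in atTop, W₀ n ∈ 𝒬₀ n
  mem₁ : ∀ᶠ n in atTop, W₁ n ∈ 𝒬₁ n
  le₀ : ∀ᶠ n in atTop, ∀ Q ∈ 𝒬₀ n, ∀ t,
    power (thresholdTest b t n) Q ≤ power (thresholdTest b t n) (W₀ n)
  ge₁ : ∀ᶠ n in atTop, ∀ Q ∈ 𝒬₁ n, ∀ t,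
    power (thresholdTest b t n) (W₁ n) ≤ power (thresholdTest b t n) Q

theorem normalCdf_pos (x : ℝ) : 0 < normalCdf x :=
  (cdf_nonneg _ (x - 1)).trans_lt (normalCdf_strictMono (by linarith))

theorem normalCdf_lt_one (x : ℝ) : normalCdf x < 1 :=
  (normalCdf_strictMono (by linarith : x < x + 1)).trans_le (cdf_le_one _ _)

/-- Along an ultrafilter all bounded quantities converge at once, which replaces repeated passage to
subsequences. -/
theorem exists_tendsto_ultrafilter (l : Ultrafilter ℕ) {f : ℕ → ℝ}
    (h : ∀ᶠ n in l, f n ∈ Set.Icc (0 : ℝ) 1) :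
    ∃ a ∈ Set.Icc (0 : ℝ) 1, Tendsto f l (𝓝 a) :=
  isCompact_Icc.ultrafilter_le_nhds (l.map f) (le_principal_iff.2 h)

theorem isUpperSet_le_prod (n : ℕ) (k : ℝ≥0∞) :
    IsUpperSet {y : Fin n → ℝ≥0∞ | k ≤ ∏ i, y i} := fun _ _ hy h =>
  le_trans h (Finset.prod_le_prod' fun i _ => hy i)

theorem isUpperSet_lt_prod (n : ℕ) (k : ℝ≥0∞) :
    IsUpperSet {y : Fin n → ℝ≥0∞ | k < ∏ i, y i} := fun _ _ hy h =>
  lt_of_lt_of_le h (Finset.prod_le_prod' fun i _ => hy i)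

/-- The likelihood ratio test randomizing evenly at the critical value. -/
noncomputable def midTest {X : Type*} (π : X → ℝ≥0∞) (k : ℝ≥0∞) {n : ℕ} (x : Fin n → X) : ℝ :=
  ({x : Fin n → X | k < ∏ i, π (x i)}.indicator 1 x +
    {x : Fin n → X | k ≤ ∏ i, π (x i)}.indicator 1 x) / 2

section MidTest

variable {π : Ω → ℝ≥0∞} {k : ℝ≥0∞} {n : ℕ}

theorem midTest_of_lt {X : Type*} {π : X → ℝ≥0∞} {x : Fin n → X}
    (h : k < ∏ i, π (x i)) : midTest π k x = 1 := by
  rw [midTest, Set.indicator_of_mem (by exact h), Set.indicator_of_mem (by exact h.le)]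
  norm_num

theorem midTest_of_gt {X : Type*} {π : X → ℝ≥0∞} {x : Fin n → X}
    (h : ∏ i, π (x i) < k) : midTest π k x = 0 := by
  rw [midTest, Set.indicator_of_notMem (by exact not_lt.2 h.le),
    Set.indicator_of_notMem (by exact not_le.2 h)]
  norm_num

theorem midTest_of_eq {X : Type*} {π : X → ℝ≥0∞} {x : Fin n → X}
    (h : ∏ i, π (x i) = k) : midTest π k x = 1 / 2 := by
  rw [midTest, Set.indicator_of_notMem (by exact h.not_gt),
    Set.indicator_of_mem (by exact h.ge)]
  norm_num

theorem midTest_mem {X : Type*} {π : X → ℝ≥0∞} (x : Fin n → X) :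
    midTest π k x ∈ Set.Icc (0 : ℝ) 1 := by
  rcases lt_trichotomy k (∏ i, π (x i)) with h | h | h
  · rw [midTest_of_lt h]; simp
  · rw [midTest_of_eq h.symm]; norm_num
  · rw [midTest_of_gt h]; simp

theorem measurableSet_lt_prod (hπ : Measurable π) (k : ℝ≥0∞) (n : ℕ) :
    MeasurableSet {x : Fin n → Ω | k < ∏ i, π (x i)} :=
  measurableSet_lt measurable_const (by fun_prop)

theorem measurableSet_le_prod (hπ : Measurable π) (k : ℝ≥0∞) (n : ℕ) :
    MeasurableSet {x : Fin n → Ω | k ≤ ∏ i, π (x i)} :=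
  measurableSet_le measurable_const (by fun_prop)

theorem measurable_midTest (hπ : Measurable π) (k : ℝ≥0∞) (n : ℕ) :
    Measurable (midTest π k : (Fin n → Ω) → ℝ) :=
  ((measurable_one.indicator (measurableSet_lt_prod hπ k n)).add
    (measurable_one.indicator (measurableSet_le_prod hπ k n))).div_const 2

theorem power_midTest (hπ : Measurable π) (k : ℝ≥0∞) (n : ℕ) (Q : Measure Ω)
    [IsProbabilityMeasure Q] : power (midTest π k : (Fin n → Ω) → ℝ) Q =
      ((Measure.pi fun _ : Fin n => Q).real {x | k < ∏ i, π (x i)} +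
        (Measure.pi fun _ : Fin n => Q).real {x | k ≤ ∏ i, π (x i)}) / 2 := by
  unfold power midTest
  rw [integral_div, integral_add
    (show Integrable ({x : Fin n → Ω | k < ∏ i, π (x i)}.indicator 1) _ from
      (integrable_const (1 : ℝ)).indicator (measurableSet_lt_prod hπ k n))
    (show Integrable ({x : Fin n → Ω | k ≤ ∏ i, π (x i)}.indicator 1) _ from
      (integrable_const (1 : ℝ)).indicator (measurableSet_le_prod hπ k n)),
    integral_indicator_one (measurableSet_lt_prod hπ k n),
    integral_indicator_one (measurableSet_le_prod hπ k n)]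

theorem measureReal_lt_prod_mono (hπ : Measurable π) {Q Q' : Measure Ω} [IsProbabilityMeasure Q]
    [IsProbabilityMeasure Q'] (h : ∀ t, 0 < t → t < ∞ → Q {x | t < π x} ≤ Q' {x | t < π x})
    (k : ℝ≥0∞) (n : ℕ) : (Measure.pi fun _ : Fin n => Q).real {x | k < ∏ i, π (x i)} ≤
      (Measure.pi fun _ : Fin n => Q').real {x | k < ∏ i, π (x i)} :=
  ENNReal.toReal_mono (measure_ne_top _ _) (measure_pi_comp_le_of_isUpperSet hπ
    (fun _ hU hUm => measure_preimage_le_of_forall_lt hπ h hU hUm) n (isUpperSet_lt_prod n k)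
    (measurableSet_lt measurable_const (by fun_prop)))

theorem power_midTest_mono (hπ : Measurable π) {Q Q' : Measure Ω} [IsProbabilityMeasure Q]
    [IsProbabilityMeasure Q'] (h : ∀ t, 0 < t → t < ∞ → Q {x | t < π x} ≤ Q' {x | t < π x})
    (k : ℝ≥0∞) (n : ℕ) :
    power (midTest π k : (Fin n → Ω) → ℝ) Q ≤ power (midTest π k : (Fin n → Ω) → ℝ) Q' := by
  rw [power_midTest hπ, power_midTest hπ]
  have h1 := measureReal_lt_prod_mono hπ h k n
  have h2 : (Measure.pi fun _ : Fin n => Q).real {x | k ≤ ∏ i, π (x i)} ≤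
      (Measure.pi fun _ : Fin n => Q').real {x | k ≤ ∏ i, π (x i)} :=
    ENNReal.toReal_mono (measure_ne_top _ _) (measure_pi_comp_le_of_isUpperSet hπ
      (fun _ hU hUm => measure_preimage_le_of_forall_lt hπ h hU hUm) n (isUpperSet_le_prod n k)
      (measurableSet_le measurable_const (by fun_prop)))
  linarith

/-- At the critical value the even randomization is at distance `1/2` from both `0` and `1`. If
`midTest` is close to a nonrandomized test, the critical value is therefore hit rarely, and every
other randomization is close to that test as well. -/
theorem half_le_of_ne_midTest {X : Type*} {π : X → ℝ≥0∞} {x : Fin n → X} {d e : ℝ}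
    (hd : d = 0 ∨ d = 1)
    (h1 : k < ∏ i, π (x i) → e = 1) (h0 : ∏ i, π (x i) < k → e = 0) (hne : e ≠ d) :
    1 / 2 ≤ |midTest π k x - d| := by
  rcases lt_trichotomy k (∏ i, π (x i)) with h | h | h
  · rw [midTest_of_lt h]
    rcases hd with rfl | rfl
    · norm_num
    · exact absurd (h1 h) hne
  · rw [midTest_of_eq h.symm]
    rcases hd with rfl | rfl <;> norm_num [abs_of_pos, abs_of_neg]
  · rw [midTest_of_gt h]
    rcases hd with rfl | rfl
    · exact absurd (h0 h) hne
    · norm_num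

end MidTest

theorem thresholdTest_eq_zero_or_one {X : Type*} (b : X → ℝ) (t : ℝ) (n : ℕ) (x : Fin n → X) :
    thresholdTest b t n x = 0 ∨ thresholdTest b t n x = 1 := by
  rcases lt_or_ge t (scaledSum b x) with h | h
  · exact Or.inr (thresholdTest_of_lt h)
  · exact Or.inl (thresholdTest_of_le h)

namespace TiltData

variable {P : Measure Ω} [IsProbabilityMeasure P] {q b : Ω → ℝ} {r C σ : ℝ}

/-- Likelihood ratio tests of least favorable pairs whose size tends to `α` coincide asymptotically
with the asymptotic Neyman-Pearson test. -/
theorem tendsto_of_isRobustAsyTest (D : TiltData P q b r C σ) (u : ℝ)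
    {𝒬₀ 𝒬₁ : ℕ → Set (Measure Ω)} {W₁ : ℕ → Measure Ω}
    (hW : ExtremalPair b 𝒬₀ 𝒬₁ (linearLaw P q) W₁) (hT₁ : HasTangent P W₁ (fun x => q x + b x))
    {φ : TestSeq Ω} (hφ : IsRobustAsyTest 𝒬₀ 𝒬₁ (normalCdf (-u)) φ) {η : ℝ} (hη : 0 < η) :
    Tendsto (fun n => (Measure.pi fun _ : Fin n => P).real {x | η ≤ |φ n x - D.npTest u n x|})
      atTop (𝓝 0) := by
  obtain ⟨hφt, Q₀, Q₁, π', k, hL, hk, hα⟩ := hφ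
  set α := normalCdf (-u) with hαdef
  have hα0 : 0 < α := normalCdf_pos _
  have hα1 : α < 1 := normalCdf_lt_one _
  classical
  -- The given ratios are known to be measurable only for large `n`; elsewhere zero is used.
  set π : ℕ → Ω → ℝ≥0∞ := fun n => if Measurable (π' n) then π' n else 0 with hπdef
  have hπm : ∀ n, Measurable (π n) := fun n => by
    simp only [hπdef]; split_ifs with h
    · exact h
    · exact measurable_const
  have hππ : ∀ᶠ n in atTop, π' n = π n := by
    filter_upwards [hL] with n hn
    simp only [hπdef]; rw [if_pos hn.2.2.1]
  have hW₁p : ∀ᶠ n in atTop, IsProbabilityMeasure (W₁ n) := by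
    filter_upwards [hW.prob₁, hW.mem₁] with n h1 h2 using h1 _ h2
  -- the facts at a fixed large sample size
  have hfix : ∀ᶠ n in atTop, IsProbabilityMeasure (Q₀ n) ∧ IsProbabilityMeasure (Q₁ n) ∧
      Q₁ n = (Q₀ n).withDensity (π n) ∧
      (∀ t, 0 < t → t < ∞ → linearLaw P q n {x | t < π n x} ≤ Q₀ n {x | t < π n x}) ∧
      (∀ t, 0 < t → t < ∞ → Q₁ n {x | t < π n x} ≤ W₁ n {x | t < π n x}) ∧
      (∀ t, power (thresholdTest b t n) (Q₀ n) ≤ power (thresholdTest b t n) (linearLaw P q n)) ∧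
      (∀ t, power (thresholdTest b t n) (W₁ n) ≤ power (thresholdTest b t n) (Q₁ n)) ∧
      (∀ x : Fin n → Ω, (k n < ∏ i, π n (x i) → φ n x = 1) ∧
        (∏ i, π n (x i) < k n → φ n x = 0)) := by
    filter_upwards [hL, hk, hππ, hW.prob₀, hW.prob₁, hW.mem₀, hW.mem₁, hW.le₀, hW.ge₁]
      with n h1 h2 h3 h4 h5 h6 h7 h8 h9
    rw [h3] at h1
    obtain ⟨m0, m1, -, e, ho⟩ := h1
    refine ⟨h4 _ m0, h5 _ m1, e, fun t h0 ht => (ho t h0 ht).1 _ h6,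
      fun t h0 ht => (ho t h0 ht).2 _ h7, h8 _ m0, h9 _ m1, ?_⟩
    rw [← h3]; exact h2
  have hαr : Tendsto (fun n => power (φ n) (Q₀ n)) atTop (𝓝 α) := by
    have := (ENNReal.tendsto_toReal ENNReal.ofReal_ne_top).comp hα
    rw [ENNReal.toReal_ofReal hα0.le] at this
    refine this.congr' ?_
    filter_upwards [hfix] with n hn
    have := hn.1
    simp only [Function.comp_apply]
    rw [rejectionProb_eq_ofReal_power (hφt n).1 (hφt n).2,
      ENNReal.toReal_ofReal (power_nonneg (hφt n).2 _)]
  set a : ℕ → ℝ := fun n => (Measure.pi fun _ : Fin n => Q₀ n).real {x | k n < ∏ i, π n (x i)}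
  set c : ℕ → ℝ := fun n => (Measure.pi fun _ : Fin n => Q₀ n).real {x | k n ≤ ∏ i, π n (x i)}
  have hac : ∀ᶠ n in atTop, a n ≤ power (φ n) (Q₀ n) ∧ power (φ n) (Q₀ n) ≤ c n := by
    filter_upwards [hfix] with n ⟨i0, _, _, _, _, _, _, hn⟩
    have hi := integrable_test (hφt n).1 (hφt n).2 (Measure.pi fun _ : Fin n => Q₀ n)
    constructor
    · simp only [a]
      rw [← integral_indicator_one (measurableSet_lt_prod (hπm n) (k n) n)]
      refine integral_mono ((integrable_const (1 : ℝ)).indicator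
        (measurableSet_lt_prod (hπm n) (k n) n)) hi fun x => ?_
      refine Set.indicator_apply_le' (fun hx => ?_) fun _ => ((hφt n).2 x).1
      rw [(hn x).1 hx]; rfl
    · simp only [c]
      rw [← integral_indicator_one (measurableSet_le_prod (hπm n) (k n) n)]
      refine integral_mono hi ((integrable_const (1 : ℝ)).indicator
        (measurableSet_le_prod (hπm n) (k n) n)) fun x => ?_
      refine Set.le_indicator_apply (fun _ => ((hφt n).2 x).2) fun hx => ?_
      rw [(hn x).2 (not_le.1 hx)]
  -- The weak rejection region has probability above `α/2` eventually, so critical values are at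
  -- most `2/α`.
  have hk : ∀ᶠ n in atTop, k n ≠ ∞ ∧ (k n).toReal ≤ 2 / α := by
    filter_upwards [hfix, hac, hαr.eventually_const_lt (half_lt_self hα0)]
      with n ⟨i0, i1, e, _⟩ h1 h2
    rw [e] at i1
    have hle := mul_measure_pi_le_one (n := n) (hπm n) (Q₀ := Q₀ n) (k n)
    have hc : α / 2 < c n := h2.trans_le h1.2
    have hkt : k n ≠ ∞ := by
      intro ht
      have hne : (Measure.pi fun _ : Fin n => Q₀ n) {x | k n ≤ ∏ i, π n (x i)} ≠ 0 := by
        intro h0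
        have : c n = 0 := by simp only [c, measureReal_def, h0, ENNReal.toReal_zero]
        linarith
      rw [ht] at hle hne
      rw [ENNReal.top_mul hne] at hle
      simp at hle
    refine ⟨hkt, ?_⟩
    have := ENNReal.toReal_mono ENNReal.one_ne_top hle
    rw [ENNReal.toReal_mul, ENNReal.toReal_one] at this
    have h3 : (k n).toReal * c n ≤ 1 := this
    rw [le_div_iff₀ hα0]
    nlinarith [ENNReal.toReal_nonneg (a := k n)]
  rw [tendsto_iff_ultrafilter]
  intro l hl
  have hIcc : ∀ A : (n : ℕ) → Set (Fin n → Ω), ∀ᶠ n in (l : Filter ℕ),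
      (Measure.pi fun _ : Fin n => Q₀ n).real (A n) ∈ Set.Icc (0 : ℝ) 1 := fun A => by
    filter_upwards [hl hfix] with n hn
    have := hn.1
    exact ⟨measureReal_nonneg, measureReal_le_one⟩
  obtain ⟨a', ha', hlima⟩ := exists_tendsto_ultrafilter l
    (hIcc fun n => {x | k n < ∏ i, π n (x i)})
  obtain ⟨c', hc', hlimc⟩ := exists_tendsto_ultrafilter l
    (hIcc fun n => {x | k n ≤ ∏ i, π n (x i)})
  have haα : a' ≤ α := le_of_tendsto_of_tendsto hlima (hαr.mono_left hl) (by
    filter_upwards [hl hac] with n hn using hn.1)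
  have hcα : α ≤ c' := le_of_tendsto_of_tendsto (hαr.mono_left hl) hlimc (by
    filter_upwards [hl hac] with n hn using hn.2)
  -- `Φ(-v)` is the limiting size of the evenly randomized test. It need not be `α` a priori, since
  -- the critical value might carry mass; `a' ≤ α ≤ c'` keeps it strictly between `0` and `1`.
  obtain ⟨v, hv⟩ := exists_normalCdf_eq (a := (a' + c') / 2) (by linarith [ha'.1])
    (by linarith [hc'.2])
  set χ : TestSeq Ω := fun n => midTest (π n) (k n)
  have hχ : IsTest χ := fun n => ⟨measurable_midTest (hπm n) (k n) n, midTest_mem⟩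
  have hχ₀ : Tendsto (fun n => power (χ n) (Q₀ n)) l (𝓝 (normalCdf (-v))) := by
    rw [hv]
    refine ((hlima.add hlimc).div_const 2).congr' ?_
    filter_upwards [hl hfix] with n hn
    have := hn.1
    exact (power_midTest (hπm n) (k n) n (Q₀ n)).symm
  have hW₀lim := (D.tendsto_power_npTest_null v D.prob D.tangent).mono_left hl
  have hW₁lim := (D.tendsto_power_npTest_alt v hW₁p hT₁).mono_left hl
  -- A lower bound for the Lagrangian of `χ` under the extremal laws. The absolute difference
  -- vanishes in the limit because `v` matches the sizes.
  have hlow : Tendsto (fun n => power (D.npTest v n) (W₁ n) - 2 / α *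
      |power (D.npTest v n) (linearLaw P q n) - power (χ n) (Q₀ n)| -
        D.crit v * power (χ n) (Q₀ n)) l
      (𝓝 (normalCdf (-v + σ) - 2 / α * |normalCdf (-v) - normalCdf (-v)| -
        D.crit v * normalCdf (-v))) :=
    (hW₁lim.sub ((hW₀lim.sub hχ₀).abs.const_mul _)).sub (hχ₀.const_mul _)
  rw [sub_self, abs_zero, mul_zero, sub_zero] at hlow
  have hcrit : 0 < D.crit v := Real.exp_pos _
  -- The evenly randomized test is monotone in the stochastic order, so `Q₀`, `Q₁` being least
  -- favorable bounds its size and power under `linearLaw`, `W₁` by those under `Q₀`, `Q₁`. The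
  -- Neyman-Pearson lemma between `Q₀` and `Q₁` compares it with `npTest`, and extremality of
  -- `linearLaw`, `W₁` for the score leads back.
  have hmain := fun {η : ℝ} (hη : 0 < η) => D.tendsto_of_lagrangian_ge v D.prob D.tangent hW₁p hT₁
    hl hχ (fun ε hε => by
      filter_upwards [hlow.eventually_const_lt (sub_lt_self _ hε), hl hfix, hl hk, hl hW₁p,
        hl D.prob] with n h1 ⟨i0, i1, e, s0, s1, t0, t1, _⟩ ⟨hk1, hk2⟩ i2 i3
      have m0 := power_midTest_mono (hπm n) s0 (k n) n
      have m1 := power_midTest_mono (hπm n) s1 (k n) n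
      have hnp : power (D.npTest v n) (Q₁ n) - power (χ n) (Q₁ n) ≤
          (k n).toReal * (power (D.npTest v n) (Q₀ n) - power (χ n) (Q₀ n)) := by
        rw [e] at i1 ⊢
        exact power_sub_le_of_likelihoodRatio (hπm n) hk1 (hχ n).1 (hχ n).2
          (fun x => midTest_of_lt) (fun x => midTest_of_gt) (D.isTest_npTest v n).1
          (D.isTest_npTest v n).2
      have t0 := t0 (D.threshold v)
      have t1 := t1 (D.threshold v)
      have hkx : (k n).toReal * (power (D.npTest v n) (Q₀ n) - power (χ n) (Q₀ n)) ≤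
          2 / α * |power (D.npTest v n) (linearLaw P q n) - power (χ n) (Q₀ n)| := by
        refine (mul_le_mul_of_nonneg_left ?_ ENNReal.toReal_nonneg).trans
          (mul_le_mul_of_nonneg_right hk2 (abs_nonneg _))
        exact (sub_le_sub_right t0 _).trans (le_abs_self _)
      have := mul_le_mul_of_nonneg_left m0 hcrit.le
      change power (thresholdTest b (D.threshold v) n) (W₁ n) ≤ power (D.npTest v n) (Q₁ n) at t1
      have t1' : power (D.npTest v n) (W₁ n) ≤ power (D.npTest v n) (Q₁ n) := t1
      change D.crit v * power (χ n) (linearLaw P q n) ≤ D.crit v * power (χ n) (Q₀ n) at this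
      change power (χ n) (Q₁ n) ≤ power (χ n) (W₁ n) at m1
      linarith) hη
  have hhalf := hmain (η := 1 / 2) (by norm_num)
  -- the level of the strict test
  have hlev : normalCdf (-v) ≤ a' := by
    have h1 : Tendsto (fun n => power (D.npTest v n) (linearLaw P q n) -
        (Measure.pi fun _ : Fin n => linearLaw P q n).real
          {x | 1 / 2 ≤ |χ n x - D.npTest v n x|}) l (𝓝 (normalCdf (-v) - 0)) := hW₀lim.sub hhalf
    rw [sub_zero] at h1
    refine le_of_tendsto_of_tendsto h1 hlima ?_
    filter_upwards [hl hfix, hl D.prob] with n ⟨i0, i1, e, s0, s1, t0, t1, _⟩ i3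
    refine le_trans ?_ (measureReal_lt_prod_mono (hπm n) s0 (k n) n)
    rw [npTest, power_thresholdTest D.hb, sub_le_iff_le_add]
    refine (measureReal_mono ?_ (by finiteness)).trans (measureReal_union_le _ _)
    intro x hx
    by_cases hxA : k n < ∏ i, π n (x i)
    · exact Or.inl hxA
    · refine Or.inr (half_le_of_ne_midTest (e := 0) (thresholdTest_eq_zero_or_one _ _ _ _)
        (fun h => absurd h hxA) (fun _ => rfl) ?_)
      rw [thresholdTest_of_lt hx]
      norm_num
  -- The mean of `a'` and `c'` is at most `a'`, while `a' ≤ α ≤ c'`; hence all three coincide.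
  have huv : v = u := by
    have : normalCdf (-v) = normalCdf (-u) := by
      rw [hv] at hlev ⊢
      linarith
    exact neg_injective (normalCdf_strictMono.injective this)
  rw [huv] at hhalf
  -- Where `φ n` differs from `npTest` at all, `χ` differs from it by at least `1/2`, whatever the
  -- randomization of `φ n`.
  refine D.tendsto_center hl (fun n => measurableSet_le measurable_const
    (((hφt n).1.sub (D.isTest_npTest u n).1).abs)) ?_
  refine tendsto_of_tendsto_of_tendsto_of_le_of_le' tendsto_const_nhds hhalf
    (.of_forall fun _ => measureReal_nonneg) ?_
  filter_upwards [hl hfix, hl D.prob] with n ⟨i0, i1, e, s0, s1, t0, t1, hx⟩ i3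
  refine measureReal_mono (fun x hxη => half_le_of_ne_midTest
    (thresholdTest_eq_zero_or_one _ _ _ _) (hx x).1 (hx x).2 fun h => ?_) (by finiteness)
  have h' : φ n x = D.npTest u n x := h
  have : η ≤ |φ n x - D.npTest u n x| := hxη
  rw [h', sub_self, abs_zero] at this
  linarith

end TiltData

/-! ### Clipping constants -/

theorem integrable_max_sub {P : Measure Ω} [IsFiniteMeasure P] {X : Ω → ℝ} (hX : Integrable X P)
    (c : ℝ) : Integrable (fun x => max (X x - c) 0) P :=
  (hX.sub (integrable_const c)).pos_part

/-- The expected excess over `c` is Lipschitz in `c` and tends to zero at infinity, so the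
intermediate value theorem applies. -/
theorem exists_integral_max_sub_eq {P : Measure Ω} [IsProbabilityMeasure P] {X : Ω → ℝ}
    (hX : Integrable X P) {a z : ℝ} (ha : 0 < a) (h : a < ∫ x, max (X x - z) 0 ∂P) :
    ∃ c, z < c ∧ ∫ x, max (X x - c) 0 ∂P = a := by
  have hlip : ∀ c d, |∫ x, max (X x - c) 0 ∂P - ∫ x, max (X x - d) 0 ∂P| ≤ |c - d| := by
    intro c d
    rw [← integral_sub (integrable_max_sub hX c) (integrable_max_sub hX d)]
    have hpt : ∀ x, ‖max (X x - c) 0 - max (X x - d) 0‖ ≤ |c - d| := fun x => by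
      refine (abs_max_sub_max_le_abs (X x - c) (X x - d) 0).trans (le_of_eq ?_)
      rw [← abs_neg]; congr 1; ring
    have := norm_integral_le_of_norm_le_const (μ := P) (.of_forall hpt)
    rwa [probReal_univ, mul_one, Real.norm_eq_abs] at this
  have hcont : Continuous fun c => ∫ x, max (X x - c) 0 ∂P := by
    have : LipschitzWith 1 fun c => ∫ x, max (X x - c) 0 ∂P :=
      LipschitzWith.of_dist_le_mul fun c d => by
        simpa [Real.dist_eq] using hlip c d
    exact this.continuous
  have hlim : Tendsto (fun n : ℕ => ∫ x, max (X x - n) 0 ∂P) atTop (𝓝 (∫ _, (0 : ℝ) ∂P)) := by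
    refine tendsto_integral_of_dominated_convergence (fun x => |X x|)
      (fun n => (integrable_max_sub hX n).aestronglyMeasurable) hX.abs
      (fun n => .of_forall fun x => ?_) (.of_forall fun x => ?_)
    · rw [Real.norm_eq_abs, abs_of_nonneg (le_max_right _ _)]
      have : (0 : ℝ) ≤ n := n.cast_nonneg
      exact max_le (by linarith [le_abs_self (X x)]) (abs_nonneg _)
    · refine tendsto_const_nhds.congr' ?_
      filter_upwards [eventually_ge_atTop ⌈X x⌉₊] with n hn
      rw [max_eq_right (by linarith [Nat.ceil_le.1 hn])]
  rw [integral_zero] at hlim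
  obtain ⟨n, hn, hzn⟩ := ((hlim.eventually_lt_const ha).and (eventually_ge_atTop ⌈z⌉₊)).exists
  obtain ⟨c, hc, hca⟩ := intermediate_value_Ioo' (Nat.ceil_le.1 hzn) hcont.continuousOn ⟨hn, h⟩
  exact ⟨c, hc.1, hca⟩

/-- The expected excess decreases strictly as long as it is positive: equality at `c < d` forces the
excess over `c` to vanish almost everywhere. -/
theorem integral_max_sub_injective {P : Measure Ω} [IsProbabilityMeasure P] {X : Ω → ℝ}
    (hX : Integrable X P) {a c d : ℝ} (ha : 0 < a) (hc : ∫ x, max (X x - c) 0 ∂P = a)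
    (hd : ∫ x, max (X x - d) 0 ∂P = a) : c = d := by
  wlog hcd : c < d generalizing c d
  · rcases eq_or_lt_of_le (not_lt.1 hcd) with h | h
    · exact h.symm
    · exact (this hd hc h).symm
  exfalso
  have h0 := (integral_eq_zero_iff_of_nonneg_ae (.of_forall fun x => sub_nonneg.2
    (max_le_max (by linarith) le_rfl : max (X x - d) 0 ≤ max (X x - c) 0))
    ((integrable_max_sub hX c).sub (integrable_max_sub hX d))).1
    (by rw [integral_sub (integrable_max_sub hX c) (integrable_max_sub hX d), hc, hd, sub_self])
  have : ∫ x, max (X x - c) 0 ∂P = 0 := by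
    refine integral_eq_zero_of_ae ?_
    filter_upwards [h0] with x hx
    simp only [Pi.zero_apply] at hx ⊢
    by_contra hne
    have hpos : 0 < X x - c := by
      by_contra hle
      exact hne (max_eq_right (not_lt.1 hle))
    rw [max_eq_left hpos.le] at hx
    rcases max_cases (X x - d) 0 with ⟨h1, _⟩ | ⟨h1, _⟩ <;> rw [h1] at hx <;> linarith
  linarith

/-- The clipping constants of the score `Λ`. -/
structure ClipData (P : Measure Ω) (Λ : Ω → ℝ) (τ r₀ r₁ c' c'' : ℝ) : Prop where
  hm : Measurable Λ
  hL : MemLp Λ 2 P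
  h0 : ∫ x, Λ x ∂P = 0
  hτ : 0 < τ
  hr₀ : 0 < r₀
  hr₁ : 0 < r₁
  low : c' < (r₁ - r₀) / τ
  high : (r₁ - r₀) / τ < c''
  eq_low : ∫ x, max (c' - Λ x) 0 ∂P = r₁ / τ
  eq_high : ∫ x, max (Λ x - c'') 0 ∂P = r₀ / τ

/-- One assumption yields both constants. As `Λ` is centered, `E (z - Λ)₊ = E (Λ - z)₊ + z` with `z
= r₁/τ - r₀/τ`, so the lower condition is equivalent to the upper one. -/
theorem exists_clipData {P : Measure Ω} [IsProbabilityMeasure P] {Λ : Ω → ℝ} {τ r₀ r₁ : ℝ}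
    (hm : Measurable Λ) (hL : MemLp Λ 2 P) (h0 : ∫ x, Λ x ∂P = 0) (hτ : 0 < τ) (hr₀ : 0 < r₀)
    (hr₁ : 0 < r₁) (hr : r₀ < ∫ x, max (τ * Λ x - (r₁ - r₀)) 0 ∂P) :
    ∃ c' c'', ClipData P Λ τ r₀ r₁ c' c'' := by
  have hi : Integrable Λ P := hL.integrable (by norm_num)
  set z := (r₁ - r₀) / τ with hz
  have e1 : ∫ x, max (τ * Λ x - (r₁ - r₀)) 0 ∂P = τ * ∫ x, max (Λ x - z) 0 ∂P := by
    rw [← integral_const_mul]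
    refine integral_congr_ae (.of_forall fun x => ?_)
    simp only
    rw [mul_max_of_nonneg _ _ hτ.le, mul_zero, mul_sub, hz, mul_div_cancel₀ _ hτ.ne']
  rw [e1] at hr
  have hr' : r₀ / τ < ∫ x, max (Λ x - z) 0 ∂P := by rw [div_lt_iff₀ hτ]; linarith
  obtain ⟨c'', hc'', e''⟩ := exists_integral_max_sub_eq hi (div_pos hr₀ hτ) hr'
  have hneg : r₁ / τ < ∫ x, max ((-Λ) x - (-z)) 0 ∂P := by
    have e2 : ∀ x, max ((-Λ) x - (-z)) 0 = max (Λ x - z) 0 - (Λ x - z) := fun x => by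
      simp only [Pi.neg_apply]
      rcases le_total (Λ x) z with h | h
      · rw [max_eq_left (by linarith), max_eq_right (by linarith)]; ring
      · rw [max_eq_right (by linarith), max_eq_left (by linarith)]; ring
    simp_rw [e2]
    rw [integral_sub (integrable_max_sub hi z) (show Integrable (fun x => Λ x - z) P from
      hi.sub (integrable_const z)), integral_sub hi (integrable_const z), h0]
    simp only [integral_const, probReal_univ, smul_eq_mul, one_mul]
    have : z = r₁ / τ - r₀ / τ := by rw [hz, sub_div]
    linarith
  obtain ⟨d, hd, e'⟩ := exists_integral_max_sub_eq hi.neg (div_pos hr₁ hτ) hneg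
  refine ⟨-d, c'', hm, hL, h0, hτ, hr₀, hr₁, by linarith, hc'', ?_, e''⟩
  rw [← e']
  refine integral_congr_ae (.of_forall fun x => ?_)
  simp only [Pi.neg_apply]
  congr 1; ring

/-! ### The least favorable tangents and their clipped difference. -/

namespace ClipData

variable {P : Measure Ω} {Λ : Ω → ℝ} {τ r₀ r₁ c' c'' : ℝ}

/-- The least favorable null tangent. -/
def tangentNull (_ : ClipData P Λ τ r₀ r₁ c' c'') (x : Ω) : ℝ := τ * max (Λ x - c'') 0 - r₀

/-- The least favorable alternative tangent. -/
def tangentAlt (_ : ClipData P Λ τ r₀ r₁ c' c'') (x : Ω) : ℝ :=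
  τ * Λ x + τ * max (c' - Λ x) 0 - r₁

/-- The difference of the least favorable tangents. -/
noncomputable def score (_ : ClipData P Λ τ r₀ r₁ c' c'') (x : Ω) : ℝ :=
  τ * clippedScore Λ ((r₁ - r₀) / τ) c' c'' x

theorem lt (D : ClipData P Λ τ r₀ r₁ c' c'') : c' < c'' := D.low.trans D.high

theorem mul_center (D : ClipData P Λ τ r₀ r₁ c' c'') : τ * ((r₁ - r₀) / τ) = r₁ - r₀ :=
  mul_div_cancel₀ _ D.hτ.ne'

/-- Checked on the three regions cut out by `c'` and `c''`. Both tangents may be unbounded, but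
their difference is bounded, as the normal approximation requires. -/
theorem tangentNull_add_score (D : ClipData P Λ τ r₀ r₁ c' c'') (x : Ω) :
    D.tangentNull x + D.score x = D.tangentAlt x := by
  have h := D.mul_center
  have hlt := D.lt
  simp only [tangentNull, tangentAlt, score, clippedScore]
  rw [mul_sub, h]
  rcases le_total (Λ x) c'' with h1 | h1
  · rw [min_eq_left h1, max_eq_right (by linarith : Λ x - c'' ≤ 0)]
    rcases le_total (Λ x) c' with h2 | h2
    · rw [max_eq_left h2, max_eq_left (by linarith : 0 ≤ c' - Λ x)]; ring
    · rw [max_eq_right h2, max_eq_right (by linarith : c' - Λ x ≤ 0)]; ring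
  · rw [min_eq_right h1, max_eq_left (by linarith : 0 ≤ Λ x - c''), max_eq_right hlt.le,
      max_eq_right (by linarith : c' - Λ x ≤ 0)]; ring

theorem score_le (D : ClipData P Λ τ r₀ r₁ c' c'') (x : Ω) :
    D.score x ≤ τ * (c'' - (r₁ - r₀) / τ) :=
  mul_le_mul_of_nonneg_left (sub_le_sub_right (max_le D.lt.le (min_le_right _ _)) _) D.hτ.le

theorem le_score (D : ClipData P Λ τ r₀ r₁ c' c'') (x : Ω) :
    τ * (c' - (r₁ - r₀) / τ) ≤ D.score x :=
  mul_le_mul_of_nonneg_left (sub_le_sub_right (le_max_left _ _) _) D.hτ.le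

theorem score_of_gt (D : ClipData P Λ τ r₀ r₁ c' c'') {x : Ω} (h : c'' < Λ x) :
    D.score x = τ * (c'' - (r₁ - r₀) / τ) := by
  simp only [score, clippedScore]
  rw [min_eq_right h.le, max_eq_right D.lt.le]

theorem score_of_lt (D : ClipData P Λ τ r₀ r₁ c' c'') {x : Ω} (h : Λ x < c') :
    D.score x = τ * (c' - (r₁ - r₀) / τ) := by
  simp only [score, clippedScore]
  rw [min_eq_left (h.trans D.lt).le, max_eq_left h.le]

theorem measurable_tangentNull (D : ClipData P Λ τ r₀ r₁ c' c'') : Measurable D.tangentNull :=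
  (((D.hm.sub_const _).max measurable_const).const_mul τ).sub_const _

theorem measurable_score (D : ClipData P Λ τ r₀ r₁ c' c'') : Measurable D.score :=
  ((measurable_const.max (D.hm.min measurable_const)).sub_const _).const_mul τ

theorem abs_score_le (D : ClipData P Λ τ r₀ r₁ c' c'') (x : Ω) :
    |D.score x| ≤ max |τ * (c' - (r₁ - r₀) / τ)| |τ * (c'' - (r₁ - r₀) / τ)| :=
  abs_le_max_abs_abs (D.le_score x) (D.score_le x)

theorem integral_score_sq (D : ClipData P Λ τ r₀ r₁ c' c'') : ∫ x, D.score x ^ 2 ∂P =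
    (τ * clippedNorm P Λ ((r₁ - r₀) / τ) c' c'') ^ 2 := by
  rw [mul_pow, clippedNorm, Real.sq_sqrt (integral_nonneg fun x => sq_nonneg _),
    ← integral_const_mul]
  simp only [score, mul_pow]

variable [IsProbabilityMeasure P]

theorem integrable (D : ClipData P Λ τ r₀ r₁ c' c'') : Integrable Λ P :=
  D.hL.integrable (by norm_num)

theorem integrable_high (D : ClipData P Λ τ r₀ r₁ c' c'') (c : ℝ) :
    Integrable (fun x => max (Λ x - c) 0) P := integrable_max_sub D.integrable c

theorem integrable_low (D : ClipData P Λ τ r₀ r₁ c' c'') (c : ℝ) :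
    Integrable (fun x => max (c - Λ x) 0) P :=
  ((integrable_const c).sub D.integrable).pos_part

theorem moment_equations_iff (D : ClipData P Λ τ r₀ r₁ c' c'') (d' d'' : ℝ) :
    (∫ x, (τ * max (Λ x - d'') 0 - r₀) ∂P = 0 ∧
      ∫ x, (τ * Λ x + τ * max (d' - Λ x) 0 - r₁) ∂P = 0) ↔ d' = c' ∧ d'' = c'' := by
  have hτ := D.hτ
  have e1 : ∀ d, ∫ x, (τ * max (Λ x - d) 0 - r₀) ∂P = τ * ∫ x, max (Λ x - d) 0 ∂P - r₀ := by
    intro d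
    rw [integral_sub ((D.integrable_high d).const_mul τ) (integrable_const _), integral_const_mul]
    simp
  have e2 : ∀ d, ∫ x, (τ * Λ x + τ * max (d - Λ x) 0 - r₁) ∂P =
      τ * ∫ x, max (d - Λ x) 0 ∂P - r₁ := by
    intro d
    rw [integral_sub (show Integrable (fun x => τ * Λ x + τ * max (d - Λ x) 0) P from
      (D.integrable.const_mul τ).add ((D.integrable_low d).const_mul τ)) (integrable_const _),
      integral_add (D.integrable.const_mul τ)
      ((D.integrable_low d).const_mul τ), integral_const_mul, integral_const_mul, D.h0]
    simp
  rw [e1, e2]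
  constructor
  · rintro ⟨h1, h2⟩
    have h1' : ∫ x, max (Λ x - d'') 0 ∂P = r₀ / τ := by rw [eq_div_iff hτ.ne']; linarith
    have h2' : ∫ x, max (d' - Λ x) 0 ∂P = r₁ / τ := by rw [eq_div_iff hτ.ne']; linarith
    refine ⟨?_, integral_max_sub_injective D.integrable (div_pos D.hr₀ hτ) h1' D.eq_high⟩
    have := integral_max_sub_injective D.integrable.neg (div_pos D.hr₁ hτ) (c := -d') (d := -c')
      (by rw [← h2']; congr 1; ext x; simp only [Pi.neg_apply]; congr 1; ring)
      (by rw [← D.eq_low]; congr 1; ext x; simp only [Pi.neg_apply]; congr 1; ring)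
    linarith
  · rintro ⟨rfl, rfl⟩
    rw [D.eq_low, D.eq_high, mul_div_cancel₀ _ hτ.ne', mul_div_cancel₀ _ hτ.ne']
    simp

theorem memLp_high (D : ClipData P Λ τ r₀ r₁ c' c'') : MemLp (fun x => max (Λ x - c'') 0) 2 P :=
  (D.hL.sub (memLp_const c'')).pos_part

theorem memLp_low (D : ClipData P Λ τ r₀ r₁ c' c'') : MemLp (fun x => max (c' - Λ x) 0) 2 P :=
  ((memLp_const c').sub D.hL).pos_part

theorem memLp_tangentNull (D : ClipData P Λ τ r₀ r₁ c' c'') : MemLp D.tangentNull 2 P :=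
  (D.memLp_high.const_mul τ).sub (memLp_const r₀)

theorem memLp_tangentAlt (D : ClipData P Λ τ r₀ r₁ c' c'') : MemLp D.tangentAlt 2 P :=
  ((D.hL.const_mul τ).add (D.memLp_low.const_mul τ)).sub (memLp_const r₁)

theorem integral_tangentNull (D : ClipData P Λ τ r₀ r₁ c' c'') : ∫ x, D.tangentNull x ∂P = 0 :=
  ((D.moment_equations_iff c' c'').2 ⟨rfl, rfl⟩).1

theorem integral_tangentAlt (D : ClipData P Λ τ r₀ r₁ c' c'') : ∫ x, D.tangentAlt x ∂P = 0 :=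
  ((D.moment_equations_iff c' c'').2 ⟨rfl, rfl⟩).2

theorem integrable_score (D : ClipData P Λ τ r₀ r₁ c' c'') : Integrable D.score P :=
  Integrable.of_bound D.measurable_score.aestronglyMeasurable _ (.of_forall D.abs_score_le)

theorem integral_score (D : ClipData P Λ τ r₀ r₁ c' c'') : ∫ x, D.score x ∂P = 0 := by
  have h := D.integral_tangentAlt
  simp_rw [← D.tangentNull_add_score] at h
  rw [integral_add (D.memLp_tangentNull.integrable (by norm_num)) D.integrable_score,
    D.integral_tangentNull, zero_add] at h
  exact h

/-- A vanishing score would exclude `Λ > c''`, where it equals `τ (c'' - z) > 0`; but that region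
carries the positive excess `r₀/τ`. -/
theorem mul_clippedNorm_pos (D : ClipData P Λ τ r₀ r₁ c' c'') :
    0 < τ * clippedNorm P Λ ((r₁ - r₀) / τ) c' c'' := by
  refine lt_of_le_of_ne (mul_nonneg D.hτ.le (Real.sqrt_nonneg _)) fun h => ?_
  have h0 := D.integral_score_sq
  rw [← h, zero_pow two_ne_zero, integral_eq_zero_iff_of_nonneg (fun x => sq_nonneg _)
    (Integrable.of_bound (D.measurable_score.pow_const 2).aestronglyMeasurable
      ((max |τ * (c' - (r₁ - r₀) / τ)| |τ * (c'' - (r₁ - r₀) / τ)|) ^ 2) (.of_forall fun x => by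
        rw [norm_pow]; exact pow_le_pow_left₀ (norm_nonneg _) (D.abs_score_le x) 2))] at h0
  have : ∫ x, max (Λ x - c'') 0 ∂P = 0 := by
    refine integral_eq_zero_of_ae ?_
    filter_upwards [h0] with x hx
    have hx' : D.score x = 0 := by simpa using hx
    refine max_eq_right ?_
    by_contra hlt
    rw [D.score_of_gt (by linarith)] at hx'
    exact (mul_pos D.hτ (sub_pos.2 D.high)).ne' hx'
  rw [D.eq_high] at this
  exact (div_pos D.hr₀ D.hτ).ne' this

theorem tiltData (D : ClipData P Λ τ r₀ r₁ c' c'') : TiltData P D.tangentNull D.score r₀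
    (max |τ * (c' - (r₁ - r₀) / τ)| |τ * (c'' - (r₁ - r₀) / τ)|)
    (τ * clippedNorm P Λ ((r₁ - r₀) / τ) c' c'') where
  hq := D.measurable_tangentNull
  hqL := D.memLp_tangentNull
  hq0 := D.integral_tangentNull
  hr := D.hr₀
  hqr x := by
    have := mul_nonneg D.hτ.le (le_max_right (Λ x - c'') 0)
    simp only [tangentNull]; linarith
  hb := D.measurable_score
  hbC := D.abs_score_le
  hb0 := D.integral_score
  hσ := D.mul_clippedNorm_pos
  hσ2 := D.integral_score_sq

/-- The mass `q₀ + r₀` has total `r₀` and lives where the score is constantly maximal. -/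
theorem integral_score_mul_tangentNull (D : ClipData P Λ τ r₀ r₁ c' c'') :
    ∫ x, D.score x * D.tangentNull x ∂P = τ * (r₀ * (c'' - (r₁ - r₀) / τ)) := by
  have e : ∀ x, D.score x * D.tangentNull x =
      τ * (c'' - (r₁ - r₀) / τ) * (τ * max (Λ x - c'') 0) - r₀ * D.score x := fun x => by
    simp only [tangentNull]
    rcases lt_or_ge c'' (Λ x) with h | h
    · rw [D.score_of_gt h]; ring
    · rw [max_eq_right (by linarith : Λ x - c'' ≤ 0)]; ring
  simp_rw [e]
  rw [integral_sub (((D.integrable_high c'').const_mul τ).const_mul _)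
    (D.integrable_score.const_mul _), integral_const_mul, integral_const_mul, integral_const_mul,
    D.integral_score, D.eq_high, mul_div_cancel₀ _ D.hτ.ne']
  ring

theorem npTest_eq_clippedTest (D : ClipData P Λ τ r₀ r₁ c' c'') (u : ℝ) :
    D.tiltData.npTest u = clippedTest P Λ ((r₁ - r₀) / τ) c' c'' r₀ u := by
  ext n x
  have h : D.tiltData.threshold u < scaledSum D.score x ↔
      clippedNorm P Λ ((r₁ - r₀) / τ) c' c'' * u + r₀ * (c'' - (r₁ - r₀) / τ)
        < (√n)⁻¹ * ∑ i, clippedScore Λ ((r₁ - r₀) / τ) c' c'' (x i) := by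
    rw [TiltData.threshold, D.integral_score_mul_tangentNull, scaledSum]
    simp only [score]
    rw [← Finset.mul_sum, mul_assoc, ← mul_add, mul_left_comm, mul_lt_mul_iff_right₀ D.hτ]
  rw [TiltData.npTest, clippedTest]
  split_ifs with h1
  · exact thresholdTest_of_lt (h.2 h1)
  · exact thresholdTest_of_le (not_lt.1 fun h2 => h1 (h.1 h2))

end ClipData

/-! ### Extremal contaminations -/

theorem ae_withDensity_ofReal {P : Measure Ω} {f : Ω → ℝ} (hf : Measurable f) {p : Ω → Prop}
    (h : ∀ x, 0 < f x → p x) : ∀ᵐ x ∂(P.withDensity fun x => ENNReal.ofReal (f x)), p x := by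
  rw [ae_withDensity_iff hf.ennreal_ofReal]
  exact .of_forall fun x hx => h x (ENNReal.ofReal_pos.1 (pos_iff_ne_zero.2 hx))

namespace ClipData

variable {P : Measure Ω} {Λ : Ω → ℝ} {τ r₀ r₁ c' c'' : ℝ}

variable [IsProbabilityMeasure P]

/-- The mass moved to the upper clipping region. -/
theorem isProbabilityMeasure_high (D : ClipData P Λ τ r₀ r₁ c' c'') :
    IsProbabilityMeasure (P.withDensity fun x => ENNReal.ofReal ((D.tangentNull x + r₀) / r₀)) := by
  refine isProbabilityMeasure_withDensity_ofReal (fun x => div_nonneg ?_ D.hr₀.le) ?_ ?_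
  · linarith [D.tiltData.hqr x]
  · exact ((D.memLp_tangentNull.integrable (by norm_num)).add (integrable_const _)).div_const _
  · rw [integral_div, integral_add (D.memLp_tangentNull.integrable (by norm_num))
      (integrable_const _), D.integral_tangentNull]
    simp [D.hr₀.ne']

/-- The mass moved to the lower clipping region. -/
theorem isProbabilityMeasure_low (D : ClipData P Λ τ r₀ r₁ c' c'') :
    IsProbabilityMeasure
      (P.withDensity fun x => ENNReal.ofReal (τ * max (c' - Λ x) 0 / r₁)) := by
  refine isProbabilityMeasure_withDensity_ofReal
    (fun x => div_nonneg (mul_nonneg D.hτ.le (le_max_right _ _)) D.hr₁.le)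
    (((D.integrable_low c').const_mul τ).div_const _) ?_
  rw [integral_div, integral_const_mul, D.eq_low, mul_div_cancel₀ _ D.hτ.ne', div_self D.hr₁.ne']

/-- The extremal alternative in the contamination neighborhood of `Q`. -/
noncomputable def altLaw (_ : ClipData P Λ τ r₀ r₁ c' c'') (Q : ℕ → Measure Ω) (n : ℕ) :
    Measure Ω :=
  ENNReal.ofReal (1 - r₁ / √n) • Q n +
    ENNReal.ofReal (r₁ / √n) • P.withDensity fun x => ENNReal.ofReal (τ * max (c' - Λ x) 0 / r₁)

theorem hasTangent_altLaw (D : ClipData P Λ τ r₀ r₁ c' c'') {Q : ℕ → Measure Ω}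
    (hQ : ∀ᶠ n in atTop, IsProbabilityMeasure (Q n)) (hT : HasTangent P Q fun x => τ * Λ x) :
    HasTangent P (D.altLaw Q) (fun x => D.tangentNull x + D.score x) := by
  have := HasTangent.mixture hQ (D.hm.const_mul τ) (D.hL.const_mul τ) hT
    (((measurable_const.sub D.hm).max measurable_const).const_mul τ)
    (fun x => mul_nonneg D.hτ.le (le_max_right (c' - Λ x) 0)) (D.memLp_low.const_mul τ) D.hr₁
  simp_rw [D.tangentNull_add_score]
  exact this

/-- The null contamination sits on `Λ > c''`, where the score attains its maximum, the alternative
one on `Λ < c'`, where it attains its minimum. Extremality thus holds exactly at every large `n`,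
for all thresholds together. -/
theorem extremalPair (D : ClipData P Λ τ r₀ r₁ c' c'') {Q : ℕ → Measure Ω}
    (hQ : ∀ᶠ n in atTop, IsProbabilityMeasure (Q n)) :
    ExtremalPair D.score (fun n => contaminationNhd P (r₀ / √n))
      (fun n => contaminationNhd (Q n) (r₁ / √n)) (linearLaw P D.tangentNull) (D.altLaw Q) := by
  have hsmall : ∀ r : ℝ, 0 < r → ∀ᶠ n : ℕ in atTop, 0 ≤ r / √n ∧ r / √n ≤ 1 := fun r hr => by
    filter_upwards [eventually_mul_inv_sqrt_le r one_pos] with n hn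
    exact ⟨by positivity, by rwa [div_eq_mul_inv]⟩
  have hm₀ : ∀ᶠ n : ℕ in atTop, linearLaw P D.tangentNull n = ENNReal.ofReal (1 - r₀ / √n) • P +
      ENNReal.ofReal (r₀ / √n) •
        P.withDensity fun x => ENNReal.ofReal ((D.tangentNull x + r₀) / r₀) := by
    filter_upwards [eventually_mul_inv_sqrt_le r₀ (c := 1 / 2) (by norm_num),
      eventually_gt_atTop 0] with n h1 h2
    exact linearLaw_eq_mixture D.measurable_tangentNull D.hr₀ D.tiltData.hqr h2 h1
  have i0 := D.isProbabilityMeasure_high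
  have i1 := D.isProbabilityMeasure_low
  refine ⟨?_, ?_, ?_, ?_, ?_, ?_⟩
  · filter_upwards [hsmall r₀ D.hr₀] with n hn R hR
    exact isProbabilityMeasure_contaminationNhd hn.1 hn.2 hR
  · filter_upwards [hsmall r₁ D.hr₁, hQ] with n hn hQn R hR
    exact isProbabilityMeasure_contaminationNhd hn.1 hn.2 hR
  · filter_upwards [hm₀] with n hn
    exact ⟨_, i0, hn⟩
  · exact .of_forall fun n => ⟨_, i1, rfl⟩
  · filter_upwards [hm₀, hsmall r₀ D.hr₀, D.tiltData.prob] with n hn hs hp R hR t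
    have hRp := isProbabilityMeasure_contaminationNhd hs.1 hs.2 hR
    refine power_thresholdTest_le D.measurable_score (fun U hU _ => ?_) t n
    obtain ⟨M, hM, rfl⟩ := hR
    rw [hn]
    refine contamination_le_of_top _ _ D.score_le ?_ hU
    refine ae_withDensity_ofReal ((D.measurable_tangentNull.add_const _).div_const _)
      fun x hx => D.score_of_gt ?_
    by_contra hle
    rw [tangentNull, max_eq_right (by linarith)] at hx
    simp at hx
  · filter_upwards [hsmall r₁ D.hr₁, hQ] with n hs hQn R hR t
    have hRp := isProbabilityMeasure_contaminationNhd hs.1 hs.2 hR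
    have hWp : IsProbabilityMeasure (D.altLaw Q n) :=
      isProbabilityMeasure_contaminationNhd (P := Q n) hs.1 hs.2 ⟨_, i1, rfl⟩
    refine power_thresholdTest_le D.measurable_score (fun U hU _ => ?_) t n
    obtain ⟨M, hM, rfl⟩ := hR
    refine contamination_ge_of_bot _ _ D.le_score ?_ hU
    refine ae_withDensity_ofReal (f := fun x => τ * max (c' - Λ x) 0 / r₁)
      ((((measurable_const.sub D.hm).max measurable_const).const_mul τ).div_const _)
      fun x hx => D.score_of_lt ?_
    by_contra hle
    rw [max_eq_right (by linarith)] at hx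
    simp at hx

/-! ### Geometry of the tangent sets -/

theorem mem_nullTangents_iff (D : ClipData P Λ τ r₀ r₁ c' c'') (g : Lp ℝ 2 P) :
    g ∈ nullTangents P r₀ ↔ ∫ x, g x ∂P = 0 ∧ ∀ᵐ x ∂P, -r₀ ≤ g x := by
  have hr := D.hr₀
  constructor
  · rintro ⟨h, ⟨h0, h1⟩, rfl⟩
    have e := Lp.coeFn_smul r₀ h
    refine ⟨?_, ?_⟩
    · rw [integral_congr_ae e]
      simp only [Pi.smul_apply, smul_eq_mul]
      rw [integral_const_mul, h0, mul_zero]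
    · filter_upwards [e, h1] with x hx hx1
      simp only [hx, Pi.smul_apply, smul_eq_mul]
      nlinarith
  · rintro ⟨h0, h1⟩
    have e := Lp.coeFn_smul r₀⁻¹ g
    refine ⟨r₀⁻¹ • g, ⟨?_, ?_⟩, smul_inv_smul₀ hr.ne' g⟩
    · rw [integral_congr_ae e]
      simp only [Pi.smul_apply, smul_eq_mul]
      rw [integral_const_mul, h0, mul_zero]
    · filter_upwards [e, h1] with x hx hx1
      rw [hx, Pi.smul_apply, smul_eq_mul, inv_mul_eq_div, le_div_iff₀ hr]
      linarith

/-- `g + r₀` is nonnegative of total mass `r₀`, so its pairing with the score is at most `r₀` times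
the maximal score, and `q₀` attains this. -/
theorem integral_score_mul_le (D : ClipData P Λ τ r₀ r₁ c' c'') {g : Ω → ℝ} (hg : MemLp g 2 P)
    (hg0 : ∫ x, g x ∂P = 0) (hgr : ∀ᵐ x ∂P, -r₀ ≤ g x) :
    ∫ x, D.score x * g x ∂P ≤ ∫ x, D.score x * D.tangentNull x ∂P := by
  have hgi := hg.integrable (by norm_num : (1 : ℝ≥0∞) ≤ 2)
  have hbg : Integrable (fun x => D.score x * g x) P :=
    hgi.bdd_mul D.measurable_score.aestronglyMeasurable (.of_forall D.abs_score_le)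
  have h1 : ∫ x, (D.score x * g x + r₀ * D.score x) ∂P ≤
      ∫ x, τ * (c'' - (r₁ - r₀) / τ) * (g x + r₀) ∂P := by
    refine integral_mono_ae (hbg.add (D.integrable_score.const_mul _))
      ((hgi.add (integrable_const _)).const_mul _) ?_
    filter_upwards [hgr] with x hx
    nlinarith [D.score_le x]
  rw [integral_add hbg (D.integrable_score.const_mul _), integral_const_mul, D.integral_score,
    integral_const_mul, integral_add hgi (integrable_const _), hg0] at h1
  rw [D.integral_score_mul_tangentNull]
  simp only [integral_const, probReal_univ, smul_eq_mul] at h1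
  linarith

/-- The difference `g - q₁` has mean zero and can be negative only where `Λ < c'`, that is, where
the score is minimal. -/
theorem le_integral_score_mul (D : ClipData P Λ τ r₀ r₁ c' c'') {g : Ω → ℝ} (hg : MemLp g 2 P)
    (hg0 : ∫ x, g x ∂P = 0) (hgr : ∀ᵐ x ∂P, τ * Λ x - r₁ ≤ g x) :
    ∫ x, D.score x * D.tangentAlt x ∂P ≤ ∫ x, D.score x * g x ∂P := by
  have hgi := hg.integrable (by norm_num : (1 : ℝ≥0∞) ≤ 2)
  have bdd : ∀ {f : Ω → ℝ}, Integrable f P → Integrable (fun x => D.score x * f x) P := fun hf =>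
    hf.bdd_mul D.measurable_score.aestronglyMeasurable (.of_forall D.abs_score_le)
  have hai := D.memLp_tangentAlt.integrable (by norm_num : (1 : ℝ≥0∞) ≤ 2)
  have h1 : ∫ x, τ * (c' - (r₁ - r₀) / τ) * (g x - D.tangentAlt x) ∂P ≤
      ∫ x, (D.score x * g x - D.score x * D.tangentAlt x) ∂P := by
    refine integral_mono_ae ((hgi.sub hai).const_mul _) ((bdd hgi).sub (bdd hai)) ?_
    filter_upwards [hgr] with x hx
    rw [← mul_sub]
    rcases lt_or_ge (Λ x) c' with h | h
    · rw [D.score_of_lt h]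
    · refine mul_le_mul_of_nonneg_right (D.le_score x) ?_
      rw [tangentAlt, max_eq_right (by linarith)]
      linarith
  rw [integral_sub (bdd hgi) (bdd hai), integral_const_mul, integral_sub hgi hai, hg0,
    D.integral_tangentAlt] at h1
  linarith

theorem mem_altTangents_iff (D : ClipData P Λ τ r₀ r₁ c' c'') (hL : MemLp Λ 2 P) (g : Lp ℝ 2 P) :
    g ∈ altTangents P (hL.toLp Λ) τ r₁ ↔
      ∫ x, g x ∂P = 0 ∧ ∀ᵐ x ∂P, τ * Λ x - r₁ ≤ g x := by
  have hr := D.hr₁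
  have hi : ∀ f : Lp ℝ 2 P, Integrable f P := fun f => (Lp.memLp f).integrable (by norm_num)
  constructor
  · rintro ⟨h, ⟨h0, h1⟩, rfl⟩
    have e : (τ • hL.toLp Λ + r₁ • h : Lp ℝ 2 P) =ᵐ[P] fun x => τ * Λ x + r₁ * h x := by
      filter_upwards [Lp.coeFn_add (τ • hL.toLp Λ) (r₁ • h), Lp.coeFn_smul τ (hL.toLp Λ),
        Lp.coeFn_smul r₁ h, hL.coeFn_toLp] with x h1 h2 h3 h4
      rw [h1, Pi.add_apply, h2, h3, Pi.smul_apply, Pi.smul_apply, h4, smul_eq_mul, smul_eq_mul]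
    refine ⟨?_, ?_⟩
    · rw [integral_congr_ae e, integral_add (D.integrable.const_mul τ) ((hi h).const_mul r₁),
        integral_const_mul, integral_const_mul, h0, D.h0]
      simp
    · filter_upwards [e, h1] with x hx hx1
      simp only [hx]
      nlinarith
  · rintro ⟨h0, h1⟩
    have e : (r₁⁻¹ • (g - τ • hL.toLp Λ) : Lp ℝ 2 P) =ᵐ[P] fun x => r₁⁻¹ * (g x - τ * Λ x) := by
      filter_upwards [Lp.coeFn_smul r₁⁻¹ (g - τ • hL.toLp Λ), Lp.coeFn_sub g (τ • hL.toLp Λ),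
        Lp.coeFn_smul τ (hL.toLp Λ), hL.coeFn_toLp] with x h1 h2 h3 h4
      rw [h1, Pi.smul_apply, h2, Pi.sub_apply, h3, Pi.smul_apply, h4, smul_eq_mul, smul_eq_mul]
    refine ⟨r₁⁻¹ • (g - τ • hL.toLp Λ), ⟨?_, ?_⟩, ?_⟩
    · rw [integral_congr_ae e, integral_const_mul, integral_sub (hi g) (D.integrable.const_mul τ),
        integral_const_mul, h0, D.h0]
      simp
    · filter_upwards [e, h1] with x hx hx1
      rw [hx, inv_mul_eq_div, le_div_iff₀ hr]
      linarith
    · simp only [smul_inv_smul₀ hr.ne', add_sub_cancel]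

/-- The least favorable tangents as elements of `L₂(P)`. -/
noncomputable def nullLp (D : ClipData P Λ τ r₀ r₁ c' c'') : Lp ℝ 2 P := D.memLp_tangentNull.toLp _

noncomputable def altLp (D : ClipData P Λ τ r₀ r₁ c' c'') : Lp ℝ 2 P := D.memLp_tangentAlt.toLp _

theorem coeFn_nullLp (D : ClipData P Λ τ r₀ r₁ c' c'') : D.nullLp =ᵐ[P] D.tangentNull :=
  D.memLp_tangentNull.coeFn_toLp

theorem coeFn_altLp (D : ClipData P Λ τ r₀ r₁ c' c'') : D.altLp =ᵐ[P] D.tangentAlt :=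
  D.memLp_tangentAlt.coeFn_toLp

theorem nullLp_mem (D : ClipData P Λ τ r₀ r₁ c' c'') : D.nullLp ∈ nullTangents P r₀ := by
  rw [D.mem_nullTangents_iff]
  refine ⟨by rw [integral_congr_ae D.coeFn_nullLp, D.integral_tangentNull], ?_⟩
  filter_upwards [D.coeFn_nullLp] with x hx
  rw [hx]; exact D.tiltData.hqr x

theorem altLp_mem (D : ClipData P Λ τ r₀ r₁ c' c'') (hL : MemLp Λ 2 P) :
    D.altLp ∈ altTangents P (hL.toLp Λ) τ r₁ := by
  rw [D.mem_altTangents_iff]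
  refine ⟨by rw [integral_congr_ae D.coeFn_altLp, D.integral_tangentAlt], ?_⟩
  filter_upwards [D.coeFn_altLp] with x hx
  rw [hx, tangentAlt]
  have := mul_nonneg D.hτ.le (le_max_right (c' - Λ x) 0)
  linarith

theorem coeFn_altLp_sub_nullLp (D : ClipData P Λ τ r₀ r₁ c' c'') :
    (D.altLp - D.nullLp : Lp ℝ 2 P) =ᵐ[P] D.score := by
  filter_upwards [Lp.coeFn_sub D.altLp D.nullLp, D.coeFn_altLp, D.coeFn_nullLp] with x h1 h2 h3
  rw [h1, Pi.sub_apply, h2, h3, ← D.tangentNull_add_score]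
  ring

theorem inner_score (D : ClipData P Λ τ r₀ r₁ c' c'') (g : Lp ℝ 2 P) :
    inner ℝ (D.altLp - D.nullLp) g = ∫ x, D.score x * g x ∂P := by
  rw [L2.inner_def]
  refine integral_congr_ae ?_
  filter_upwards [D.coeFn_altLp_sub_nullLp] with x hx
  rw [hx]
  exact mul_comm _ _

theorem norm_altLp_sub_nullLp (D : ClipData P Λ τ r₀ r₁ c' c'') :
    ‖D.altLp - D.nullLp‖ = τ * clippedNorm P Λ ((r₁ - r₀) / τ) c' c'' := by
  rw [← sq_eq_sq₀ (norm_nonneg _) D.mul_clippedNorm_pos.le, ← D.integral_score_sq,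
    ← real_inner_self_eq_norm_sq, D.inner_score]
  refine integral_congr_ae ?_
  filter_upwards [D.coeFn_altLp_sub_nullLp] with x hx
  rw [hx, pow_two]

theorem inner_null_le (D : ClipData P Λ τ r₀ r₁ c' c'') {g : Lp ℝ 2 P}
    (hg : g ∈ nullTangents P r₀) :
    ∫ x, D.score x * g x ∂P ≤ ∫ x, D.score x * D.tangentNull x ∂P := by
  rw [D.mem_nullTangents_iff] at hg
  exact D.integral_score_mul_le (Lp.memLp g) hg.1 hg.2

theorem le_inner_alt (D : ClipData P Λ τ r₀ r₁ c' c'') (hL : MemLp Λ 2 P) {g : Lp ℝ 2 P}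
    (hg : g ∈ altTangents P (hL.toLp Λ) τ r₁) :
    ∫ x, D.score x * D.tangentAlt x ∂P ≤ ∫ x, D.score x * g x ∂P := by
  rw [D.mem_altTangents_iff] at hg
  exact D.le_integral_score_mul (Lp.memLp g) hg.1 hg.2

theorem integral_score_mul_tangentAlt (D : ClipData P Λ τ r₀ r₁ c' c'') :
    ∫ x, D.score x * D.tangentAlt x ∂P - ∫ x, D.score x * D.tangentNull x ∂P =
      (τ * clippedNorm P Λ ((r₁ - r₀) / τ) c' c'') ^ 2 := by
  have := D.tiltData.integral_mul_add
  simp_rw [D.tangentNull_add_score] at this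
  rw [this]; ring

/-- The variational inequality that characterizes the nearest point to the origin in the convex set
of differences. -/
theorem sq_le_inner (D : ClipData P Λ τ r₀ r₁ c' c'') (hL : MemLp Λ 2 P) {g₀ g₁ : Lp ℝ 2 P}
    (h₀ : g₀ ∈ nullTangents P r₀) (h₁ : g₁ ∈ altTangents P (hL.toLp Λ) τ r₁) :
    ‖D.altLp - D.nullLp‖ ^ 2 ≤ inner ℝ (D.altLp - D.nullLp) (g₁ - g₀) := by
  rw [inner_sub_right, D.inner_score, D.inner_score, D.norm_altLp_sub_nullLp,
    ← D.integral_score_mul_tangentAlt]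
  linarith [D.inner_null_le h₀, D.le_inner_alt hL h₁]

theorem norm_le (D : ClipData P Λ τ r₀ r₁ c' c'') (hL : MemLp Λ 2 P) {g₀ g₁ : Lp ℝ 2 P}
    (h₀ : g₀ ∈ nullTangents P r₀) (h₁ : g₁ ∈ altTangents P (hL.toLp Λ) τ r₁) :
    ‖D.altLp - D.nullLp‖ ≤ ‖g₁ - g₀‖ := by
  have h := (D.sq_le_inner hL h₀ h₁).trans (real_inner_le_norm _ _)
  have hp : 0 < ‖D.altLp - D.nullLp‖ := by
    rw [D.norm_altLp_sub_nullLp]; exact D.mul_clippedNorm_pos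
  rw [pow_two] at h
  exact le_of_mul_le_mul_left h hp

theorem eq_of_norm_le (D : ClipData P Λ τ r₀ r₁ c' c'') (hL : MemLp Λ 2 P) {g₀ g₁ : Lp ℝ 2 P}
    (h₀ : g₀ ∈ nullTangents P r₀) (h₁ : g₁ ∈ altTangents P (hL.toLp Λ) τ r₁)
    (h : ‖g₁ - g₀‖ ≤ ‖D.altLp - D.nullLp‖) : g₀ = D.nullLp ∧ g₁ = D.altLp := by
  -- Expanding the squared distance of the two differences, the norm bound and the variational
  -- inequality make it nonpositive.
  have hd : g₁ - g₀ = D.altLp - D.nullLp := by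
    rw [← sub_eq_zero, ← norm_eq_zero, ← sq_eq_zero_iff]
    refine le_antisymm ?_ (sq_nonneg _)
    rw [norm_sub_sq_real, real_inner_comm]
    have := D.sq_le_inner hL h₀ h₁
    have := pow_le_pow_left₀ (norm_nonneg _) h 2
    linarith
  have h₀' := (D.mem_nullTangents_iff g₀).1 h₀
  have h₁' := (D.mem_altTangents_iff hL g₁).1 h₁
  -- Equal differences do not yet give equal pairs. For `Λ < c'` the tangent `q₀` equals its lower
  -- bound `-r₀`; otherwise `q₁` equals its lower bound, and the common difference transfers this to
  -- `q₀`. As the means agree, domination becomes equality.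
  have hle : ∀ᵐ x ∂P, D.tangentNull x ≤ g₀ x := by
    have hd' : (g₁ - g₀ : Lp ℝ 2 P) =ᵐ[P] D.score := by rw [hd]; exact D.coeFn_altLp_sub_nullLp
    filter_upwards [hd', Lp.coeFn_sub g₁ g₀, h₀'.2, h₁'.2] with x h1 h2 h3 h4
    rw [h1, Pi.sub_apply] at h2
    have h5 := D.tangentNull_add_score x
    rcases lt_or_ge (Λ x) c' with hx | hx
    · rw [tangentNull, max_eq_right (by linarith [D.lt])]
      linarith
    · rw [tangentAlt, max_eq_right (by linarith)] at h5
      linarith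
  have hgi : Integrable g₀ P := (Lp.memLp g₀).integrable (by norm_num)
  have hqi := D.memLp_tangentNull.integrable (by norm_num : (1 : ℝ≥0∞) ≤ 2)
  have he : D.tangentNull =ᵐ[P] g₀ := by
    rw [← integral_eq_iff_of_ae_le hqi hgi hle, h₀'.1, D.integral_tangentNull]
  have e0 : g₀ = D.nullLp := Lp.ext (he.symm.trans D.coeFn_nullLp.symm)
  refine ⟨e0, ?_⟩
  rw [e0] at hd
  exact sub_left_injective hd

theorem isMinNormPair_iff (D : ClipData P Λ τ r₀ r₁ c' c'') (hL : MemLp Λ 2 P) (g₀ g₁ : Lp ℝ 2 P) :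
    IsMinNormPair (nullTangents P r₀) (altTangents P (hL.toLp Λ) τ r₁) g₀ g₁ ↔
      g₀ = D.nullLp ∧ g₁ = D.altLp := by
  constructor
  · rintro ⟨h0, h1, h⟩
    exact D.eq_of_norm_le hL h0 h1 (h _ D.nullLp_mem _ (D.altLp_mem hL))
  · rintro ⟨rfl, rfl⟩
    exact ⟨D.nullLp_mem, D.altLp_mem hL, fun h0 hh0 h1 hh1 => D.norm_le hL hh0 hh1⟩

theorem tangentTest_ae_eq (D : ClipData P Λ τ r₀ r₁ c' c'') (u : ℝ) (n : ℕ) :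
    tangentTest D.nullLp D.altLp u n =ᵐ[Measure.pi fun _ : Fin n => P]
      clippedTest P Λ ((r₁ - r₀) / τ) c' c'' r₀ u n := by
  rw [← D.npTest_eq_clippedTest]
  have hae : ∀ᵐ x ∂(Measure.pi fun _ : Fin n => P), ∀ i,
      (D.altLp - D.nullLp : Lp ℝ 2 P) (x i) = D.score (x i) := by
    rw [ae_all_iff]
    intro i
    exact (Measure.quasiMeasurePreserving_eval (fun _ : Fin n => P) i).ae
      (p := fun y => (D.altLp - D.nullLp : Lp ℝ 2 P) y = D.score y) D.coeFn_altLp_sub_nullLp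
  have hin : inner ℝ (D.altLp - D.nullLp) D.nullLp = ∫ x, D.score x * D.tangentNull x ∂P := by
    rw [D.inner_score]
    refine integral_congr_ae ?_
    filter_upwards [D.coeFn_nullLp] with x hx
    rw [hx]
  filter_upwards [hae] with x hx
  rw [tangentTest, hin, D.norm_altLp_sub_nullLp]
  simp_rw [hx]
  rw [TiltData.npTest]
  split_ifs with h
  · exact (thresholdTest_of_lt h).symm
  · exact (thresholdTest_of_le (not_lt.1 h)).symm

end ClipData

/-! ### Asymptotic size and power -/

section AsySizePower

variable {ψ : TestSeq Ω} {Q : ℕ → Measure Ω} {a : ℝ}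

theorem rejectionProb_eventuallyEq (hψ : IsTest ψ)
    (hQ : ∀ᶠ n in atTop, IsProbabilityMeasure (Q n)) :
    (fun n => rejectionProb (ψ n) (Q n)) =ᶠ[atTop]
      fun n => ENNReal.ofReal (power (ψ n) (Q n)) := by
  filter_upwards [hQ] with n hn using rejectionProb_eq_ofReal_power (hψ n).1 (hψ n).2 _

theorem tendsto_rejectionProb (hψ : IsTest ψ) (hQ : ∀ᶠ n in atTop, IsProbabilityMeasure (Q n))
    (h : Tendsto (fun n => power (ψ n) (Q n)) atTop (𝓝 a)) :
    Tendsto (fun n => rejectionProb (ψ n) (Q n)) atTop (𝓝 (ENNReal.ofReal a)) :=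
  (ENNReal.tendsto_ofReal h).congr' (rejectionProb_eventuallyEq hψ hQ).symm

theorem eventually_power_le_of_asySize_le (hψ : IsTest ψ)
    (hQ : ∀ᶠ n in atTop, IsProbabilityMeasure (Q n)) (ha : 0 ≤ a)
    (h : asySize ψ Q ≤ ENNReal.ofReal a) {ε : ℝ} (hε : 0 < ε) :
    ∀ᶠ n in atTop, power (ψ n) (Q n) ≤ a + ε := by
  have hlt : asySize ψ Q < ENNReal.ofReal (a + ε) :=
    h.trans_lt ((ENNReal.ofReal_lt_ofReal_iff (by linarith)).2 (by linarith))
  filter_upwards [eventually_lt_of_limsup_lt hlt, rejectionProb_eventuallyEq hψ hQ] with n h1 h2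
  rw [h2, ENNReal.ofReal_lt_ofReal_iff (by linarith)] at h1
  exact h1.le

theorem eventually_le_power_of_le_asyPower (hψ : IsTest ψ)
    (hQ : ∀ᶠ n in atTop, IsProbabilityMeasure (Q n)) (ha : 0 < a)
    (h : ENNReal.ofReal a ≤ asyPower ψ Q) {ε : ℝ} (hε : 0 < ε) :
    ∀ᶠ n in atTop, a - ε ≤ power (ψ n) (Q n) := by
  have hlt : ENNReal.ofReal (a - ε) < asyPower ψ Q :=
    ((ENNReal.ofReal_lt_ofReal_iff ha).2 (by linarith)).trans_le h
  filter_upwards [eventually_lt_of_lt_liminf hlt, rejectionProb_eventuallyEq hψ hQ] with n h1 h2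
  rw [h2] at h1
  exact (ENNReal.lt_ofReal_iff_toReal_lt (by simp)).1 h1 |>.le.trans' (by
    rw [ENNReal.toReal_ofReal']; exact le_max_left _ _)

theorem asyPower_le_of_eventually (hψ : IsTest ψ)
    (hQ : ∀ᶠ n in atTop, IsProbabilityMeasure (Q n))
    (h : ∀ ε > 0, ∀ᶠ n in atTop, power (ψ n) (Q n) ≤ a + ε) :
    asyPower ψ Q ≤ ENNReal.ofReal a := by
  have hlim : Tendsto (fun ε : ℝ => ENNReal.ofReal (a + ε)) (𝓝[>] 0) (𝓝 (ENNReal.ofReal a)) := by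
    refine ENNReal.tendsto_ofReal (Tendsto.mono_left ?_ nhdsWithin_le_nhds)
    simpa using (tendsto_id (x := 𝓝 (0 : ℝ))).const_add a
  refine ge_of_tendsto hlim ?_
  filter_upwards [self_mem_nhdsWithin] with ε hε
  refine liminf_le_of_frequently_le' (Eventually.frequently ?_)
  filter_upwards [h ε hε, rejectionProb_eventuallyEq hψ hQ] with n h1 h2
  rw [h2]
  exact ENNReal.ofReal_le_ofReal h1

end AsySizePower

namespace TiltData

variable {P : Measure Ω} [IsProbabilityMeasure P] {q b : Ω → ℝ} {r C σ : ℝ}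
  {Q₀ Q₁ : ℕ → Measure Ω} {ψ : TestSeq Ω}

/-- No test of asymptotic level `Φ(-u)` has asymptotic power exceeding `Φ(-u + σ)`. -/
theorem asyPower_le (D : TiltData P q b r C σ) (u : ℝ)
    (hQ₀ : ∀ᶠ n in atTop, IsProbabilityMeasure (Q₀ n)) (hT₀ : HasTangent P Q₀ q)
    (hQ₁ : ∀ᶠ n in atTop, IsProbabilityMeasure (Q₁ n))
    (hT₁ : HasTangent P Q₁ (fun x => q x + b x)) (hψ : IsTest ψ)
    (h : asySize ψ Q₀ ≤ ENNReal.ofReal (normalCdf (-u))) :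
    asyPower ψ Q₁ ≤ ENNReal.ofReal (normalCdf (-u + σ)) := by
  have hk : 0 < D.crit u := Real.exp_pos _
  refine asyPower_le_of_eventually hψ hQ₁ fun ε hε => ?_
  -- Slack in the level is priced by the multiplier `D.crit u`, and is chosen to cost `ε/2`.
  have hδ : 0 < ε / (2 * D.crit u) := by positivity
  filter_upwards [eventually_power_le_of_asySize_le hψ hQ₀ (normalCdf_pos _).le h hδ,
    D.eventually_lagrangian_le u hQ₀ hT₀ hQ₁ hT₁ (half_pos hε)] with n h1 h2
  have h2 := h2 (ψ n) (hψ n).1 (hψ n).2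
  have h3 := mul_le_mul_of_nonneg_left h1 hk.le
  have h4 : D.crit u * (normalCdf (-u) + ε / (2 * D.crit u)) =
      D.crit u * normalCdf (-u) + ε / 2 := by field_simp
  rw [h4] at h3
  linarith

/-- Tests of asymptotic level `Φ(-u)` attaining the maximal power coincide asymptotically. -/
theorem tendsto_of_asyPower_ge (D : TiltData P q b r C σ) (u : ℝ)
    (hQ₀ : ∀ᶠ n in atTop, IsProbabilityMeasure (Q₀ n)) (hT₀ : HasTangent P Q₀ q)
    (hQ₁ : ∀ᶠ n in atTop, IsProbabilityMeasure (Q₁ n))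
    (hT₁ : HasTangent P Q₁ (fun x => q x + b x)) (hψ : IsTest ψ)
    (h₀ : asySize ψ Q₀ ≤ ENNReal.ofReal (normalCdf (-u)))
    (h₁ : ENNReal.ofReal (normalCdf (-u + σ)) ≤ asyPower ψ Q₁) {η : ℝ} (hη : 0 < η) :
    Tendsto (fun n => (Measure.pi fun _ : Fin n => P).real {x | η ≤ |ψ n x - D.npTest u n x|})
      atTop (𝓝 0) := by
  have hk : 0 < D.crit u := Real.exp_pos _
  refine D.tendsto_center le_rfl (fun n => measurableSet_le measurable_const
    (((hψ n).1.sub (D.isTest_npTest u n).1).abs)) (D.tendsto_of_lagrangian_ge u hQ₀ hT₀ hQ₁ hT₁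
      le_rfl hψ (fun ε hε => ?_) hη)
  have hδ : 0 < ε / (2 * D.crit u) := by positivity
  filter_upwards [eventually_power_le_of_asySize_le hψ hQ₀ (normalCdf_pos _).le h₀ hδ,
    eventually_le_power_of_le_asyPower hψ hQ₁ (normalCdf_pos _) h₁ (half_pos hε)] with n h1 h2
  have h3 := mul_le_mul_of_nonneg_left h1 hk.le
  have h4 : D.crit u * (normalCdf (-u) + ε / (2 * D.crit u)) =
      D.crit u * normalCdf (-u) + ε / 2 := by field_simp
  rw [h4] at h3
  linarith

theorem asyEqual_npTest (D : TiltData P q b r C σ) (u : ℝ)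
    (h : ∀ η : ℝ, 0 < η → Tendsto (fun n => (Measure.pi fun _ : Fin n => P).real
      {x | η ≤ |ψ n x - D.npTest u n x|}) atTop (𝓝 0)) : AsyEqual P ψ (D.npTest u) := by
  intro η hη
  have := ENNReal.tendsto_ofReal (h η hη)
  rw [ENNReal.ofReal_zero] at this
  exact this.congr fun n => ofReal_measureReal (by finiteness)

/-- The asymptotic Neyman-Pearson test is maxmin over neighborhoods with an extremal pair. -/
theorem isAsyMaxminOver (D : TiltData P q b r C σ) (u : ℝ)
    {𝒬₀ 𝒬₁ : ℕ → Set (Measure Ω)} {W₁ : ℕ → Measure Ω}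
    (hW : ExtremalPair b 𝒬₀ 𝒬₁ (linearLaw P q) W₁)
    (hT₁ : HasTangent P W₁ (fun x => q x + b x)) :
    IsAsyMaxminOver 𝒬₀ 𝒬₁ (normalCdf (-u)) (D.npTest u) := by
  have hW₁p : ∀ᶠ n in atTop, IsProbabilityMeasure (W₁ n) := by
    filter_upwards [hW.prob₁, hW.mem₁] with n h1 h2 using h1 _ h2
  refine ⟨D.isTest_npTest u, ?_, fun δ hδ hsize => ?_⟩
  · rw [← (tendsto_rejectionProb (D.isTest_npTest u) D.prob
      (D.tendsto_power_npTest_null u D.prob D.tangent)).limsup_eq]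
    refine limsup_le_limsup ?_
    filter_upwards [hW.prob₀, hW.le₀, D.prob] with n h1 h2 h3
    refine iSup₂_le fun Q hQ => ?_
    have := h1 Q hQ
    rw [rejectionProb_eq_ofReal_power (D.isTest_npTest u n).1 (D.isTest_npTest u n).2,
      rejectionProb_eq_ofReal_power (D.isTest_npTest u n).1 (D.isTest_npTest u n).2]
    exact ENNReal.ofReal_le_ofReal (h2 Q hQ _)
  -- Size and power over the neighborhoods bound those at the extremal members, so the simple
  -- problem limits every competitor.
  · have h0 : asySize δ (linearLaw P q) ≤ ENNReal.ofReal (normalCdf (-u)) := by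
      refine (limsup_le_limsup ?_).trans hsize
      filter_upwards [hW.mem₀] with n hn
      exact le_iSup₂ (f := fun Q (_ : Q ∈ 𝒬₀ n) => rejectionProb (δ n) Q) _ hn
    have h1 : asyMinPower 𝒬₁ δ ≤ asyPower δ W₁ := by
      refine liminf_le_liminf ?_
      filter_upwards [hW.mem₁] with n hn
      exact iInf₂_le (f := fun Q (_ : Q ∈ 𝒬₁ n) => rejectionProb (δ n) Q) _ hn
    refine (h1.trans (D.asyPower_le u D.prob D.tangent hW₁p hT₁ hδ h0)).trans ?_
    rw [← (tendsto_rejectionProb (D.isTest_npTest u) hW₁p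
      (D.tendsto_power_npTest_alt u hW₁p hT₁)).liminf_eq]
    refine liminf_le_liminf ?_
    filter_upwards [hW.prob₁, hW.ge₁, hW₁p] with n h1 h2 h3
    refine le_iInf₂ fun Q hQ => ?_
    have := h1 Q hQ
    rw [rejectionProb_eq_ofReal_power (D.isTest_npTest u n).1 (D.isTest_npTest u n).2,
      rejectionProb_eq_ofReal_power (D.isTest_npTest u n).1 (D.isTest_npTest u n).2]
    exact ENNReal.ofReal_le_ofReal (h2 Q hQ _)

end TiltData

/-! ### Optimal tests of simple hypotheses -/

/-- The threshold test based on `h`, with `t` giving limiting level `Φ(-u)`, is an admissible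
competitor. The optimal score `g₁ - g₀` may be unbounded, so only bounded `h` are tried; they
approximate it well enough. -/
theorem IsOptimalSimple.le_asyPower {P : Measure Ω} [IsProbabilityMeasure P]
    {Q₀ Q₁ : ℕ → Measure Ω} (hQ₀ : ∀ᶠ n in atTop, IsProbabilityMeasure (Q₀ n))
    (hQ₁ : ∀ᶠ n in atTop, IsProbabilityMeasure (Q₁ n)) {g₀ g₁ h : Ω → ℝ} (hg₀ : Measurable g₀)
    (hgL₀ : MemLp g₀ 2 P) (hT₀ : HasTangent P Q₀ g₀) (hg₁ : Measurable g₁) (hgL₁ : MemLp g₁ 2 P)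
    (hT₁ : HasTangent P Q₁ g₁) {u : ℝ} {δ : TestSeq Ω}
    (hδ : IsOptimalSimple (normalCdf (-u)) Q₀ Q₁ δ) (hh : Measurable h) {C : ℝ}
    (hC : ∀ x, |h x| ≤ C) (hh0 : ∫ x, h x ∂P = 0) {ρ : ℝ} (hρ : 0 < ρ)
    (hρ2 : ∫ x, h x ^ 2 ∂P = ρ ^ 2) :
    ENNReal.ofReal (normalCdf (-u + (∫ x, h x * g₁ x ∂P - ∫ x, h x * g₀ x ∂P) / ρ)) ≤
      asyPower δ Q₁ := by
  set t := ρ * u + ∫ x, h x * g₀ x ∂P with ht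
  have l0 := tendsto_rejectionProb (isTest_thresholdTest hh t) hQ₀
    (hT₀.tendsto_power_thresholdTest hQ₀ hg₀ hgL₀ hh hC hh0 hρ hρ2 t)
  have l1 := tendsto_rejectionProb (isTest_thresholdTest hh t) hQ₁
    (hT₁.tendsto_power_thresholdTest hQ₁ hg₁ hgL₁ hh hC hh0 hρ hρ2 t)
  have e0 : (∫ x, h x * g₀ x ∂P - t) / ρ = -u := by rw [ht]; field_simp; ring
  have e1 : (∫ x, h x * g₁ x ∂P - t) / ρ =
      -u + (∫ x, h x * g₁ x ∂P - ∫ x, h x * g₀ x ∂P) / ρ := by rw [ht]; field_simp; ring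
  rw [e0] at l0
  rw [e1] at l1
  rw [← l1.liminf_eq]
  exact hδ.2.2 _ (isTest_thresholdTest hh t) l0.limsup_eq.le

/-- The norm is determined by pairings with bounded centered functions. -/
theorem integral_sq_le_of_forall_bounded {P : Measure Ω} [IsProbabilityMeasure P] {g : Ω → ℝ}
    (hg : Measurable g) (hgL : MemLp g 2 P) (hg0 : ∫ x, g x ∂P = 0) {σ : ℝ} (hσ : 0 ≤ σ)
    (H : ∀ (h : Ω → ℝ) (C ρ : ℝ), Measurable h → (∀ x, |h x| ≤ C) → ∫ x, h x ∂P = 0 → 0 < ρ →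
      ∫ x, h x ^ 2 ∂P = ρ ^ 2 → ∫ x, h x * g x ∂P ≤ σ * ρ) :
    ∫ x, g x ^ 2 ∂P ≤ σ * √(∫ x, g x ^ 2 ∂P) := by
  have hgi := hgL.integrable (by norm_num : (1 : ℝ≥0∞) ≤ 2)
  have hg2 := hgL.integrable_sq
  have hclip : ∀ (K : ℕ) x, |max (-(K : ℝ)) (min (g x) K)| ≤ K := fun K x => by
    have : (0 : ℝ) ≤ K := K.cast_nonneg
    exact abs_le.2 ⟨le_max_left _ _, max_le (by linarith) (min_le_right _ _)⟩
  have hclip' : ∀ (K : ℕ) x, |max (-(K : ℝ)) (min (g x) K)| ≤ |g x| := fun K x => by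
    have hK : (0 : ℝ) ≤ K := K.cast_nonneg
    refine abs_le.2 ⟨?_, max_le (by linarith [abs_nonneg (g x)])
      ((min_le_left _ _).trans (le_abs_self _))⟩
    rcases le_total (g x) K with h | h
    · rw [min_eq_left h]; exact le_max_of_le_right (neg_abs_le _)
    · rw [min_eq_right h]; exact le_max_of_le_right (by linarith [abs_nonneg (g x)])
  -- The test functions are the truncations of `g` at level `K`, recentered. Recentering changes
  -- neither the pairing with the centered `g` nor increases the `L₂` norm.
  have hle : ∀ K : ℕ, ∫ x, max (-(K : ℝ)) (min (g x) K) * g x ∂P ≤ σ * √(∫ x, g x ^ 2 ∂P) := by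
    intro K
    set k : Ω → ℝ := fun x => max (-(K : ℝ)) (min (g x) K) with hk
    have hkm : Measurable k := measurable_const.max (hg.min measurable_const)
    have hki : Integrable k P := Integrable.of_bound hkm.aestronglyMeasurable K
      (.of_forall (hclip K))
    set m := ∫ x, k x ∂P with hm
    have hkg : Integrable (fun x => k x * g x) P :=
      hgi.bdd_mul hkm.aestronglyMeasurable (.of_forall (hclip K))
    have hk2 : Integrable (fun x => k x ^ 2) P :=
      Integrable.of_bound (hkm.pow_const 2).aestronglyMeasurable ((K : ℝ) ^ 2)
        (.of_forall fun x => by rw [norm_pow]; exact pow_le_pow_left₀ (norm_nonneg _) (hclip K x) 2)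
    have e1 : ∫ x, (k x - m) * g x ∂P = ∫ x, k x * g x ∂P := by
      simp_rw [sub_mul]
      rw [integral_sub hkg (hgi.const_mul m), integral_const_mul, hg0, mul_zero, sub_zero]
    have e2 : ∫ x, (k x - m) ^ 2 ∂P = ∫ x, k x ^ 2 ∂P - m ^ 2 := by
      have : ∀ x, (k x - m) ^ 2 = k x ^ 2 - (2 * m * k x - m ^ 2) := fun x => by ring
      simp_rw [this]
      rw [integral_sub hk2 (show Integrable (fun x => 2 * m * k x - m ^ 2) P from
        (hki.const_mul _).sub (integrable_const _)),
        integral_sub (hki.const_mul _) (integrable_const _), integral_const_mul, ← hm]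
      simp only [integral_const, probReal_univ, smul_eq_mul]
      ring
    have e3 : ∫ x, k x ^ 2 ∂P ≤ ∫ x, g x ^ 2 ∂P :=
      integral_mono hk2 hg2 fun x => sq_le_sq.2 (hclip' K x)
    rw [← e1]
    have hn : 0 ≤ ∫ x, (k x - m) ^ 2 ∂P := integral_nonneg fun x => sq_nonneg _
    have hs : √(∫ x, (k x - m) ^ 2 ∂P) ≤ √(∫ x, g x ^ 2 ∂P) :=
      Real.sqrt_le_sqrt (by rw [e2]; linarith [sq_nonneg m])
    -- An almost surely constant truncation has no positive `ρ`, but then its pairing with `g` is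
    -- zero.
    rcases hn.eq_or_lt with h0 | h0
    · have hz := (integral_eq_zero_iff_of_nonneg (fun x => sq_nonneg (k x - m))
        (Integrable.of_bound ((hkm.sub_const m).pow_const 2).aestronglyMeasurable
          (((K : ℝ) + |m|) ^ 2) (.of_forall fun x => by
            rw [norm_pow]
            exact pow_le_pow_left₀ (norm_nonneg _)
              ((abs_sub _ _).trans (add_le_add_left (hclip K x) _)) 2))).1 h0.symm
      have : ∫ x, (k x - m) * g x ∂P = 0 := by
        refine integral_eq_zero_of_ae ?_
        filter_upwards [hz] with x hx
        have : k x - m = 0 := by simpa using hx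
        simp [this]
      rw [this]
      positivity
    · refine (H (fun x => k x - m) (K + |m|) (√(∫ x, (k x - m) ^ 2 ∂P)) (hkm.sub_const m)
        (fun x => (abs_sub _ _).trans (add_le_add_left (hclip K x) _)) ?_ (Real.sqrt_pos.2 h0)
        (Real.sq_sqrt hn).symm).trans (mul_le_mul_of_nonneg_left hs hσ)
      rw [integral_sub hki (integrable_const m), ← hm]
      simp
  have hlim : Tendsto (fun K : ℕ => ∫ x, max (-(K : ℝ)) (min (g x) K) * g x ∂P) atTop
      (𝓝 (∫ x, g x ^ 2 ∂P)) := by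
    refine tendsto_integral_of_dominated_convergence (fun x => g x ^ 2) (fun K =>
      ((measurable_const.max (hg.min measurable_const)).mul hg).aestronglyMeasurable) hg2
      (fun K => .of_forall fun x => ?_) (.of_forall fun x => ?_)
    · rw [norm_mul, Real.norm_eq_abs, Real.norm_eq_abs, ← sq_abs, pow_two]
      exact mul_le_mul_of_nonneg_right (hclip' K x) (abs_nonneg _)
    · refine tendsto_const_nhds.congr' ?_
      filter_upwards [eventually_ge_atTop ⌈|g x|⌉₊] with K hK
      have h := abs_le.1 (Nat.ceil_le.1 hK)
      rw [min_eq_left h.2, max_eq_right h.1, pow_two]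
  exact le_of_tendsto' hlim hle

/-! ### The maxmin problem between the tangent sets -/

/-- A choice of local alternatives along all tangents. -/
def IsLocalLaw (P : Measure Ω) (law : Lp ℝ 2 P → ℕ → Measure Ω) : Prop :=
  ∀ g : Lp ℝ 2 P, ∫ x, g x ∂P = 0 → (∀ n, IsProbabilityMeasure (law g n)) ∧ HasTangent P (law g) g

theorem measurable_Lp {P : Measure Ω} (g : Lp ℝ 2 P) : Measurable g :=
  (Lp.stronglyMeasurable g).measurable

namespace ClipData

variable {P : Measure Ω} [IsProbabilityMeasure P] {Λ : Ω → ℝ} {τ r₀ r₁ c' c'' : ℝ}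
  {law : Lp ℝ 2 P → ℕ → Measure Ω}

theorem hasTangent_nullLp (D : ClipData P Λ τ r₀ r₁ c' c'') (hlaw : IsLocalLaw P law) :
    (∀ n, IsProbabilityMeasure (law D.nullLp n)) ∧
      HasTangent P (law D.nullLp) D.tangentNull := by
  obtain ⟨h1, h2⟩ := hlaw D.nullLp ((D.mem_nullTangents_iff _).1 D.nullLp_mem).1
  exact ⟨h1, h2.congr_ae D.coeFn_nullLp⟩

theorem hasTangent_altLp (D : ClipData P Λ τ r₀ r₁ c' c'') (hlaw : IsLocalLaw P law) :
    (∀ n, IsProbabilityMeasure (law D.altLp n)) ∧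
      HasTangent P (law D.altLp) fun x => D.tangentNull x + D.score x := by
  obtain ⟨h1, h2⟩ := hlaw D.altLp ((D.mem_altTangents_iff D.hL _).1 (D.altLp_mem D.hL)).1
  simp_rw [D.tangentNull_add_score]
  exact ⟨h1, h2.congr_ae D.coeFn_altLp⟩

theorem tendsto_rejectionProb_npTest (D : ClipData P Λ τ r₀ r₁ c' c'') (hlaw : IsLocalLaw P law)
    (u : ℝ) {g : Lp ℝ 2 P} (hg : ∫ x, g x ∂P = 0) :
    Tendsto (fun n => rejectionProb (D.tiltData.npTest u n) (law g n)) atTop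
      (𝓝 (ENNReal.ofReal (normalCdf (-u + (∫ x, D.score x * g x ∂P -
        ∫ x, D.score x * D.tangentNull x ∂P) /
          (τ * clippedNorm P Λ ((r₁ - r₀) / τ) c' c''))))) :=
  tendsto_rejectionProb (D.tiltData.isTest_npTest u) (.of_forall (hlaw g hg).1)
    (D.tiltData.tendsto_power_npTest u (.of_forall (hlaw g hg).1) (measurable_Lp g) (Lp.memLp g)
      (hlaw g hg).2)

theorem asySize_npTest_le (D : ClipData P Λ τ r₀ r₁ c' c'') (hlaw : IsLocalLaw P law) (u : ℝ)
    {g : Lp ℝ 2 P} (hg : g ∈ nullTangents P r₀) :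
    asySize (D.tiltData.npTest u) (law g) ≤ ENNReal.ofReal (normalCdf (-u)) := by
  have h0 := ((D.mem_nullTangents_iff g).1 hg).1
  rw [asySize, (D.tendsto_rejectionProb_npTest hlaw u h0).limsup_eq]
  refine ENNReal.ofReal_le_ofReal (normalCdf_strictMono.monotone ?_)
  have := div_nonpos_of_nonpos_of_nonneg (sub_nonpos.2 (D.inner_null_le hg))
    D.mul_clippedNorm_pos.le
  linarith

theorem le_asyPower_npTest (D : ClipData P Λ τ r₀ r₁ c' c'') (hlaw : IsLocalLaw P law) (u : ℝ)
    (hL : MemLp Λ 2 P) {g : Lp ℝ 2 P} (hg : g ∈ altTangents P (hL.toLp Λ) τ r₁) :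
    ENNReal.ofReal (normalCdf (-u + τ * clippedNorm P Λ ((r₁ - r₀) / τ) c' c'')) ≤
      asyPower (D.tiltData.npTest u) (law g) := by
  have h0 := ((D.mem_altTangents_iff hL g).1 hg).1
  rw [asyPower, (D.tendsto_rejectionProb_npTest hlaw u h0).liminf_eq]
  refine ENNReal.ofReal_le_ofReal (normalCdf_strictMono.monotone (add_le_add_right ?_ _))
  rw [le_div_iff₀ D.mul_clippedNorm_pos, ← pow_two, ← D.integral_score_mul_tangentAlt]
  exact sub_le_sub_right (D.le_inner_alt hL hg) _

theorem asySize_npTest_nullLp (D : ClipData P Λ τ r₀ r₁ c' c'') (hlaw : IsLocalLaw P law) (u : ℝ) :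
    asySize (D.tiltData.npTest u) (law D.nullLp) = ENNReal.ofReal (normalCdf (-u)) :=
  (tendsto_rejectionProb (D.tiltData.isTest_npTest u) (.of_forall (D.hasTangent_nullLp hlaw).1)
    (D.tiltData.tendsto_power_npTest_null u (.of_forall (D.hasTangent_nullLp hlaw).1)
      (D.hasTangent_nullLp hlaw).2)).limsup_eq

theorem asyPower_npTest_altLp (D : ClipData P Λ τ r₀ r₁ c' c'') (hlaw : IsLocalLaw P law) (u : ℝ) :
    asyPower (D.tiltData.npTest u) (law D.altLp) =
      ENNReal.ofReal (normalCdf (-u + τ * clippedNorm P Λ ((r₁ - r₀) / τ) c' c'')) :=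
  (tendsto_rejectionProb (D.tiltData.isTest_npTest u) (.of_forall (D.hasTangent_altLp hlaw).1)
    (D.tiltData.tendsto_power_npTest_alt u (.of_forall (D.hasTangent_altLp hlaw).1)
      (D.hasTangent_altLp hlaw).2)).liminf_eq

theorem asyPower_altLp_le (D : ClipData P Λ τ r₀ r₁ c' c'') (hlaw : IsLocalLaw P law) (u : ℝ)
    {δ : TestSeq Ω} (hδ : IsTest δ)
    (h : asySize δ (law D.nullLp) ≤ ENNReal.ofReal (normalCdf (-u))) :
    asyPower δ (law D.altLp) ≤
      ENNReal.ofReal (normalCdf (-u + τ * clippedNorm P Λ ((r₁ - r₀) / τ) c' c'')) :=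
  D.tiltData.asyPower_le u (.of_forall (D.hasTangent_nullLp hlaw).1) (D.hasTangent_nullLp hlaw).2
    (.of_forall (D.hasTangent_altLp hlaw).1) (D.hasTangent_altLp hlaw).2 hδ h

theorem isSaddlePoint (D : ClipData P Λ τ r₀ r₁ c' c'') (hlaw : IsLocalLaw P law) (u : ℝ)
    (hL : MemLp Λ 2 P) :
    IsSaddlePoint law (nullTangents P r₀) (altTangents P (hL.toLp Λ) τ r₁) (normalCdf (-u))
      D.nullLp D.altLp (D.tiltData.npTest u) := by
  refine ⟨D.nullLp_mem, D.altLp_mem hL, ⟨D.tiltData.isTest_npTest u,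
    (D.asySize_npTest_nullLp hlaw u).le, fun δ hδ hs => ?_⟩, fun g hg => ?_, fun g hg => ?_⟩
  · rw [D.asyPower_npTest_altLp hlaw u]
    exact D.asyPower_altLp_le hlaw u hδ hs
  · rw [D.asySize_npTest_nullLp hlaw u]
    exact D.asySize_npTest_le hlaw u hg
  · rw [D.asyPower_npTest_altLp hlaw u]
    exact D.le_asyPower_npTest hlaw u hL hg

theorem iInf_asyPower_npTest (D : ClipData P Λ τ r₀ r₁ c' c'') (hlaw : IsLocalLaw P law) (u : ℝ)
    (hL : MemLp Λ 2 P) :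
    ⨅ g ∈ altTangents P (hL.toLp Λ) τ r₁, asyPower (D.tiltData.npTest u) (law g) =
      ENNReal.ofReal (normalCdf (-u + τ * clippedNorm P Λ ((r₁ - r₀) / τ) c' c'')) := by
  refine le_antisymm ?_ (le_iInf₂ fun g hg => D.le_asyPower_npTest hlaw u hL hg)
  rw [← D.asyPower_npTest_altLp hlaw u]
  exact iInf₂_le (f := fun g (_ : g ∈ altTangents P (hL.toLp Λ) τ r₁) =>
    asyPower (D.tiltData.npTest u) (law g)) _ (D.altLp_mem hL)

theorem isMaxminTest (D : ClipData P Λ τ r₀ r₁ c' c'') (hlaw : IsLocalLaw P law) (u : ℝ)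
    (hL : MemLp Λ 2 P) :
    IsMaxminTest law (nullTangents P r₀) (altTangents P (hL.toLp Λ) τ r₁) (normalCdf (-u))
      (D.tiltData.npTest u) := by
  refine ⟨D.tiltData.isTest_npTest u, iSup₂_le fun g hg => D.asySize_npTest_le hlaw u hg,
    fun δ hδ hs => ?_⟩
  rw [D.iInf_asyPower_npTest hlaw u hL]
  exact (iInf₂_le (f := fun g (_ : g ∈ altTangents P (hL.toLp Λ) τ r₁) => asyPower δ (law g)) _
    (D.altLp_mem hL)).trans (D.asyPower_altLp_le hlaw u hδ ((le_iSup₂ (f := fun g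
      (_ : g ∈ nullTangents P r₀) => asySize δ (law g)) _ D.nullLp_mem).trans hs))

theorem asyEqual_of_isMaxminTest (D : ClipData P Λ τ r₀ r₁ c' c'') (hlaw : IsLocalLaw P law)
    (u : ℝ) (hL : MemLp Λ 2 P) {δ : TestSeq Ω} (hδ : IsMaxminTest law (nullTangents P r₀)
      (altTangents P (hL.toLp Λ) τ r₁) (normalCdf (-u)) δ) :
    AsyEqual P δ (D.tiltData.npTest u) := by
  have h0 : asySize δ (law D.nullLp) ≤ ENNReal.ofReal (normalCdf (-u)) :=
    (le_iSup₂ (f := fun g (_ : g ∈ nullTangents P r₀) => asySize δ (law g)) _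
      D.nullLp_mem).trans hδ.2.1
  have h1 : ENNReal.ofReal (normalCdf (-u + τ * clippedNorm P Λ ((r₁ - r₀) / τ) c' c'')) ≤
      asyPower δ (law D.altLp) := by
    rw [← D.iInf_asyPower_npTest hlaw u hL]
    exact (hδ.2.2 _ (D.tiltData.isTest_npTest u) (D.isMaxminTest hlaw u hL).2.1).trans
      (iInf₂_le (f := fun g (_ : g ∈ altTangents P (hL.toLp Λ) τ r₁) => asyPower δ (law g)) _
        (D.altLp_mem hL))
  exact D.tiltData.asyEqual_npTest u fun η hη => D.tiltData.tendsto_of_asyPower_ge u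
    (.of_forall (D.hasTangent_nullLp hlaw).1) (D.hasTangent_nullLp hlaw).2
    (.of_forall (D.hasTangent_altLp hlaw).1) (D.hasTangent_altLp hlaw).2 hδ.1 h0 h1 hη

/-- The saddle test keeps level `α` at `q₀`, and its power at `q₁` is no smaller than at `g₁`, so
the latter is at most `Φ(-u + ‖q₁ - q₀‖)`. Optimality between `g₀` and `g₁` forces it to be at least
what every bounded score achieves. Hence `‖g₁ - g₀‖` is minimal, and the geometry identifies the
pair. -/
theorem isLeastFavorableTangentPair_iff (D : ClipData P Λ τ r₀ r₁ c' c'')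
    (hlaw : IsLocalLaw P law) (u : ℝ) (hL : MemLp Λ 2 P) (g₀ g₁ : Lp ℝ 2 P) :
    IsLeastFavorableTangentPair law (nullTangents P r₀) (altTangents P (hL.toLp Λ) τ r₁)
      (normalCdf (-u)) g₀ g₁ ↔ g₀ = D.nullLp ∧ g₁ = D.altLp := by
  constructor
  swap
  · rintro ⟨rfl, rfl⟩
    exact ⟨_, D.isSaddlePoint hlaw u hL⟩
  rintro ⟨δ, m0, m1, hδ, hs0, hs1⟩
  have z0 := ((D.mem_nullTangents_iff g₀).1 m0).1
  have z1 := ((D.mem_altTangents_iff hL g₁).1 m1).1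
  have hp : asyPower δ (law g₁) ≤
      ENNReal.ofReal (normalCdf (-u + τ * clippedNorm P Λ ((r₁ - r₀) / τ) c' c'')) :=
    (hs1 _ (D.altLp_mem hL)).trans
      (D.asyPower_altLp_le hlaw u hδ.1 ((hs0 _ D.nullLp_mem).trans hδ.2.1))
  have hi : ∀ g : Lp ℝ 2 P, Integrable g P := fun g => (Lp.memLp g).integrable (by norm_num)
  set g : Ω → ℝ := fun x => g₁ x - g₀ x with hg
  have hgm : Measurable g := (measurable_Lp g₁).sub (measurable_Lp g₀)
  have key := integral_sq_le_of_forall_bounded (P := P) (g := g) hgm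
    ((Lp.memLp g₁).sub (Lp.memLp g₀))
    (by simp only [hg]; rw [integral_sub (hi g₁) (hi g₀), z0, z1, sub_zero])
    D.mul_clippedNorm_pos.le fun h C ρ hh hC hh0 hρ hρ2 => by
      have h1 := (IsOptimalSimple.le_asyPower (.of_forall (hlaw g₀ z0).1)
        (.of_forall (hlaw g₁ z1).1) (measurable_Lp g₀) (Lp.memLp g₀) (hlaw g₀ z0).2
        (measurable_Lp g₁) (Lp.memLp g₁) (hlaw g₁ z1).2 hδ hh hC hh0 hρ hρ2).trans hp
      rw [ENNReal.ofReal_le_ofReal_iff (normalCdf_pos _).le, normalCdf_strictMono.le_iff_le,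
        add_le_add_iff_left, div_le_iff₀ hρ] at h1
      refine le_trans (le_of_eq ?_) h1
      simp only [hg, mul_sub]
      exact integral_sub ((hi g₁).bdd_mul hh.aestronglyMeasurable (.of_forall hC))
        ((hi g₀).bdd_mul hh.aestronglyMeasurable (.of_forall hC))
  have hnorm : ∫ x, g x ^ 2 ∂P = ‖g₁ - g₀‖ ^ 2 := by
    rw [← real_inner_self_eq_norm_sq, L2.inner_def]
    refine integral_congr_ae ?_
    filter_upwards [Lp.coeFn_sub g₁ g₀] with x hx
    rw [hx, Pi.sub_apply]
    exact pow_two _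
  rw [hnorm, Real.sqrt_sq (norm_nonneg _), pow_two, ← D.norm_altLp_sub_nullLp] at key
  refine D.eq_of_norm_le hL m0 m1 ?_
  rcases (norm_nonneg (g₁ - g₀)).eq_or_lt with h | h
  · rw [← h]; exact norm_nonneg _
  · exact le_of_mul_le_mul_right key h

end ClipData

end RobustTest

/-! ### Assembly of the theorem. -/

theorem mainTheorem3 {Ω : Type*} [MeasurableSpace Ω]
    (Θ : Set ℝ) (hΘ : IsOpen Θ) (P : ℝ → Measure Ω) (hP : ∀ θ ∈ Θ, IsProbabilityMeasure (P θ))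
    (θ₀ : ℝ) (hθ₀ : θ₀ ∈ Θ)
    (Λ : Ω → ℝ) (hΛm : Measurable Λ) (hΛ : MemLp Λ 2 (P θ₀)) (hΛ0 : ∫ x, Λ x ∂(P θ₀) = 0)
    (τ : ℝ) (hτ : 0 < τ)
    (hdiff : HasTangent (P θ₀) (fun n : ℕ => P (θ₀ + τ / √n)) (fun x => τ * Λ x))
    (r₀ r₁ : ℝ) (hr₀ : 0 < r₀) (hr₁ : 0 < r₁)
    (hr : r₀ < ∫ x, max (τ * Λ x - (r₁ - r₀)) 0 ∂(P θ₀))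
    (α u : ℝ) (hα0 : 0 < α) (hα1 : α < 1) (hu : cdf (gaussianReal 0 1) (-u) = α)
    -- any choice of local alternatives `P_{n,g}` along the tangents `g`
    (law : Lp ℝ 2 (P θ₀) → ℕ → Measure Ω)
    (hlaw : ∀ g : Lp ℝ 2 (P θ₀), ∫ x, g x ∂(P θ₀) = 0 →
      (∀ n, IsProbabilityMeasure (law g n)) ∧ HasTangent (P θ₀) (law g) g) :
    ∃ c' c'' : ℝ, c' < (r₁ - r₀) / τ ∧ (r₁ - r₀) / τ < c'' ∧
      -- the clipping constants are determined by the two moment equations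
      (∀ d' d'' : ℝ,
        (∫ x, (τ * max (Λ x - d'') 0 - r₀) ∂(P θ₀) = 0 ∧
          ∫ x, (τ * Λ x + τ * max (d' - Λ x) 0 - r₁) ∂(P θ₀) = 0) ↔ (d' = c' ∧ d'' = c'')) ∧
      -- a) least favorable tangent pair, maxmin test, maxmin power
      (∃ q₀ q₁ : Lp ℝ 2 (P θ₀),
        (∀ᵐ x ∂(P θ₀), q₀ x = τ * max (Λ x - c'') 0 - r₀) ∧
        (∀ᵐ x ∂(P θ₀), q₁ x = τ * Λ x + τ * max (c' - Λ x) 0 - r₁) ∧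
        (∀ g₀ g₁ : Lp ℝ 2 (P θ₀),
          IsLeastFavorableTangentPair law (nullTangents (P θ₀) r₀)
            (altTangents (P θ₀) (hΛ.toLp Λ) τ r₁) α g₀ g₁ ↔ (g₀ = q₀ ∧ g₁ = q₁)) ∧
        (∀ g₀ g₁ : Lp ℝ 2 (P θ₀),
          IsMinNormPair (nullTangents (P θ₀) r₀)
            (altTangents (P θ₀) (hΛ.toLp Λ) τ r₁) g₀ g₁ ↔ (g₀ = q₀ ∧ g₁ = q₁)) ∧
        (∀ n : ℕ, tangentTest q₀ q₁ u n =ᵐ[Measure.pi fun _ : Fin n => P θ₀]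
          clippedTest (P θ₀) Λ ((r₁ - r₀) / τ) c' c'' r₀ u n) ∧
        IsSaddlePoint law (nullTangents (P θ₀) r₀)
          (altTangents (P θ₀) (hΛ.toLp Λ) τ r₁) α q₀ q₁
          (clippedTest (P θ₀) Λ ((r₁ - r₀) / τ) c' c'' r₀ u)) ∧
      IsMaxminTest law (nullTangents (P θ₀) r₀) (altTangents (P θ₀) (hΛ.toLp Λ) τ r₁) α
        (clippedTest (P θ₀) Λ ((r₁ - r₀) / τ) c' c'' r₀ u) ∧
      (∀ δ : TestSeq Ω,
        IsMaxminTest law (nullTangents (P θ₀) r₀) (altTangents (P θ₀) (hΛ.toLp Λ) τ r₁) α δ →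
          AsyEqual (P θ₀) δ (clippedTest (P θ₀) Λ ((r₁ - r₀) / τ) c' c'' r₀ u)) ∧
      (⨅ g ∈ altTangents (P θ₀) (hΛ.toLp Λ) τ r₁,
          asyPower (clippedTest (P θ₀) Λ ((r₁ - r₀) / τ) c' c'' r₀ u) (law g)) =
        ENNReal.ofReal (cdf (gaussianReal 0 1)
          (-u + τ * clippedNorm (P θ₀) Λ ((r₁ - r₀) / τ) c' c'')) ∧
      -- b) coincidence with the test based on least favorable probability pairs, and its optimality
      (∃ φ : TestSeq Ω, IsRobustAsyTest (fun n => contaminationNhd (P θ₀) (r₀ / √n))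
        (fun n => contaminationNhd (P (θ₀ + τ / √n)) (r₁ / √n)) α φ) ∧
      (∀ φ : TestSeq Ω, IsRobustAsyTest (fun n => contaminationNhd (P θ₀) (r₀ / √n))
          (fun n => contaminationNhd (P (θ₀ + τ / √n)) (r₁ / √n)) α φ →
        AsyEqual (P θ₀) φ (clippedTest (P θ₀) Λ ((r₁ - r₀) / τ) c' c'' r₀ u)) ∧
      IsAsyMaxminOver (fun n => contaminationNhd (P θ₀) (r₀ / √n))
        (fun n => contaminationNhd (P (θ₀ + τ / √n)) (r₁ / √n)) α
        (clippedTest (P θ₀) Λ ((r₁ - r₀) / τ) c' c'' r₀ u) := by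
  have i0 : IsProbabilityMeasure (P θ₀) := hP θ₀ hθ₀
  obtain ⟨c', c'', D⟩ := exists_clipData hΛm hΛ hΛ0 hτ hr₀ hr₁ hr
  have hlaw' : IsLocalLaw (P θ₀) law := hlaw
  have hα : α = normalCdf (-u) := hu.symm
  -- Only parameters in `Θ` give probabilities, and `θ₀ + τ/√n` lies in the open set `Θ` from some
  -- `n` on.
  have hQ : ∀ᶠ n : ℕ in atTop, IsProbabilityMeasure (P (θ₀ + τ / √n)) := by
    have hlim : Tendsto (fun n : ℕ => θ₀ + τ / √(n : ℝ)) atTop (𝓝 θ₀) := by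
      have := (tendsto_inv_sqrt_natCast.const_mul τ).const_add θ₀
      simp only [mul_zero, add_zero] at this
      exact this.congr fun n => by rw [div_eq_mul_inv]
    filter_upwards [hlim.eventually (hΘ.mem_nhds hθ₀)] with n hn using hP _ hn
  -- The link between a) and b): the extremal member of the alternative neighborhood has tangent
  -- `q₁`, as the extremal null member has `q₀`.
  have hT := D.hasTangent_altLaw hQ hdiff
  have hE := D.extremalPair hQ
  rw [hα]
  refine ⟨c', c'', D.low, D.high, D.moment_equations_iff, ?_⟩
  rw [← D.npTest_eq_clippedTest u]
  refine ⟨⟨D.nullLp, D.altLp, D.coeFn_nullLp, D.coeFn_altLp,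
    D.isLeastFavorableTangentPair_iff hlaw' u hΛ, D.isMinNormPair_iff hΛ, fun n => ?_,
    D.isSaddlePoint hlaw' u hΛ⟩, D.isMaxminTest hlaw' u hΛ,
    fun δ hδ => D.asyEqual_of_isMaxminTest hlaw' u hΛ hδ, D.iInf_asyPower_npTest hlaw' u hΛ,
    ?_, fun φ hφ => ?_, D.tiltData.isAsyMaxminOver u hE hT⟩
  · rw [D.npTest_eq_clippedTest u]
    exact D.tangentTest_ae_eq u n
  · exact exists_isRobustAsyTest hE.prob₀ (eventually_exists_isLeastFavorablePair hQ
      (hΛm.const_mul τ) (hΛ.const_mul τ) hdiff hr₀ hr₁ hr) (normalCdf_pos _).le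
      (normalCdf_lt_one _).le
  · exact D.tiltData.asyEqual_npTest u fun η hη =>
      D.tiltData.tendsto_of_isRobustAsyTest u hE hT hφ hη
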